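/- Let $m$ be Lebesgue measure on $[0,1]$ and, for a measurable $x:[0,1]\to\mathbb R$ (functions equal a.e. are identified), let $x^*(t)=\inf\{s\ge 0: m(\{|x|>s\})\le t\}$, $t>0$. Let $\Psi$ be the set of all increasing (i.e. non-decreasing), continuous, concave functions $\psi$ on $[0,1]$ with $\psi(0)=0$ and $\psi\not\equiv 0$. For $\psi\in\Psi$ the Lorentz space $\Lambda(\psi)$ is the space of all $x$ with $\|x\|_{\Lambda(\psi)}=\int_0^1 x^*(t)\,d\psi(t)<\infty$; the Marcinkiewicz space $M(\psi)$ is the space of all $x$ with $\|x\|_{M(\psi)}=\sup_{0<\tau\le 1}\frac1{\psi(\tau)}\int_0^\tau x^*(t)\,dt<\infty$; and $M(\psi)_0$ is the space of all $x\in M(\psi)$ with $\lim_{\tau\to0}\frac1{\psi(\tau)}\int_0^\tau x^*(t)\,dt=0$, with the norm of $M(\psi)$. Let $E$ be one of the spaces $\Lambda(\psi)$, $M(\psi)_0$, and let $p\ge1$. A bounded sequence $(x_n)$ in $E$ is a $p$-BS-sequence if every subsequence $(y_k)$ of it satisfies $\sup_{m\ge1} m^{-1/p}\big\|\sum_{k=1}^m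 y_k\big\|_E<\infty$. Let $\Gamma_{\rm i}(E)$ (respectively $\Gamma_{\rm iid}(E)$) be the set of all real $p\ge 1$ such that every weakly null sequence in $E$ of independent (respectively, independent identically distributed) random variables on $([0,1],m)$ has a subsequence which is a $p$-BS-sequence. Then, for every $\psi\in\Psi$, $$\Gamma_{\rm i}(\Lambda(\psi))=\Gamma_{\rm iid}(\Lambda(\psi))\qquad\text{and}\qquad \Gamma_{\rm i}(M(\psi)_0)=\Gamma_{\rm iid}(M(\psi)_0).$$ -/

import Mathlib

open MeasureTheory ProbabilityTheory Filter Topology Set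
open scoped unitInterval ENNReal

/-- `L0`: real measurable functions on `[0,1]` with Lebesgue measure, modulo a.e. equality. -/
abbrev L0 : Type := I →ₘ[(volume : Measure I)] ℝ

/-- The class `Ψ` of increasing continuous concave functions on `[0,1]` vanishing at `0`.
Only the values on `[0,1]` matter. The function is not identically zero (the formulas for the
two norms presuppose this). -/
structure Psi where
  toFun : ℝ → ℝ
  monotoneOn' : MonotoneOn toFun (Icc 0 1)
  continuousOn' : ContinuousOn toFun (Icc 0 1)
  concaveOn' : ConcaveOn ℝ (Icc 0 1) toFun
  map_zero' : toFun 0 = 0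
  ne_zero' : ∃ t ∈ Icc (0 : ℝ) 1, toFun t ≠ 0

namespace Psi

/-- The extension of `ψ` to `ℝ` which is constant on `(-∞, 0]` and on `[1, ∞)`, as a
Stieltjes function. -/
noncomputable def stieltjes (ψ : Psi) : StieltjesFunction ℝ where
  toFun t := ψ.toFun (projIcc (0 : ℝ) 1 zero_le_one t)
  mono' := fun _ _ h =>
    ψ.monotoneOn' (projIcc _ _ _ _).2 (projIcc _ _ _ _).2 (monotone_projIcc _ h)
  right_continuous' := fun t =>
    ((ψ.continuousOn'.domRestrict.comp continuous_projIcc).continuousAt (x := t)).continuousWithinAt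

/-- The Lebesgue–Stieltjes measure `dψ` (it is carried by `(0,1]`). -/
noncomputable def dMeasure (ψ : Psi) : Measure ℝ := ψ.stieltjes.measure

end Psi

/-- The non-increasing right-continuous rearrangement
`x*(t) = inf {s ≥ 0 : m {u ∈ [0,1] : |x u| > s} ≤ t}`, for `t > 0`. -/
noncomputable def rearrangement (x : L0) (t : ℝ) : ℝ :=
  sInf {s : ℝ | 0 ≤ s ∧ (volume : Measure I) {u : I | s < |x u|} ≤ ENNReal.ofReal t}

/-! ### The Lorentz space -/

/-- `∫₀¹ x* dψ`, with values in `[0, ∞]`. -/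
noncomputable def lorentzENorm (ψ : Psi) (x : L0) : ℝ≥0∞ :=
  ∫⁻ t in Ioc (0 : ℝ) 1, ENNReal.ofReal (rearrangement x t) ∂ψ.dMeasure

/-- The Lorentz space `Λ(ψ)`. -/
def lorentzSpace (ψ : Psi) : Set L0 := {x | lorentzENorm ψ x < ∞}

/-- The norm of `Λ(ψ)`. -/
noncomputable def lorentzNorm (ψ : Psi) (x : L0) : ℝ := (lorentzENorm ψ x).toReal

/-! ### The Marcinkiewicz space and its separable part -/

/-- `(1 / ψ(τ)) ∫₀^τ x*(t) dt`, for `0 < τ ≤ 1`, with values in `[0, ∞]`. -/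
noncomputable def marcinkiewiczRatio (ψ : Psi) (x : L0) (τ : ℝ) : ℝ≥0∞ :=
  (∫⁻ t in Ioc (0 : ℝ) τ, ENNReal.ofReal (rearrangement x t)) / ENNReal.ofReal (ψ.toFun τ)

/-- `sup_{0 < τ ≤ 1} (1 / ψ(τ)) ∫₀^τ x*(t) dt`, with values in `[0, ∞]`. -/
noncomputable def marcinkiewiczENorm (ψ : Psi) (x : L0) : ℝ≥0∞ :=
  ⨆ τ ∈ Ioc (0 : ℝ) 1, marcinkiewiczRatio ψ x τ

/-- The Marcinkiewicz space `M(ψ)`. -/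
def marcinkiewiczSpace (ψ : Psi) : Set L0 := {x | marcinkiewiczENorm ψ x < ∞}

/-- The norm of `M(ψ)`. -/
noncomputable def marcinkiewiczNorm (ψ : Psi) (x : L0) : ℝ := (marcinkiewiczENorm ψ x).toReal

/-- The separable part `M(ψ)₀` of `M(ψ)`; it carries the norm of `M(ψ)`. -/
def marcinkiewiczSpaceZero (ψ : Psi) : Set L0 :=
  {x | x ∈ marcinkiewiczSpace ψ ∧ Tendsto (marcinkiewiczRatio ψ x) (𝓝[>] 0) (𝓝 0)}

/-! ### Banach–Saks index sets

Below `E` is the underlying set of a space of (classes of) measurable functions on `[0,1]`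
and `N` is its norm (only the values of `N` on `E` matter). -/

/-- Weakly null sequences in `(E, N)`: sequences in `E` which every bounded linear functional
on `E` maps to a null sequence. Every linear functional on the linear subspace `E` of `L0` is the
restriction of a linear functional on `L0`, so the bounded functionals on `E` are described
by the linear functionals on `L0` which are bounded on `E`. -/
def WeaklyNull (E : Set L0) (N : L0 → ℝ) (x : ℕ → L0) : Prop :=
  (∀ n, x n ∈ E) ∧
    ∀ f : L0 →ₗ[ℝ] ℝ, (∃ C : ℝ, ∀ y ∈ E, |f y| ≤ C * N y) →
      Tendsto (fun n => f (x n)) atTop (𝓝 0)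

/-- `p`-BS-sequences: bounded sequences in `E` such that for all subsequences `y` one has
`sup_{m ≥ 1} m^{-1/p} ‖y₁ + ⋯ + y_m‖ < ∞`. -/
def IsBSSequence (E : Set L0) (N : L0 → ℝ) (p : ℝ) (x : ℕ → L0) : Prop :=
  (∀ n, x n ∈ E) ∧ (∃ C : ℝ, ∀ n, N (x n) ≤ C) ∧
    ∀ θ : ℕ → ℕ, StrictMono θ →
      ∃ C : ℝ, ∀ m : ℕ, 1 ≤ m →
        (m : ℝ) ^ (-(1 / p)) * N (∑ k ∈ Finset.range m, x (θ k)) ≤ C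

/-- The sequence `x` contains (as a subsequence) a `p`-BS-sequence. -/
def ContainsBSSequence (E : Set L0) (N : L0 → ℝ) (p : ℝ) (x : ℕ → L0) : Prop :=
  ∃ θ : ℕ → ℕ, StrictMono θ ∧ IsBSSequence E N p (fun n => x (θ n))

/-- The terms of `x` are (mutually) independent random variables on `[0,1]`. -/
def IsIndepSeq (x : ℕ → L0) : Prop :=
  iIndepFun (fun n => (x n : I → ℝ)) (volume : Measure I)

/-- The terms of `x` are independent identically distributed random variables on `[0,1]`. -/
def IsIIDSeq (x : ℕ → L0) : Prop :=
  IsIndepSeq x ∧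
    ∀ n, IdentDistrib (x n : I → ℝ) (x 0 : I → ℝ) (volume : Measure I) (volume : Measure I)

/-- `Γ_i(E)`: all `p ≥ 1` such that each weakly null sequence of independent random variables
contains a `p`-BS-sequence. -/
def GammaI (E : Set L0) (N : L0 → ℝ) : Set ℝ :=
  {p | 1 ≤ p ∧ ∀ x : ℕ → L0, WeaklyNull E N x → IsIndepSeq x → ContainsBSSequence E N p x}

/-- `Γ_iid(E)`: all `p ≥ 1` such that each weakly null sequence of independent identically
distributed random variables contains a `p`-BS-sequence. -/
def GammaIid (E : Set L0) (N : L0 → ℝ) : Set ℝ :=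
  {p | 1 ≤ p ∧ ∀ x : ℕ → L0, WeaklyNull E N x → IsIIDSeq x → ContainsBSSequence E N p x}

/-! One inclusion is immediate, since iid sequences are independent. For the other, let p belong to
the iid index set and let (x n) be weakly null and independent.

Both norms are suprema of mixtures of the functionals f ↦ ∫₀^τ f* (`mixNorm`). Hence they are
subadditive, have the Fatou property, and decrease whenever the means of (|f| - s)⁺ decrease for all
s. The spaces consist exactly of the functions whose upper truncations vanish in norm (`HasOCNorm`).
The one exception is M(ψ)₀ with t/ψ(t) bounded below, which is {0}.

Pass to a subsequence along which the dyadic quantiles of |x n| converge to numbers c j, and cut the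
n-th term at its quantile of order 2^{-(n+1)}. The lower parts are dominated in distribution by a
single symmetric law with dyadic quantiles c j + 1, and by Fatou this law has finite norm. By
symmetrization (`mixNorm_sum_centred_le`) the sums of the centred lower parts are at most twice the
sums of iid variables U k with this law. In M(ψ)₀ these variables need not have order continuous
norm, so the hypothesis on p does not apply to them directly. `rpow_bound_of_mem_gammaIid` bridges
the gap: if their sums grew faster than m^{1/p}, damping the large values by sparsely placed weights
2^{-j} would give an iid symmetric sequence inside the space that still violates the bound. Such a
sequence is weakly null because suitable signed averages are small in norm (`weaklyNull_of_symm`).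

The upper parts have supports of measure tending to zero, and `SmallSupportProperty` gives a
subsequence of them with bounded sums of absolute values. This also bounds the sums of the means of
the lower parts, as the means of x n tend to zero. In M(ψ)₀ the property is a gliding hump of c₀
type (`exists_subseq_tsum_le`). In Λ(ψ) the upper parts tend to zero in norm (`lorentz_excess_le`):
otherwise bounded functions h k of x k which nearly norm the upper parts could be glued into one
bounded functional. Independence factors the cross terms and makes them small, so this functional
stays away from zero on a subsequence, against weak nullity. -/

/-! ### The functional `∫₀^τ f*` and norms generated by it -/

section KFun

variable {Ω : Type*} [MeasurableSpace Ω] {P : Measure Ω} {f g : Ω → ℝ}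

/-- `∫₀^τ f*(t) dt`, written in terms of the distribution function of `|f|`. -/
noncomputable def kFun (P : Measure Ω) (f : Ω → ℝ) (τ : ℝ) : ℝ≥0∞ :=
  ∫⁻ s in Ioi (0 : ℝ), min (P {ω | s < |f ω|}) (ENNReal.ofReal τ)

lemma setLIntegral_Ioi_add (F : ℝ → ℝ≥0∞) (s : ℝ) :
    ∫⁻ u in Ioi 0, F (u + s) = ∫⁻ u in Ioi s, F u := by
  rw [← lintegral_indicator measurableSet_Ioi, ← lintegral_indicator measurableSet_Ioi,
    ← lintegral_add_right_eq_self (μ := volume) ((Ioi s).indicator F) s]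
  congr 1
  ext u
  by_cases h : 0 < u <;> simp [Set.indicator, h]

lemma lintegral_excess (hf : AEMeasurable f P) (s : ℝ) :
    ∫⁻ ω, ENNReal.ofReal (|f ω| - s) ∂P = ∫⁻ u in Ioi s, P {ω | u < |f ω|} := by
  have h1 : ∫⁻ ω, ENNReal.ofReal (|f ω| - s) ∂P
      = ∫⁻ ω, ENNReal.ofReal (max (|f ω| - s) 0) ∂P := by
    refine lintegral_congr fun ω => ?_
    rcases le_total (|f ω| - s) 0 with h | h
    · rw [max_eq_right h, ENNReal.ofReal_of_nonpos h, ENNReal.ofReal_zero]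
    · rw [max_eq_left h]
  have hm : AEMeasurable (fun ω => max (|f ω| - s) 0) P := by
    have : AEMeasurable (fun ω => |f ω|) P := hf.abs
    fun_prop
  rw [h1, lintegral_eq_lintegral_meas_lt P (f := fun ω => max (|f ω| - s) 0)
      (ae_of_all _ fun ω => le_max_right _ _) hm,
    ← setLIntegral_Ioi_add _ s]
  refine setLIntegral_congr_fun measurableSet_Ioi fun u hu => ?_
  simp only [mem_Ioi] at hu
  congr 1
  ext ω
  simp only [mem_ofPred_eq, lt_max_iff, not_lt.2 hu.le, or_false]
  constructor <;> intro h <;> linarith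

lemma lintegral_abs (hf : AEMeasurable f P) :
    ∫⁻ ω, ENNReal.ofReal |f ω| ∂P = ∫⁻ u in Ioi 0, P {ω | u < |f ω|} := by
  simpa using lintegral_excess (P := P) hf 0

/-- The minimum is bounded by τ at levels below s and by the tail above s. With `exists_kFun_eq`
this is the variational formula ∫₀^τ f* = min over s of sτ + E(|f| - s)⁺ (the K-functional of L¹ and
L^∞), from which subadditivity, homogeneity and comparison follow. -/
lemma kFun_le (hf : AEMeasurable f P) {s : ℝ} (hs : 0 ≤ s) (τ : ℝ) :
    kFun P f τ ≤ ENNReal.ofReal s * ENNReal.ofReal τ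
      + ∫⁻ ω, ENNReal.ofReal (|f ω| - s) ∂P := by
  rw [lintegral_excess hf s, kFun, ← Ioc_union_Ioi_eq_Ioi hs,
    lintegral_union measurableSet_Ioi (Set.Ioc_disjoint_Ioi le_rfl)]
  gcongr
  · calc _ ≤ ∫⁻ u in Ioc 0 s, ENNReal.ofReal τ := by
          gcongr; exact min_le_right _ _
      _ = _ := by simp [mul_comm]
  · exact min_le_left _ _

lemma tendsto_measure_lt_abs [IsFiniteMeasure P] (hf : AEMeasurable f P) :
    Tendsto (fun n : ℕ => P {ω | (n : ℝ) < |f ω|}) atTop (𝓝 0) := by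
  have h := tendsto_measure_iInter_atTop (μ := P) (s := fun n : ℕ => {ω | (n : ℝ) < |f ω|})
    (fun n => nullMeasurableSet_lt aemeasurable_const hf.abs)
    (fun a b hab ω (hω : (b : ℝ) < _) => lt_of_le_of_lt (by exact_mod_cast hab) hω)
    ⟨0, measure_ne_top _ _⟩
  have he : ⋂ n : ℕ, {ω | (n : ℝ) < |f ω|} = ∅ := by
    ext ω
    simp only [mem_iInter, mem_ofPred_eq, mem_empty_iff_false, iff_false, not_forall, not_lt]
    exact exists_nat_ge _
  simpa [he, Function.comp_def] using h

lemma exists_measure_lt_abs_le [IsFiniteMeasure P] (hf : AEMeasurable f P) {ε : ℝ≥0∞}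
    (hε : 0 < ε) : ∃ s : ℝ, 0 ≤ s ∧ P {ω | s < |f ω|} ≤ ε := by
  obtain ⟨n, hn⟩ := ((tendsto_measure_lt_abs hf).eventually_le_const hε).exists
  exact ⟨n, by positivity, hn⟩

/-- The optimal level is s = f*(τ): the tail exceeds τ below it and is at most τ above it, so the
minimum splits exactly there. -/
lemma exists_kFun_eq [IsFiniteMeasure P] (hf : AEMeasurable f P) {τ : ℝ} (hτ : 0 < τ) :
    ∃ s : ℝ, 0 ≤ s ∧ kFun P f τ = ENNReal.ofReal s * ENNReal.ofReal τ
      + ∫⁻ ω, ENNReal.ofReal (|f ω| - s) ∂P := by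
  set S : Set ℝ := {s | 0 ≤ s ∧ P {ω | s < |f ω|} ≤ ENNReal.ofReal τ}
  have hne : S.Nonempty := exists_measure_lt_abs_le hf (ENNReal.ofReal_pos.2 hτ)
  have hbd : BddBelow S := ⟨0, fun s hs => hs.1⟩
  have h0 : 0 ≤ sInf S := le_csInf hne fun s hs => hs.1
  refine ⟨sInf S, h0, le_antisymm (kFun_le hf h0 τ) ?_⟩
  rw [lintegral_excess hf (sInf S), kFun, ← Ioc_union_Ioi_eq_Ioi h0,
    lintegral_union measurableSet_Ioi (Set.Ioc_disjoint_Ioi le_rfl)]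
  gcongr ?_ + ?_
  · calc _ = ∫⁻ u in Ioo 0 (sInf S), ENNReal.ofReal τ := by simp [mul_comm]
      _ ≤ ∫⁻ u in Ioo 0 (sInf S), min (P {ω | u < |f ω|}) (ENNReal.ofReal τ) := by
          refine setLIntegral_mono' measurableSet_Ioo fun u hu => ?_
          refine le_min ?_ le_rfl
          by_contra! hcon
          exact not_lt.2 (csInf_le hbd (⟨hu.1.le, hcon.le⟩ : u ∈ S)) hu.2
      _ ≤ _ := lintegral_mono_set Ioo_subset_Ioc_self
  · refine setLIntegral_mono' measurableSet_Ioi fun u hu => ?_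
    refine le_min le_rfl ?_
    obtain ⟨s, hs, hsu⟩ := exists_lt_of_csInf_lt hne hu
    exact (measure_mono fun ω (hω : u < _) => hsu.trans hω).trans hs.2

lemma kFun_of_nonpos {τ : ℝ} (hτ : τ ≤ 0) : kFun P f τ = 0 := by
  simp [kFun, ENNReal.ofReal_of_nonpos hτ]

variable {Ω' : Type*} [MeasurableSpace Ω'] {P' : Measure Ω'} {f' : Ω' → ℝ}

/-- Domination of `(|f| - s)⁺` in mean for all levels `s` implies domination of `∫₀^τ f*`. -/
lemma kFun_le_of_excess_le [IsFiniteMeasure P'] (hf : AEMeasurable f P) (hg : AEMeasurable f' P')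
    (h : ∀ s : ℝ, 0 ≤ s → ∫⁻ ω, ENNReal.ofReal (|f ω| - s) ∂P
      ≤ ∫⁻ ω, ENNReal.ofReal (|f' ω| - s) ∂P') (τ : ℝ) :
    kFun P f τ ≤ kFun P' f' τ := by
  rcases le_or_gt τ 0 with hτ | hτ
  · simp [kFun_of_nonpos hτ]
  obtain ⟨s, hs, he⟩ := exists_kFun_eq hg hτ
  rw [he]
  refine (kFun_le hf hs τ).trans ?_
  exact add_le_add le_rfl (h s hs)

lemma kFun_mono_dist (h : ∀ s : ℝ, 0 < s → P {ω | s < |f ω|} ≤ P' {ω | s < |f' ω|}) (τ : ℝ) :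
    kFun P f τ ≤ kFun P' f' τ :=
  setLIntegral_mono' measurableSet_Ioi fun u hu => min_le_min (h u hu) le_rfl

lemma kFun_mono (h : ∀ᵐ ω ∂P, |f ω| ≤ |g ω|) (τ : ℝ) : kFun P f τ ≤ kFun P g τ := by
  refine kFun_mono_dist (fun s _ => measure_mono_ae ?_) τ
  filter_upwards [h] with ω hω hs
  exact lt_of_lt_of_le hs hω

lemma kFun_mono_right (P : Measure Ω) (f : Ω → ℝ) : Monotone (kFun P f) := fun a b hab => by
  unfold kFun
  gcongr

lemma measurable_kFun (P : Measure Ω) (f : Ω → ℝ) : Measurable (kFun P f) :=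
  (kFun_mono_right P f).measurable

/-- If s and t are the optimal levels of f and g, then s + t is an admissible level for f + g. -/
lemma kFun_add_le [IsFiniteMeasure P] (hf : AEMeasurable f P) (hg : AEMeasurable g P) (τ : ℝ) :
    kFun P (fun ω => f ω + g ω) τ ≤ kFun P f τ + kFun P g τ := by
  rcases le_or_gt τ 0 with hτ | hτ
  · simp [kFun_of_nonpos hτ]
  obtain ⟨s, hs, he⟩ := exists_kFun_eq hf hτ
  obtain ⟨t, ht, he'⟩ := exists_kFun_eq hg hτ
  rw [he, he']
  refine (kFun_le (hf.add hg) (add_nonneg hs ht) τ).trans ?_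
  rw [ENNReal.ofReal_add hs ht, add_mul, add_add_add_comm]
  refine add_le_add le_rfl ?_
  have hm : AEMeasurable (fun ω => ENNReal.ofReal (|f ω| - s)) P := by
    have : AEMeasurable (fun ω => |f ω|) P := hf.abs
    fun_prop
  rw [← lintegral_add_left' hm]
  gcongr with ω
  rcases le_total (|f ω + g ω| - (s + t)) 0 with h | h
  · simp [ENNReal.ofReal_of_nonpos h]
  refine le_trans (ENNReal.ofReal_le_ofReal ?_) ENNReal.ofReal_add_le
  rw [Pi.add_apply]
  linarith [abs_add_le (f ω) (g ω)]

lemma kFun_const_mul_le [IsFiniteMeasure P] (hf : AEMeasurable f P) (c τ : ℝ) :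
    kFun P (fun ω => c * f ω) τ ≤ ENNReal.ofReal |c| * kFun P f τ := by
  rcases le_or_gt τ 0 with hτ | hτ
  · simp [kFun_of_nonpos hτ]
  obtain ⟨s, hs, he⟩ := exists_kFun_eq hf hτ
  rw [he]
  refine (kFun_le (hf.const_mul c) (mul_nonneg (abs_nonneg c) hs) τ).trans ?_
  rw [ENNReal.ofReal_mul (abs_nonneg c), mul_add, mul_assoc,
    ← lintegral_const_mul' _ _ ENNReal.ofReal_ne_top]
  gcongr with ω
  rw [abs_mul, ← mul_sub, ENNReal.ofReal_mul (abs_nonneg c)]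

lemma kFun_one (hf : AEMeasurable f P) [IsProbabilityMeasure P] :
    kFun P f 1 = ∫⁻ ω, ENNReal.ofReal |f ω| ∂P := by
  rw [lintegral_abs hf, kFun]
  refine setLIntegral_congr_fun measurableSet_Ioi fun u _ => ?_
  simpa using prob_le_one

lemma kFun_le_lintegral_abs (hf : AEMeasurable f P) (τ : ℝ) :
    kFun P f τ ≤ ∫⁻ ω, ENNReal.ofReal |f ω| ∂P := by
  simpa using kFun_le (P := P) hf le_rfl τ

/-- If `f` is bounded by `c` and vanishes off a set of measure at most `δ`, then
`∫₀^τ f* ≤ c min(δ, τ)`. -/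
lemma kFun_le_of_abs_le {c : ℝ} (hfc : ∀ᵐ ω ∂P, |f ω| ≤ c) {δ : ℝ≥0∞}
    (hδ : P {ω | f ω ≠ 0} ≤ δ) (τ : ℝ) :
    kFun P f τ ≤ ENNReal.ofReal c * min δ (ENNReal.ofReal τ) := by
  have h0 : ∀ u : ℝ, c ≤ u → P {ω | u < |f ω|} = 0 := fun u hu => by
    rw [← nonpos_iff_eq_zero, ← ae_iff.1 hfc]
    exact measure_mono fun ω (hω : u < |f ω|) => not_le.2 (lt_of_le_of_lt hu hω)
  calc kFun P f τ ≤ ∫⁻ s in Ioi (0 : ℝ), (Ioc 0 c).indicator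
        (fun _ => min δ (ENNReal.ofReal τ)) s := by
        refine setLIntegral_mono' measurableSet_Ioi fun u (hu : 0 < u) => ?_
        rcases le_total c u with h | h
        · simp [h0 u h]
        · rw [indicator_of_mem (show u ∈ Ioc 0 c from ⟨hu, h⟩)]
          refine min_le_min (le_trans (measure_mono fun ω (hω : u < |f ω|) => ?_) hδ) le_rfl
          exact abs_pos.1 (hu.trans hω)
    _ ≤ ∫⁻ s, (Ioc 0 c).indicator (fun _ => min δ (ENNReal.ofReal τ)) s :=
        setLIntegral_le_lintegral _ _
    _ = _ := by simp [lintegral_indicator, mul_comm]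

/-- The rearrangement vanishes beyond δ, so integrating further adds nothing. -/
lemma kFun_le_of_measure_support_le {τ δ : ℝ} (hδ : P {ω | f ω ≠ 0} ≤ ENNReal.ofReal δ) :
    kFun P f τ ≤ kFun P f δ := by
  refine setLIntegral_mono' measurableSet_Ioi fun u (hu : 0 < u) => ?_
  refine le_min (min_le_left _ _) ((min_le_left _ _).trans (le_trans (measure_mono ?_) hδ))
  exact fun ω (hω : u < |f ω|) => abs_pos.1 (hu.trans hω)

/-- Since c ≥ 1, it may multiply τ as well as the tail and so comes out of the minimum; the rest is
Fatou's lemma in the level s. -/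
lemma kFun_le_of_dist_le_liminf {F : ℕ → Ω' → ℝ} {c : ℝ≥0∞} (hc : 1 ≤ c) (hc' : c ≠ ∞)
    (h : ∀ s : ℝ, 0 < s → P {ω | s < |f ω|}
      ≤ c * liminf (fun n => P' {ω | s < |F n ω|}) atTop) (τ : ℝ) :
    kFun P f τ ≤ c * liminf (fun n => kFun P' (F n) τ) atTop := by
  have hmeas : ∀ n, Measurable fun s : ℝ => min (P' {ω | s < |F n ω|}) (ENNReal.ofReal τ) :=
    fun n => Antitone.measurable fun a b hab => min_le_min
      (measure_mono fun ω (hω : b < _) => lt_of_le_of_lt hab hω) le_rfl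
  calc kFun P f τ ≤ ∫⁻ s in Ioi (0 : ℝ), c * liminf
        (fun n => min (P' {ω | s < |F n ω|}) (ENNReal.ofReal τ)) atTop := by
        refine setLIntegral_mono' measurableSet_Ioi fun s hs => ?_
        have : liminf (fun n => min (P' {ω | s < |F n ω|}) (ENNReal.ofReal τ)) atTop
            = min (liminf (fun n => P' {ω | s < |F n ω|}) atTop) (ENNReal.ofReal τ) := by
          simpa using liminf_min (u := fun n => P' {ω | s < |F n ω|})
            (v := fun _ => ENNReal.ofReal τ) (f := atTop)
        rw [this, mul_min]
        refine min_le_min (h s hs) ?_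
        calc ENNReal.ofReal τ = 1 * ENNReal.ofReal τ := (one_mul _).symm
          _ ≤ _ := by gcongr
    _ = c * ∫⁻ s in Ioi (0 : ℝ), liminf
        (fun n => min (P' {ω | s < |F n ω|}) (ENNReal.ofReal τ)) atTop :=
        lintegral_const_mul' _ _ hc'
    _ ≤ _ := by
        gcongr
        exact lintegral_liminf_le hmeas

/-! ### Norms that are suprema of mixtures of the functionals `∫₀^τ f*` -/

/-- The supremum over `ν ∈ V` of the mixtures `∫ (∫₀^τ f*) dν(τ)`. -/
noncomputable def mixNorm (V : Set (Measure ℝ)) (P : Measure Ω) (f : Ω → ℝ) : ℝ≥0∞ :=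
  ⨆ ν ∈ V, ∫⁻ τ, kFun P f τ ∂ν

/-- The value of `mixNorm V` on the indicator function of a set of measure `δ`. -/
noncomputable def mixFundamental (V : Set (Measure ℝ)) (δ : ℝ≥0∞) : ℝ≥0∞ :=
  ⨆ ν ∈ V, ∫⁻ τ, min δ (ENNReal.ofReal τ) ∂ν

variable {V : Set (Measure ℝ)}

lemma mixNorm_le_mul_of_kFun_le {c : ℝ≥0∞}
    (h : ∀ τ, kFun P f τ ≤ c * kFun P' f' τ) : mixNorm V P f ≤ c * mixNorm V P' f' := by
  refine iSup₂_le fun ν hν => ?_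
  calc ∫⁻ τ, kFun P f τ ∂ν ≤ ∫⁻ τ, c * kFun P' f' τ ∂ν := lintegral_mono h
    _ = c * ∫⁻ τ, kFun P' f' τ ∂ν := lintegral_const_mul _ (measurable_kFun _ _)
    _ ≤ _ := by
      gcongr
      exact le_iSup₂ (f := fun ν _ => ∫⁻ τ, kFun P' f' τ ∂ν) ν hν

lemma mixNorm_le_of_kFun_le (h : ∀ τ, kFun P f τ ≤ kFun P' f' τ) :
    mixNorm V P f ≤ mixNorm V P' f' := by
  simpa using mixNorm_le_mul_of_kFun_le (V := V) (c := 1) (by simpa using h)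

lemma mixNorm_mono (h : ∀ᵐ ω ∂P, |f ω| ≤ |g ω|) : mixNorm V P f ≤ mixNorm V P g :=
  mixNorm_le_of_kFun_le (kFun_mono h)

lemma mixNorm_congr (h : f =ᵐ[P] g) : mixNorm V P f = mixNorm V P g :=
  le_antisymm (mixNorm_mono (h.mono fun ω hω => by rw [hω]))
    (mixNorm_mono (h.mono fun ω hω => by rw [hω]))

lemma mixNorm_mono_dist (h : ∀ s : ℝ, 0 < s → P {ω | s < |f ω|} ≤ P' {ω | s < |f' ω|}) :
    mixNorm V P f ≤ mixNorm V P' f' :=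
  mixNorm_le_of_kFun_le (kFun_mono_dist h)

lemma mixNorm_add_le [IsFiniteMeasure P] (hf : AEMeasurable f P) (hg : AEMeasurable g P) :
    mixNorm V P (fun ω => f ω + g ω) ≤ mixNorm V P f + mixNorm V P g := by
  refine iSup₂_le fun ν hν => ?_
  calc ∫⁻ τ, kFun P (fun ω => f ω + g ω) τ ∂ν ≤ ∫⁻ τ, (kFun P f τ + kFun P g τ) ∂ν :=
        lintegral_mono (kFun_add_le hf hg)
    _ = ∫⁻ τ, kFun P f τ ∂ν + ∫⁻ τ, kFun P g τ ∂ν := lintegral_add_left (measurable_kFun _ _) _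
    _ ≤ _ := add_le_add (le_iSup₂ (f := fun ν _ => ∫⁻ τ, kFun P f τ ∂ν) ν hν)
        (le_iSup₂ (f := fun ν _ => ∫⁻ τ, kFun P g τ ∂ν) ν hν)

lemma mixNorm_const_mul_le [IsFiniteMeasure P] (hf : AEMeasurable f P) (c : ℝ) :
    mixNorm V P (fun ω => c * f ω) ≤ ENNReal.ofReal |c| * mixNorm V P f :=
  mixNorm_le_mul_of_kFun_le (kFun_const_mul_le hf c)

lemma mixNorm_const_mul [IsFiniteMeasure P] (hf : AEMeasurable f P) {c : ℝ} (hc : c ≠ 0) :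
    mixNorm V P (fun ω => c * f ω) = ENNReal.ofReal |c| * mixNorm V P f := by
  refine le_antisymm (mixNorm_const_mul_le hf c) ?_
  have h := mixNorm_const_mul_le (V := V) (hf.const_mul c) c⁻¹
  simp only [inv_mul_cancel_left₀ hc] at h
  calc _ ≤ ENNReal.ofReal |c| * (ENNReal.ofReal |c⁻¹| * mixNorm V P fun ω => c * f ω) := by gcongr
    _ = _ := by
      rw [← mul_assoc, ← ENNReal.ofReal_mul (abs_nonneg _), ← abs_mul, mul_inv_cancel₀ hc]
      simp

lemma mixNorm_abs : mixNorm V P (fun ω => |f ω|) = mixNorm V P f := by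
  simp [mixNorm, kFun]

lemma kFun_zero (τ : ℝ) : kFun P (fun _ => (0 : ℝ)) τ = 0 := by
  unfold kFun
  rw [setLIntegral_congr_fun (g := fun _ => 0) measurableSet_Ioi]
  · simp
  · intro s (hs : 0 < s)
    simp [hs.not_gt]

lemma mixNorm_zero : mixNorm V P (fun _ => (0 : ℝ)) = 0 := by
  simp [mixNorm, kFun_zero]

lemma mixNorm_sum_le [IsFiniteMeasure P] {ι : Type*} (s : Finset ι) {F : ι → Ω → ℝ}
    (hF : ∀ i, AEMeasurable (F i) P) :
    mixNorm V P (fun ω => ∑ i ∈ s, F i ω) ≤ ∑ i ∈ s, mixNorm V P (F i) := by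
  classical
  induction s using Finset.induction_on with
  | empty => simp [mixNorm_zero]
  | insert a s ha ih =>
    simp only [Finset.sum_insert ha]
    refine (mixNorm_add_le (hF a) (Finset.aemeasurable_fun_sum _ fun i _ => hF i)).trans ?_
    gcongr

lemma mixNorm_le_of_abs_le {c : ℝ} (hfc : ∀ᵐ ω ∂P, |f ω| ≤ c) {δ : ℝ≥0∞}
    (hδ : P {ω | f ω ≠ 0} ≤ δ) :
    mixNorm V P f ≤ ENNReal.ofReal c * mixFundamental V δ := by
  refine iSup₂_le fun ν hν => ?_
  calc ∫⁻ τ, kFun P f τ ∂ν ≤ ∫⁻ τ, ENNReal.ofReal c * min δ (ENNReal.ofReal τ) ∂ν :=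
        lintegral_mono (kFun_le_of_abs_le hfc hδ)
    _ = ENNReal.ofReal c * ∫⁻ τ, min δ (ENNReal.ofReal τ) ∂ν :=
        lintegral_const_mul' _ _ ENNReal.ofReal_ne_top
    _ ≤ _ := by
      gcongr
      exact le_iSup₂ (f := fun ν _ => ∫⁻ τ, min δ (ENNReal.ofReal τ) ∂ν) ν hν

lemma mixNorm_le_of_dist_le_liminf {F : ℕ → Ω' → ℝ} {c : ℝ≥0∞} (hc : 1 ≤ c) (hc' : c ≠ ∞)
    (h : ∀ s : ℝ, 0 < s → P {ω | s < |f ω|}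
      ≤ c * liminf (fun n => P' {ω | s < |F n ω|}) atTop) :
    mixNorm V P f ≤ c * liminf (fun n => mixNorm V P' (F n)) atTop := by
  refine iSup₂_le fun ν hν => ?_
  calc ∫⁻ τ, kFun P f τ ∂ν
      ≤ ∫⁻ τ, c * liminf (fun n => kFun P' (F n) τ) atTop ∂ν :=
        lintegral_mono (kFun_le_of_dist_le_liminf hc hc' h)
    _ = c * ∫⁻ τ, liminf (fun n => kFun P' (F n) τ) atTop ∂ν :=
        lintegral_const_mul' _ _ hc'
    _ ≤ c * liminf (fun n => ∫⁻ τ, kFun P' (F n) τ ∂ν) atTop := by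
        gcongr
        exact lintegral_liminf_le fun n => measurable_kFun _ _
    _ ≤ _ := by
        gcongr c * ?_
        refine liminf_le_liminf (Eventually.of_forall fun n => ?_)
        exact le_iSup₂ (f := fun ν _ => ∫⁻ τ, kFun P' (F n) τ ∂ν) ν hν

/-- The Fatou property. -/
lemma mixNorm_le_liminf (hf : Measurable f) {F : ℕ → Ω → ℝ} (hF : ∀ n, Measurable (F n))
    (h : ∀ᵐ ω ∂P, Tendsto (fun n => F n ω) atTop (𝓝 (f ω))) :
    mixNorm V P f ≤ liminf (fun n => mixNorm V P (F n)) atTop := by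
  have key := mixNorm_le_of_dist_le_liminf (V := V) (P := P) (P' := P) (f := f) (F := F)
    (c := 1) le_rfl ENNReal.one_ne_top ?_
  · simpa using key
  intro s _
  have hms : ∀ n, MeasurableSet {ω | s < |F n ω|} := fun n =>
    measurableSet_lt measurable_const (hF n).abs
  rw [one_mul]
  calc P {ω | s < |f ω|} ≤ ∫⁻ ω, {ω | s < |f ω|}.indicator 1 ω ∂P := by
        rw [lintegral_indicator_one (measurableSet_lt measurable_const hf.abs)]
    _ ≤ ∫⁻ ω, liminf (fun n => {ω | s < |F n ω|}.indicator 1 ω) atTop ∂P := by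
        refine lintegral_mono_ae (h.mono fun ω hω => ?_)
        by_cases hs : s < |f ω|
        · have : ∀ᶠ n in atTop, s < |F n ω| := hω.abs.eventually_const_lt hs
          refine le_liminf_of_le (by isBoundedDefault) (this.mono fun n hn => ?_)
          simp [Set.indicator, hs, hn]
        · simp [Set.indicator, hs]
    _ ≤ liminf (fun n => ∫⁻ ω, {ω | s < |F n ω|}.indicator 1 ω ∂P) atTop :=
        lintegral_liminf_le fun n => measurable_one.indicator (hms n)
    _ = _ := by simp_rw [lintegral_indicator_one (hms _)]

end KFun

/-! ### Comparison of sums of independent random variables -/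

lemma excess_convex (s : ℝ) {a b : ℝ} (ha : 0 ≤ a) (hb : 0 ≤ b) (hab : a + b = 1) (y z : ℝ) :
    max (|a * y + b * z| - s) 0 ≤ a * max (|y| - s) 0 + b * max (|z| - s) 0 := by
  have h1 : |a * y + b * z| ≤ a * |y| + b * |z| := by
    refine (abs_add_le _ _).trans ?_
    rw [abs_mul, abs_mul, abs_of_nonneg ha, abs_of_nonneg hb]
  have h2 := mul_le_mul_of_nonneg_left (le_max_left (|y| - s) 0) ha
  have h3 := mul_le_mul_of_nonneg_left (le_max_left (|z| - s) 0) hb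
  have h4 := mul_nonneg ha (le_max_right (|y| - s) 0)
  have h5 := mul_nonneg hb (le_max_right (|z| - s) 0)
  have h6 : s = a * s + b * s := by rw [← add_mul, hab, one_mul]
  refine max_le ?_ (by linarith)
  linarith [mul_sub a |y| s, mul_sub b |z| s]

/-- The even part (up to a factor) of a translate of `(|·| - s)⁺`. -/
def evenExcess (b s u : ℝ) : ℝ := max (|b + u| - s) 0 + max (|b - u| - s) 0

lemma evenExcess_nonneg (b s u : ℝ) : 0 ≤ evenExcess b s u :=
  add_nonneg (le_max_right _ _) (le_max_right _ _)

lemma continuous_evenExcess (b s : ℝ) : Continuous (evenExcess b s) := by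
  unfold evenExcess
  fun_prop

/-- An even convex function increases with |u|: for r = u/v in [-1,1], the points b ± u are convex
combinations of b ± v with weights (1 ± r)/2. -/
lemma evenExcess_mono (b s : ℝ) {u v : ℝ} (h : |u| ≤ |v|) :
    evenExcess b s u ≤ evenExcess b s v := by
  rcases eq_or_ne v 0 with rfl | hv
  · simp at h
    simp [h]
  set r := u / v
  have hr : |r| ≤ 1 := by
    rw [abs_div]
    exact div_le_one_of_le₀ h (abs_nonneg _)
  have hu : u = r * v := by simp [r, hv]
  obtain ⟨h1, h2⟩ := abs_le.1 hr
  have k1 := excess_convex s (a := (1 + r) / 2) (b := (1 - r) / 2) (by linarith) (by linarith)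
    (by ring) (b + v) (b - v)
  have k2 := excess_convex s (a := (1 - r) / 2) (b := (1 + r) / 2) (by linarith) (by linarith)
    (by ring) (b + v) (b - v)
  have e1 : (1 + r) / 2 * (b + v) + (1 - r) / 2 * (b - v) = b + u := by rw [hu]; ring
  have e2 : (1 - r) / 2 * (b + v) + (1 + r) / 2 * (b - v) = b - u := by rw [hu]; ring
  rw [e1] at k1
  rw [e2] at k2
  unfold evenExcess
  linarith

/-- An even convex H satisfies H(u - v) ≤ H(|u| + |v|) ≤ (H(2u) + H(2v))/2. This separates the two
copies in a symmetrization, at the price of doubling the argument. -/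
lemma evenExcess_sub_le (b s u v : ℝ) :
    2 * evenExcess b s (u - v) ≤ evenExcess b s (2 * u) + evenExcess b s (2 * v) := by
  have h1 : evenExcess b s (u - v) ≤ evenExcess b s (|u| + |v|) := by
    refine evenExcess_mono b s ?_
    rw [abs_of_nonneg (a := |u| + |v|) (by positivity)]
    exact abs_sub u v
  have h2 : evenExcess b s (2 * |u|) ≤ evenExcess b s (2 * u) :=
    evenExcess_mono b s (by simp [abs_mul])
  have h3 : evenExcess b s (2 * |v|) ≤ evenExcess b s (2 * v) :=
    evenExcess_mono b s (by simp [abs_mul])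
  have k1 := excess_convex s (a := 1 / 2) (b := 1 / 2) (by norm_num) (by norm_num)
    (by norm_num) (b + 2 * |u|) (b + 2 * |v|)
  have k2 := excess_convex s (a := 1 / 2) (b := 1 / 2) (by norm_num) (by norm_num)
    (by norm_num) (b - 2 * |u|) (b - 2 * |v|)
  have e1 : 1 / 2 * (b + 2 * |u|) + 1 / 2 * (b + 2 * |v|) = b + (|u| + |v|) := by ring
  have e2 : 1 / 2 * (b - 2 * |u|) + 1 / 2 * (b - 2 * |v|) = b - (|u| + |v|) := by ring
  rw [e1] at k1
  rw [e2] at k2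
  unfold evenExcess at *
  linarith

lemma ofReal_max_zero (x : ℝ) : ENNReal.ofReal (max x 0) = ENNReal.ofReal x := by
  rcases le_total x 0 with h | h
  · rw [max_eq_right h, ENNReal.ofReal_of_nonpos h, ENNReal.ofReal_zero]
  · rw [max_eq_left h]

lemma ofReal_evenExcess (b s u : ℝ) : ENNReal.ofReal (evenExcess b s u)
    = ENNReal.ofReal (|b + u| - s) + ENNReal.ofReal (|b - u| - s) := by
  rw [evenExcess, ENNReal.ofReal_add (le_max_right _ _) (le_max_right _ _), ofReal_max_zero,
    ofReal_max_zero]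

/-- Stochastic domination of `|·|` and even continuous functions which increase with `|·|`. -/
lemma lintegral_le_of_tail_le {μ β : Measure ℝ} [IsProbabilityMeasure μ] [IsProbabilityMeasure β]
    (h : ∀ s : ℝ, 0 ≤ s → μ {y | s < |y|} ≤ β {y | s < |y|}) {G : ℝ → ℝ} (hG0 : ∀ u, 0 ≤ G u)
    (hGc : Continuous G) (hG : ∀ u v, |u| ≤ |v| → G u ≤ G v) :
    ∫⁻ y, ENNReal.ofReal (G y) ∂μ ≤ ∫⁻ y, ENNReal.ofReal (G y) ∂β := by
  rw [lintegral_eq_lintegral_meas_lt μ (ae_of_all _ hG0) hGc.measurable.aemeasurable,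
    lintegral_eq_lintegral_meas_lt β (ae_of_all _ hG0) hGc.measurable.aemeasurable]
  refine lintegral_mono fun t => ?_
  -- T is a closed initial segment of [0,∞), so {t < G} is everything, a set {|y| > sup T}, or
  -- empty.
  set T : Set ℝ := {u | 0 ≤ u ∧ G u ≤ t}
  have hTc : IsClosed T := (isClosed_Ici (a := (0 : ℝ))).inter (isClosed_le hGc continuous_const)
  rcases T.eq_empty_or_nonempty with hT | hT
  · have : ∀ y, t < G y := fun y => by
      by_contra! hc
      have : |y| ∈ T := ⟨abs_nonneg y, (hG _ _ (by simp)).trans hc⟩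
      simp [hT] at this
    simp [this]
  by_cases hb : BddAbove T
  · have hmem := hTc.csSup_mem hT hb
    have heq : {y | t < G y} = {y | sSup T < |y|} := by
      ext y
      simp only [mem_ofPred_eq]
      constructor
      · intro hy
        by_contra! hc
        exact not_lt.2 ((hG y (sSup T) (hc.trans (le_abs_self _))).trans hmem.2) hy
      · intro hy
        by_contra! hc
        exact not_lt.2 (le_csSup hb (⟨abs_nonneg y, (hG _ _ (by simp)).trans hc⟩ : |y| ∈ T)) hy
    rw [heq]
    exact h _ hmem.1
  · have : {y | t < G y} = ∅ := by
      ext y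
      simp only [mem_ofPred_eq, mem_empty_iff_false, iff_false, not_lt]
      rw [not_bddAbove_iff] at hb
      obtain ⟨u, hu, hyu⟩ := hb |y|
      exact (hG y u (hyu.le.trans (le_abs_self _))).trans hu.2
    simp [this]

/-- Jensen's inequality: centring y amounts to averaging y - z over an independent copy z. -/
lemma ofReal_excess_integral_le {μ : Measure ℝ} [IsProbabilityMeasure μ]
    (hμ : Integrable (fun y => y) μ) (b s y : ℝ) :
    ENNReal.ofReal (|b + (y - ∫ z, z ∂μ)| - s) ≤ ∫⁻ z, ENNReal.ofReal (|b + (y - z)| - s) ∂μ := by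
  have hi' : Integrable (fun z => y - z) μ := (integrable_const y).sub hμ
  have hi : Integrable (fun z => b + (y - z)) μ := (integrable_const b).add hi'
  have hi2 : Integrable (fun z => |b + (y - z)| - s) μ := hi.abs.sub (integrable_const s)
  have hi3 : Integrable (fun z => max (|b + (y - z)| - s) 0) μ := hi2.pos_part
  have e1 : b + (y - ∫ z, z ∂μ) = ∫ z, (b + (y - z)) ∂μ := by
    rw [integral_add (integrable_const b) hi', integral_sub (integrable_const y) hμ]
    simp
  calc ENNReal.ofReal (|b + (y - ∫ z, z ∂μ)| - s)
      ≤ ENNReal.ofReal (∫ z, max (|b + (y - z)| - s) 0 ∂μ) := by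
        refine ENNReal.ofReal_le_ofReal ?_
        calc |b + (y - ∫ z, z ∂μ)| - s ≤ (∫ z, |b + (y - z)| ∂μ) - s := by
              rw [e1]
              gcongr
              exact abs_integral_le_integral_abs
          _ = ∫ z, (|b + (y - z)| - s) ∂μ := by
              rw [integral_sub hi.abs (integrable_const s)]
              simp
          _ ≤ _ := integral_mono hi2 hi3 fun z => le_max_left _ _
    _ = ∫⁻ z, ENNReal.ofReal (max (|b + (y - z)| - s) 0) ∂μ :=
        ofReal_integral_eq_lintegral_ofReal hi3 (ae_of_all _ fun z => le_max_right _ _)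
    _ = _ := by simp_rw [ofReal_max_zero]

/-- Symmetrization and comparison in one coordinate. -/
lemma lintegral_excess_le_of_tail_le {μ β : Measure ℝ} [IsProbabilityMeasure μ]
    [IsProbabilityMeasure β] (hμ : Integrable (fun y => y) μ) (hβ : β.map (fun y => -y) = β)
    (h : ∀ s : ℝ, 0 ≤ s → μ {y | s < |y|} ≤ β {y | s < |y|}) (b s : ℝ) :
    ∫⁻ y, ENNReal.ofReal (|b + (y - ∫ z, z ∂μ)| - s) ∂μ
      ≤ ∫⁻ y, ENNReal.ofReal (|b + 2 * y| - s) ∂β := by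
  set J := ∫⁻ y, ∫⁻ z, ENNReal.ofReal (|b + (y - z)| - s) ∂μ ∂μ
  have hJ1 : ∫⁻ y, ENNReal.ofReal (|b + (y - ∫ z, z ∂μ)| - s) ∂μ ≤ J :=
    lintegral_mono fun y => ofReal_excess_integral_le hμ b s y
  -- Exchanging the two copies turns y - z into its negative, so 2J is the double integral of the
  -- even function `evenExcess b s (y - z)`.
  have hJ2 : J = ∫⁻ y, ∫⁻ z, ENNReal.ofReal (|b - (y - z)| - s) ∂μ ∂μ := by
    rw [lintegral_lintegral_swap (by fun_prop)]
    simp only [J, sub_sub_eq_add_sub, add_sub_assoc]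
  have hG : ∫⁻ y, ENNReal.ofReal (evenExcess b s (2 * y)) ∂μ
      ≤ ∫⁻ y, ENNReal.ofReal (evenExcess b s (2 * y)) ∂β :=
    lintegral_le_of_tail_le h (fun u => evenExcess_nonneg _ _ _)
      ((continuous_evenExcess b s).comp (by fun_prop)) fun u v huv =>
      evenExcess_mono b s (by simpa [abs_mul] using huv)
  have hGβ : ∫⁻ y, ENNReal.ofReal (evenExcess b s (2 * y)) ∂β
      = 2 * ∫⁻ y, ENNReal.ofReal (|b + 2 * y| - s) ∂β := by
    simp_rw [ofReal_evenExcess]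
    rw [lintegral_add_left (by fun_prop), two_mul]
    congr 1
    conv_rhs => rw [← hβ]
    rw [lintegral_map (by fun_prop) (by fun_prop)]
    simp [sub_eq_add_neg]
  have hm : Measurable fun y => ENNReal.ofReal (evenExcess b s (2 * y)) :=
    ((continuous_evenExcess b s).measurable.comp (by fun_prop)).ennreal_ofReal
  have key : 2 * (2 * J) ≤ 2 * ∫⁻ y, ENNReal.ofReal (evenExcess b s (2 * y)) ∂μ := by
    calc 2 * (2 * J) = 2 * ∫⁻ y, ∫⁻ z, ENNReal.ofReal (evenExcess b s (y - z)) ∂μ ∂μ := by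
          congr 1
          simp_rw [ofReal_evenExcess]
          have : ∀ y, ∫⁻ z, (ENNReal.ofReal (|b + (y - z)| - s) + ENNReal.ofReal (|b - (y - z)| - s)) ∂μ
              = ∫⁻ z, ENNReal.ofReal (|b + (y - z)| - s) ∂μ
                + ∫⁻ z, ENNReal.ofReal (|b - (y - z)| - s) ∂μ := fun y =>
            lintegral_add_left (by fun_prop) _
          simp_rw [this]
          rw [lintegral_add_left (Measurable.lintegral_prod_right' (f := fun p : ℝ × ℝ =>
            ENNReal.ofReal (|b + (p.1 - p.2)| - s)) (by fun_prop)), ← hJ2, two_mul]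
      _ = ∫⁻ y, ∫⁻ z, 2 * ENNReal.ofReal (evenExcess b s (y - z)) ∂μ ∂μ := by
          rw [← lintegral_const_mul' _ _ (by simp)]
          simp_rw [lintegral_const_mul' 2 _ (by simp : (2 : ℝ≥0∞) ≠ ∞)]
      _ ≤ ∫⁻ y, ∫⁻ z, (ENNReal.ofReal (evenExcess b s (2 * y))
            + ENNReal.ofReal (evenExcess b s (2 * z))) ∂μ ∂μ := by
          refine lintegral_mono fun y => lintegral_mono fun z => ?_
          have := ENNReal.ofReal_le_ofReal (evenExcess_sub_le b s y z)
          rwa [ENNReal.ofReal_mul (by norm_num), ENNReal.ofReal_ofNat,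
            ENNReal.ofReal_add (evenExcess_nonneg _ _ _) (evenExcess_nonneg _ _ _)] at this
      _ = _ := by
          simp_rw [lintegral_add_left measurable_const]
          rw [lintegral_add_right _ measurable_const, two_mul]
          simp
  have two0 : (2 : ℝ≥0∞) ≠ 0 := by simp
  have twot : (2 : ℝ≥0∞) ≠ ∞ := by simp
  have k1 := (ENNReal.mul_le_mul_iff_right two0 twot).1 key
  have k2 := k1.trans (hG.trans hGβ.le)
  exact hJ1.trans ((ENNReal.mul_le_mul_iff_right two0 twot).1 k2)

section

variable {Ω Ω' : Type*} [MeasurableSpace Ω] [MeasurableSpace Ω'] {P : Measure Ω} {P' : Measure Ω'}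

lemma lintegral_comp_prodMk_of_indepFun [IsProbabilityMeasure P] {X Y : Ω → ℝ}
    (hX : Measurable X) (hY : Measurable Y)
    (h : IndepFun X Y P) {F : ℝ × ℝ → ℝ≥0∞} (hF : Measurable F) :
    ∫⁻ ω, F (X ω, Y ω) ∂P = ∫⁻ x, ∫⁻ y, F (x, y) ∂(P.map Y) ∂(P.map X) := by
  have := Measure.isProbabilityMeasure_map (μ := P) hX.aemeasurable
  have := Measure.isProbabilityMeasure_map (μ := P) hY.aemeasurable
  rw [← lintegral_prod _ hF.aemeasurable,
    ← (indepFun_iff_map_prod_eq_prod_map_map hX.aemeasurable hY.aemeasurable).1 h,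
    lintegral_map hF (hX.prodMk hY)]

/-- The summands are replaced one at a time. The free shift b absorbs the frozen part of the sum:
the induction hypothesis is used with the last X fixed, then, after exchanging the integrals, the
one-coordinate comparison is used with the first m of the Q fixed. -/
lemma lintegral_excess_sum_le [IsProbabilityMeasure P] [IsProbabilityMeasure P']
    {X : ℕ → Ω → ℝ} {Q : ℕ → Ω' → ℝ} (hX : ∀ k, Measurable (X k)) (hQ : ∀ k, Measurable (Q k))
    (hXi : iIndepFun X P) (hQi : iIndepFun Q P') (hint : ∀ k, Integrable (X k) P)
    (hsymm : ∀ k, P'.map (fun ω => -Q k ω) = P'.map (Q k))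
    (h : ∀ k s, 0 ≤ s → P {ω | s < |X k ω|} ≤ P' {ω | s < |Q k ω|}) (m : ℕ) (b s : ℝ) :
    ∫⁻ ω, ENNReal.ofReal (|b + ∑ k ∈ Finset.range m, (X k ω - ∫ ω', X k ω' ∂P)| - s) ∂P
      ≤ ∫⁻ ω, ENNReal.ofReal (|b + ∑ k ∈ Finset.range m, 2 * Q k ω| - s) ∂P' := by
  induction m generalizing b with
  | zero => simp
  | succ m ih =>
    have hS : Measurable fun ω => ∑ k ∈ Finset.range m, (X k ω - ∫ ω', X k ω' ∂P) := by fun_prop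
    have hT : Measurable fun ω => ∑ k ∈ Finset.range m, 2 * Q k ω := by fun_prop
    have hSi : IndepFun (fun ω => ∑ k ∈ Finset.range m, (X k ω - ∫ ω', X k ω' ∂P)) (X m) P := by
      have h1 := (hXi.indepFun_finsetSum_of_notMem hX (s := Finset.range m) (i := m) (by simp)).comp
        (φ := fun y : ℝ => y - ∑ k ∈ Finset.range m, ∫ ω', X k ω' ∂P) (ψ := id)
        (by fun_prop) measurable_id
      convert! h1 using 1
      ext ω
      simp
    have hTi : IndepFun (fun ω => ∑ k ∈ Finset.range m, 2 * Q k ω) (Q m) P' := by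
      have h1 := (hQi.indepFun_finsetSum_of_notMem hQ (s := Finset.range m) (i := m) (by simp)).comp
        (φ := fun y : ℝ => 2 * y) (ψ := id) (by fun_prop) measurable_id
      convert! h1 using 1
      ext ω
      simp [Finset.mul_sum]
    have := Measure.isProbabilityMeasure_map (μ := P) (hX m).aemeasurable
    have := Measure.isProbabilityMeasure_map (μ := P') (hQ m).aemeasurable
    have := Measure.isProbabilityMeasure_map (μ := P') hT.aemeasurable
    have := Measure.isProbabilityMeasure_map (μ := P) hS.aemeasurable
    have hmean : ∫ ω', X m ω' ∂P = ∫ z, z ∂(P.map (X m)) :=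
      (integral_map (f := fun z => z) (hX m).aemeasurable (by fun_prop)).symm
    simp_rw [Finset.sum_range_succ]
    rw [lintegral_comp_prodMk_of_indepFun (hX m) hS hSi.symm
      (F := fun p : ℝ × ℝ => ENNReal.ofReal (|b + (p.2 + (p.1 - ∫ ω', X m ω' ∂P))| - s))
      (by fun_prop),
      lintegral_comp_prodMk_of_indepFun hT (hQ m) hTi
      (F := fun p : ℝ × ℝ => ENNReal.ofReal (|b + (p.1 + 2 * p.2)| - s)) (by fun_prop)]
    calc _ ≤ ∫⁻ x, ∫⁻ y, ENNReal.ofReal (|b + (y + (x - ∫ ω', X m ω' ∂P))| - s)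
          ∂(P'.map (fun ω => ∑ k ∈ Finset.range m, 2 * Q k ω)) ∂(P.map (X m)) := by
          refine lintegral_mono fun x => ?_
          rw [lintegral_map (by fun_prop) hS, lintegral_map (by fun_prop) hT]
          simpa only [add_comm, add_left_comm, add_assoc] using ih (b + (x - ∫ ω', X m ω' ∂P))
      _ = ∫⁻ y, ∫⁻ x, ENNReal.ofReal (|b + (y + (x - ∫ ω', X m ω' ∂P))| - s)
          ∂(P.map (X m)) ∂(P'.map (fun ω => ∑ k ∈ Finset.range m, 2 * Q k ω)) :=
          lintegral_lintegral_swap (by fun_prop)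
      _ ≤ _ := by
          refine lintegral_mono fun y => ?_
          have key := lintegral_excess_le_of_tail_le (μ := P.map (X m)) (β := P'.map (Q m))
            ((integrable_map_measure (f := X m) (g := fun y => y) (by fun_prop)
              (hX m).aemeasurable).2 (hint m))
            (by rw [Measure.map_map (by fun_prop) (hQ m)]; exact hsymm m) (fun s hs => by
              rw [Measure.map_apply (hX m) (measurableSet_lt measurable_const (by fun_prop)),
                Measure.map_apply (hQ m) (measurableSet_lt measurable_const (by fun_prop))]
              exact h m s hs) (b + y) s
          rw [← hmean] at key
          simpa only [add_assoc] using key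

/-- A sum of centred independent variables is dominated by a sum of independent symmetric
variables with heavier tails. -/
lemma mixNorm_sum_centred_le [IsProbabilityMeasure P] [IsProbabilityMeasure P']
    (V : Set (Measure ℝ))
    {X : ℕ → Ω → ℝ} {Q : ℕ → Ω' → ℝ} (hX : ∀ k, Measurable (X k)) (hQ : ∀ k, Measurable (Q k))
    (hXi : iIndepFun X P) (hQi : iIndepFun Q P') (hint : ∀ k, Integrable (X k) P)
    (hsymm : ∀ k, P'.map (fun ω => -Q k ω) = P'.map (Q k))
    (h : ∀ k s, 0 ≤ s → P {ω | s < |X k ω|} ≤ P' {ω | s < |Q k ω|}) (m : ℕ) :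
    mixNorm V P (fun ω => ∑ k ∈ Finset.range m, (X k ω - ∫ ω', X k ω' ∂P))
      ≤ 2 * mixNorm V P' (fun ω => ∑ k ∈ Finset.range m, Q k ω) := by
  calc _ ≤ mixNorm V P' (fun ω => ∑ k ∈ Finset.range m, 2 * Q k ω) := by
        refine mixNorm_le_of_kFun_le (kFun_le_of_excess_le ?_ ?_ fun s _ => ?_)
        · exact Measurable.aemeasurable (by fun_prop)
        · exact Measurable.aemeasurable (by fun_prop)
        · simpa using lintegral_excess_sum_le hX hQ hXi hQi hint hsymm h m 0 s
    _ ≤ _ := by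
        simp_rw [← Finset.mul_sum]
        refine (mixNorm_const_mul_le (Measurable.aemeasurable (by fun_prop)) 2).trans ?_
        simp

end

/-! ### Functions with order continuous norm -/

section Truncation

variable {Ω : Type*} {f g : Ω → ℝ}

lemma abs_indicator_lt_le (c : ℝ) (ω : Ω) (h : |f ω| ≤ |g ω|) :
    |{ω | c < |f ω|}.indicator f ω| ≤ |{ω | c < |g ω|}.indicator g ω| := by
  by_cases h1 : c < |f ω|
  · rw [indicator_of_mem (show ω ∈ {ω | c < |f ω|} from h1),
      indicator_of_mem (show ω ∈ {ω | c < |g ω|} from h1.trans_le h)]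
    exact h
  · rw [indicator_of_notMem (show ω ∉ {ω | c < |f ω|} from h1)]
    simp

lemma abs_eq_of_indicator_split (c : ℝ) (ω : Ω) :
    f ω = {ω | |f ω| ≤ c}.indicator f ω + {ω | c < |f ω|}.indicator f ω := by
  by_cases h1 : c < |f ω|
  · simp [indicator, h1, h1.not_ge]
  · simp [indicator, h1, not_lt.1 h1]

lemma abs_indicator_le_const {c : ℝ} (hc : 0 ≤ c) (ω : Ω) :
    |{ω | |f ω| ≤ c}.indicator f ω| ≤ c := by
  by_cases h1 : |f ω| ≤ c
  · simp [indicator, h1]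
  · simp [indicator, h1, hc]

lemma abs_le_add_abs_indicator {c : ℝ} (hc : 0 ≤ c) (ω : Ω) :
    |f ω| ≤ c + |{ω | c < |f ω|}.indicator f ω| := by
  have h : |f ω| ≤ |{ω | |f ω| ≤ c}.indicator f ω| + |{ω | c < |f ω|}.indicator f ω| := by
    conv_lhs => rw [abs_eq_of_indicator_split (f := f) c ω]
    exact abs_add_le _ _
  have h2 := abs_indicator_le_const (f := f) hc ω
  linarith

lemma setOf_lt_abs_indicator {s : ℝ} (hs : 0 < s) (c : ℝ) (F : Ω → ℝ) :
    {ω | s < |{ω | c < |F ω|}.indicator F ω|} = {ω | max s c < |F ω|} := by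
  ext ω
  by_cases h1 : c < |F ω|
  · simp [h1]
  · simp [h1, hs.le]

end Truncation

section OrderContinuous

variable {Ω : Type*} [MeasurableSpace Ω] {P : Measure Ω} {f g : Ω → ℝ} {V : Set (Measure ℝ)}

lemma mixFundamental_mono (V : Set (Measure ℝ)) : Monotone (mixFundamental V) := fun a b hab => by
  unfold mixFundamental
  gcongr

/-- The norms of indicator functions tend to zero with the measures of the sets. -/
def FundamentalTendstoZero (V : Set (Measure ℝ)) : Prop :=
  ∀ ε : ℝ≥0∞, 0 < ε → ∃ δ : ℝ≥0∞, 0 < δ ∧ mixFundamental V δ ≤ ε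

lemma FundamentalTendstoZero.tendsto (hV : FundamentalTendstoZero V) {ι : Type*} {l : Filter ι}
    {d : ι → ℝ≥0∞} (hd : Tendsto d l (𝓝 0)) :
    Tendsto (fun i => mixFundamental V (d i)) l (𝓝 0) := by
  rw [ENNReal.tendsto_nhds_zero]
  intro ε hε
  obtain ⟨δ, hδ, hδε⟩ := hV ε hε
  filter_upwards [hd.eventually_le_const hδ] with i hi
  exact (mixFundamental_mono V hi).trans hδε

/-- min(1, τ) ≤ max(1, 1/δ) · min(δ, τ), so finiteness at one small δ passes to 1. -/
lemma FundamentalTendstoZero.one_lt_top (hV : FundamentalTendstoZero V) :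
    mixFundamental V 1 < ∞ := by
  obtain ⟨δ, hδ, hδε⟩ := hV 1 (by simp)
  have hc : max 1 δ⁻¹ ≠ ∞ := by simp [hδ.ne']
  have : mixFundamental V 1 ≤ max 1 δ⁻¹ * mixFundamental V δ := by
    refine iSup₂_le fun ν hν => ?_
    calc ∫⁻ τ, min 1 (ENNReal.ofReal τ) ∂ν
        ≤ ∫⁻ τ, max 1 δ⁻¹ * min δ (ENNReal.ofReal τ) ∂ν := by
          refine lintegral_mono fun τ => ?_
          rw [mul_min]
          refine min_le_min ?_ ?_
          · rcases eq_or_ne δ ∞ with rfl | h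
            · simp
            · calc 1 = δ⁻¹ * δ := (ENNReal.inv_mul_cancel hδ.ne' h).symm
                _ ≤ _ := by gcongr; exact le_max_right _ _
          · calc ENNReal.ofReal τ = 1 * ENNReal.ofReal τ := (one_mul _).symm
              _ ≤ _ := by gcongr; exact le_max_left _ _
      _ = max 1 δ⁻¹ * ∫⁻ τ, min δ (ENNReal.ofReal τ) ∂ν := lintegral_const_mul' _ _ hc
      _ ≤ _ := by
        gcongr
        exact le_iSup₂ (f := fun ν _ => ∫⁻ τ, min δ (ENNReal.ofReal τ) ∂ν) ν hν
  refine this.trans_lt (ENNReal.mul_lt_top hc.lt_top (hδε.trans_lt (by simp)))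

lemma mixNorm_le_of_abs_le_const [IsProbabilityMeasure P] {c : ℝ} (hfc : ∀ᵐ ω ∂P, |f ω| ≤ c) :
    mixNorm V P f ≤ ENNReal.ofReal c * mixFundamental V 1 :=
  mixNorm_le_of_abs_le hfc prob_le_one

/-- `f` has order continuous norm: its upper truncations tend to zero in norm. -/
def HasOCNorm (V : Set (Measure ℝ)) (P : Measure Ω) (f : Ω → ℝ) : Prop :=
  Tendsto (fun n : ℕ => mixNorm V P ({ω | (n : ℝ) < |f ω|}.indicator f)) atTop (𝓝 0)

lemma HasOCNorm.mono (hg : HasOCNorm V P g) (h : ∀ᵐ ω ∂P, |f ω| ≤ |g ω|) : HasOCNorm V P f :=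
  tendsto_of_tendsto_of_tendsto_of_le_of_le tendsto_const_nhds hg (fun _ => zero_le) fun _ =>
    mixNorm_mono (h.mono fun ω hω => abs_indicator_lt_le _ ω hω)

lemma HasOCNorm.congr (hg : HasOCNorm V P g) (h : f =ᵐ[P] g) : HasOCNorm V P f :=
  hg.mono (h.mono fun ω hω => by rw [hω])

lemma HasOCNorm.of_dist {Ω' : Type*} [MeasurableSpace Ω'] {P' : Measure Ω'} {f' : Ω' → ℝ}
    (hf : HasOCNorm V P f) (h : ∀ s : ℝ, 0 ≤ s → P' {ω | s < |f' ω|} ≤ P {ω | s < |f ω|}) :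
    HasOCNorm V P' f' := by
  refine tendsto_of_tendsto_of_tendsto_of_le_of_le tendsto_const_nhds hf (fun _ => zero_le)
    fun n => mixNorm_mono_dist fun s hs => ?_
  rw [setOf_lt_abs_indicator hs, setOf_lt_abs_indicator hs]
  exact h _ (by positivity)

lemma measurableSet_abs_le (hf : Measurable f) (c : ℝ) : MeasurableSet {ω | |f ω| ≤ c} :=
  measurableSet_le hf.abs measurable_const

lemma measurableSet_lt_abs (hf : Measurable f) (c : ℝ) : MeasurableSet {ω | c < |f ω|} :=
  measurableSet_lt measurable_const hf.abs

lemma mixNorm_le_truncation [IsProbabilityMeasure P] (hf : Measurable f) {c : ℝ} (hc : 0 ≤ c) :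
    mixNorm V P f ≤ ENNReal.ofReal c * mixFundamental V 1
      + mixNorm V P ({ω | c < |f ω|}.indicator f) := by
  calc mixNorm V P f = mixNorm V P (fun ω => {ω | |f ω| ≤ c}.indicator f ω
        + {ω | c < |f ω|}.indicator f ω) := by
        congr 1; ext ω; exact abs_eq_of_indicator_split c ω
    _ ≤ _ := mixNorm_add_le (hf.indicator (measurableSet_abs_le hf c)).aemeasurable
        (hf.indicator (measurableSet_lt_abs hf c)).aemeasurable
    _ ≤ _ := by
      gcongr
      exact mixNorm_le_of_abs_le_const (ae_of_all _ fun ω => abs_indicator_le_const hc ω)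

lemma HasOCNorm.lt_top [IsProbabilityMeasure P] (hV : FundamentalTendstoZero V)
    (hf : Measurable f) (h : HasOCNorm V P f) : mixNorm V P f < ∞ := by
  obtain ⟨n, hn⟩ := (h.eventually_lt_const (by simp : (0 : ℝ≥0∞) < 1)).exists
  refine (mixNorm_le_truncation hf n.cast_nonneg).trans_lt ?_
  exact ENNReal.add_lt_top.2 ⟨ENNReal.mul_lt_top ENNReal.ofReal_lt_top hV.one_lt_top,
    hn.trans (by simp)⟩

/-- It suffices to be close in norm to bounded functions: on {|f| > n} the bounded part costs at
most c times the norm of the indicator of a set whose measure tends to zero. -/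
lemma hasOCNorm_of_approx [IsProbabilityMeasure P] (hV : FundamentalTendstoZero V)
    (hf : Measurable f) (h : ∀ ε : ℝ≥0∞, 0 < ε → ∃ (c : ℝ) (r : Ω → ℝ), 0 ≤ c ∧ Measurable r ∧
      (∀ ω, |f ω| ≤ c + |r ω|) ∧ mixNorm V P r ≤ ε) : HasOCNorm V P f := by
  rw [HasOCNorm, ENNReal.tendsto_nhds_zero]
  intro ε hε
  obtain ⟨c, r, hc, hr, hfr, hrε⟩ := h (ε / 2) (ENNReal.half_pos hε.ne')
  have hm : Tendsto (fun n : ℕ => ENNReal.ofReal c * mixFundamental V (P {ω | (n : ℝ) < |f ω|}))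
      atTop (𝓝 0) := by
    simpa using ENNReal.Tendsto.const_mul (a := ENNReal.ofReal c)
      (hV.tendsto (tendsto_measure_lt_abs (P := P) hf.aemeasurable)) (Or.inr ENNReal.ofReal_ne_top)
  filter_upwards [hm.eventually_le_const (ENNReal.half_pos hε.ne')] with n hn
  have hms := measurableSet_lt_abs hf n
  calc mixNorm V P ({ω | (n : ℝ) < |f ω|}.indicator f)
      ≤ mixNorm V P (fun ω => {ω | (n : ℝ) < |f ω|}.indicator (fun _ => c) ω + |r ω|) := by
        refine mixNorm_mono (ae_of_all _ fun ω => ?_)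
        by_cases h1 : (n : ℝ) < |f ω|
        · rw [indicator_of_mem (show ω ∈ {ω | (n : ℝ) < |f ω|} from h1),
            indicator_of_mem (show ω ∈ {ω | (n : ℝ) < |f ω|} from h1)]
          exact (hfr ω).trans (le_abs_self _)
        · rw [indicator_of_notMem (show ω ∉ {ω | (n : ℝ) < |f ω|} from h1)]
          simp
    _ ≤ mixNorm V P ({ω | (n : ℝ) < |f ω|}.indicator (fun _ => c)) + mixNorm V P fun ω => |r ω| :=
        mixNorm_add_le (measurable_const.indicator hms).aemeasurable hr.abs.aemeasurable
    _ ≤ ENNReal.ofReal c * mixFundamental V (P {ω | (n : ℝ) < |f ω|}) + ε / 2 := by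
        gcongr
        · refine mixNorm_le_of_abs_le (ae_of_all _ fun ω => ?_) (measure_mono fun ω hω => ?_)
          · by_cases h1 : (n : ℝ) < |f ω| <;> simp [indicator, h1, abs_of_nonneg hc, hc]
          · by_contra h1
            exact hω (indicator_of_notMem h1 _)
        · rwa [mixNorm_abs]
    _ ≤ ε / 2 + ε / 2 := by gcongr
    _ = ε := ENNReal.add_halves ε

lemma HasOCNorm.exists_truncation (h : HasOCNorm V P f) {ε : ℝ≥0∞} (hε : 0 < ε) :
    ∃ n : ℕ, mixNorm V P ({ω | (n : ℝ) < |f ω|}.indicator f) ≤ ε :=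
  (h.eventually_le_const hε).exists

lemma HasOCNorm.add [IsProbabilityMeasure P] (hV : FundamentalTendstoZero V)
    (hf : Measurable f) (hg : Measurable g) (h : HasOCNorm V P f) (h' : HasOCNorm V P g) :
    HasOCNorm V P (fun ω => f ω + g ω) := by
  refine hasOCNorm_of_approx hV (hf.add hg) fun ε hε => ?_
  obtain ⟨n, hn⟩ := h.exists_truncation (ENNReal.half_pos hε.ne')
  obtain ⟨m, hm⟩ := h'.exists_truncation (ENNReal.half_pos hε.ne')
  have m1 := (hf.indicator (measurableSet_lt_abs hf n)).abs
  have m2 := (hg.indicator (measurableSet_lt_abs hg m)).abs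
  refine ⟨n + m, fun ω => |{ω | (n : ℝ) < |f ω|}.indicator f ω|
    + |{ω | (m : ℝ) < |g ω|}.indicator g ω|, by positivity, m1.add m2, fun ω => ?_, ?_⟩
  · have h1 := abs_le_add_abs_indicator (f := f) (c := n) (by positivity) ω
    have h2 := abs_le_add_abs_indicator (f := g) (c := m) (by positivity) ω
    have h3 := abs_add_le (f ω) (g ω)
    rw [abs_of_nonneg (a := |{ω | (n : ℝ) < |f ω|}.indicator f ω|
      + |{ω | (m : ℝ) < |g ω|}.indicator g ω|) (by positivity)]
    linarith
  · refine (mixNorm_add_le m1.aemeasurable m2.aemeasurable).trans ?_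
    rw [mixNorm_abs, mixNorm_abs, ← ENNReal.add_halves ε]
    gcongr

lemma HasOCNorm.const_mul [IsProbabilityMeasure P] (hV : FundamentalTendstoZero V)
    (hf : Measurable f) (h : HasOCNorm V P f) (c : ℝ) : HasOCNorm V P (fun ω => c * f ω) := by
  refine hasOCNorm_of_approx hV (hf.const_mul c) fun ε hε => ?_
  obtain ⟨n, hn⟩ := h.exists_truncation (ε := ε / ENNReal.ofReal (|c| + 1))
    (ENNReal.div_pos hε.ne' ENNReal.ofReal_ne_top)
  have m1 := hf.indicator (measurableSet_lt_abs hf n)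
  refine ⟨|c| * n, fun ω => c * {ω | (n : ℝ) < |f ω|}.indicator f ω, by positivity,
    m1.const_mul c, fun ω => ?_, ?_⟩
  · rw [abs_mul, abs_mul, ← mul_add]
    gcongr
    exact abs_le_add_abs_indicator (f := f) (c := n) (by positivity) ω
  · refine (mixNorm_const_mul_le m1.aemeasurable c).trans ?_
    calc _ ≤ ENNReal.ofReal (|c| + 1) * (ε / ENNReal.ofReal (|c| + 1)) := by
          gcongr
          linarith
      _ ≤ ε := ENNReal.mul_div_le

lemma hasOCNorm_of_bounded [IsProbabilityMeasure P] (hV : FundamentalTendstoZero V)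
    (hf : Measurable f) {c : ℝ} (hc : 0 ≤ c) (h : ∀ ω, |f ω| ≤ c) : HasOCNorm V P f :=
  hasOCNorm_of_approx hV hf fun ε _ =>
    ⟨c, fun _ => 0, hc, measurable_const, by simpa using h, by simp [mixNorm_zero]⟩

end OrderContinuous

/-! ### Weakly null sequences in spaces with order continuous norm -/

/-- The uniform boundedness principle for a seminorm. -/
theorem Seminorm.exists_bound_of_functionals {F : Type*} [AddCommGroup F] [Module ℝ F]
    (p : Seminorm ℝ F) (x : ℕ → F)
    (h : ∀ f : F →ₗ[ℝ] ℝ, (∃ C : ℝ, ∀ y, |f y| ≤ C * p y) → ∃ C : ℝ, ∀ n, |f (x n)| ≤ C) :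
    ∃ C : ℝ, ∀ n, p (x n) ≤ C := by
  let _ : SeminormedAddCommGroup F := p.toAddGroupSeminorm.toSeminormedAddCommGroup
  have hn : ∀ y : F, ‖y‖ = p y := fun y => rfl
  let _ : NormedSpace ℝ F := ⟨fun a b => by rw [hn, hn, map_smul_eq_mul]⟩
  -- The x n act on the dual, where the hypothesis is pointwise boundedness; Hahn–Banach then
  -- recovers p (x n) from the norm in the bidual.
  obtain ⟨C, hC⟩ := banach_steinhaus
    (g := fun n => NormedSpace.inclusionInDoubleDual ℝ F (x n)) fun f => by
      obtain ⟨C, hC⟩ := h f.toLinearMap ⟨‖f‖, fun y => f.le_opNorm y⟩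
      exact ⟨C, hC⟩
  refine ⟨C, fun n => ?_⟩
  obtain ⟨g, hg, hgx⟩ := exists_dual_vector'' ℝ (x n)
  have h1 := (NormedSpace.inclusionInDoubleDual ℝ F (x n)).le_opNorm g
  rw [NormedSpace.dual_def, hgx] at h1
  simp only [RCLike.ofReal_real_eq_id, id, norm_norm] at h1
  calc p (x n) = ‖x n‖ := rfl
    _ ≤ _ := h1
    _ ≤ ‖NormedSpace.inclusionInDoubleDual ℝ F (x n)‖ * 1 := by gcongr
    _ ≤ C := by rw [mul_one]; exact hC n

/-- `E` is the space of functions with order continuous `mixNorm V`-norm, normed by it. -/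
structure IsMixSpace (V : Set (Measure ℝ)) (E : Set L0) (N : L0 → ℝ) : Prop where
  fundamental : FundamentalTendstoZero V
  mem_iff : ∀ x : L0, x ∈ E ↔ HasOCNorm V volume x
  norm_eq : ∀ x : L0, N x = (mixNorm V volume x).toReal
  lintegral_le : ∃ C : ℝ≥0∞, C ≠ ∞ ∧ ∀ f : I → ℝ, Measurable f →
    ∫⁻ u, ENNReal.ofReal |f u| ≤ C * mixNorm V volume f

lemma L0.coeFn_sum {ι : Type*} (s : Finset ι) (x : ι → L0) :
    ((∑ i ∈ s, x i : L0) : I → ℝ) =ᵐ[volume] fun u => ∑ i ∈ s, x i u := by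
  classical
  induction s using Finset.induction_on with
  | empty =>
    simp only [Finset.sum_empty]
    exact AEEqFun.coeFn_zero
  | insert a s ha ih =>
    simp only [Finset.sum_insert ha]
    filter_upwards [AEEqFun.coeFn_add (x a) (∑ i ∈ s, x i), ih] with u h1 h2
    rw [h1, Pi.add_apply, h2]

lemma L0.measurable (x : L0) : Measurable (x : I → ℝ) := AEEqFun.measurable x

namespace IsMixSpace

variable {V : Set (Measure ℝ)} {E : Set L0} {N : L0 → ℝ}

/-- `E` as a linear subspace. -/
def submodule (h : IsMixSpace V E N) : Submodule ℝ L0 where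
  carrier := E
  add_mem' {x y} hx hy := by
    rw [h.mem_iff] at *
    exact (hx.add h.fundamental x.measurable y.measurable hy).congr (AEEqFun.coeFn_add x y)
  zero_mem' := by
    rw [h.mem_iff]
    exact (hasOCNorm_of_bounded (f := fun _ => (0 : ℝ)) h.fundamental measurable_const le_rfl
      (by simp)).congr AEEqFun.coeFn_zero
  smul_mem' c x hx := by
    rw [h.mem_iff] at *
    exact (hx.const_mul h.fundamental x.measurable c).congr (AEEqFun.coeFn_smul c x)

lemma lt_top (h : IsMixSpace V E N) {x : L0} (hx : x ∈ E) : mixNorm V volume (x : I → ℝ) < ∞ :=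
  ((h.mem_iff x).1 hx).lt_top h.fundamental x.measurable

lemma ofReal_norm (h : IsMixSpace V E N) {x : L0} (hx : x ∈ E) :
    ENNReal.ofReal (N x) = mixNorm V volume (x : I → ℝ) := by
  rw [h.norm_eq, ENNReal.ofReal_toReal (h.lt_top hx).ne]

/-- The norm of `E` as a seminorm on the linear subspace `E`. -/
noncomputable def seminorm (h : IsMixSpace V E N) : Seminorm ℝ h.submodule :=
  Seminorm.of (fun x => N x)
    (fun x y => by
      have hx := h.lt_top x.2
      have hy := h.lt_top y.2
      simp only [h.norm_eq, Submodule.coe_add]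
      rw [← ENNReal.toReal_add hx.ne hy.ne, mixNorm_congr (AEEqFun.coeFn_add _ _)]
      exact ENNReal.toReal_mono (ENNReal.add_lt_top.2 ⟨hx, hy⟩).ne
        (mixNorm_add_le x.1.measurable.aemeasurable y.1.measurable.aemeasurable))
    (fun c x => by
      simp only [h.norm_eq, Submodule.coe_smul]
      rw [mixNorm_congr (AEEqFun.coeFn_smul _ _)]
      rcases eq_or_ne c 0 with rfl | hc
      · have : ((0 : ℝ) • (x.1 : I → ℝ)) = fun _ => (0 : ℝ) := by ext; simp
        simp [this, mixNorm_zero]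
      · have : (c • (x.1 : I → ℝ)) = fun u => c * x.1 u := by ext; simp
        rw [this, mixNorm_const_mul x.1.measurable.aemeasurable hc, ENNReal.toReal_mul,
          ENNReal.toReal_ofReal (abs_nonneg c), Real.norm_eq_abs])

/-- Weakly null sequences are bounded. -/
lemma bounded_of_weaklyNull (h : IsMixSpace V E N) {x : ℕ → L0} (hx : WeaklyNull E N x) :
    ∃ C : ℝ, ∀ n, N (x n) ≤ C := by
  refine h.seminorm.exists_bound_of_functionals (fun n => ⟨x n, hx.1 n⟩) fun f hf => ?_
  obtain ⟨C, hC⟩ := hf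
  -- Weak nullity is tested by functionals on all of `L0`, so f is extended algebraically; only the
  -- bound on E matters.
  obtain ⟨g, hg⟩ := LinearMap.exists_extend f
  have hgf : ∀ y (hy : y ∈ E), g y = f ⟨y, hy⟩ := fun y hy =>
    LinearMap.congr_fun hg (⟨y, hy⟩ : h.submodule)
  have := hx.2 g ⟨C, fun y hy => by rw [hgf y hy]; exact hC ⟨y, hy⟩⟩
  obtain ⟨B, hB⟩ := this.abs.bddAbove_range
  exact ⟨B, fun n => by rw [← hgf _ (hx.1 n)]; exact hB ⟨n, rfl⟩⟩

/-- A measurable function which integrates boundedly against `E` gives a bounded functional. -/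
lemma tendsto_integral_of_weaklyNull (h : IsMixSpace V E N) {x : ℕ → L0} (hx : WeaklyNull E N x)
    {g : I → ℝ} (hg : AEStronglyMeasurable g volume) {C : ℝ≥0∞} (hC : C ≠ ∞)
    (hgC : ∀ y : L0, y ∈ E →
      ∫⁻ u, ENNReal.ofReal |y u * g u| ≤ C * mixNorm V volume (y : I → ℝ)) :
    Tendsto (fun n => ∫ u, x n u * g u) atTop (𝓝 0) := by
  have hint : ∀ y ∈ E, Integrable (fun u => (y : L0) u * g u) volume := fun y hy => by
    refine ⟨y.measurable.aestronglyMeasurable.mul hg, ?_⟩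
    rw [hasFiniteIntegral_iff_norm]
    exact (hgC y hy).trans_lt (ENNReal.mul_lt_top hC.lt_top (h.lt_top hy))
  let f : h.submodule →ₗ[ℝ] ℝ :=
    { toFun := fun y => ∫ u, (y : L0) u * g u
      map_add' := fun y z => by
        rw [← integral_add (hint _ y.2) (hint _ z.2)]
        refine integral_congr_ae ?_
        filter_upwards [AEEqFun.coeFn_add (y : L0) (z : L0)] with u hu
        rw [Submodule.coe_add, hu, Pi.add_apply, add_mul]
      map_smul' := fun c y => by
        rw [RingHom.id_apply, smul_eq_mul, ← integral_const_mul]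
        refine integral_congr_ae ?_
        filter_upwards [AEEqFun.coeFn_smul c (y : L0)] with u hu
        rw [Submodule.coe_smul, hu, Pi.smul_apply, smul_eq_mul, mul_assoc] }
  obtain ⟨F, hF⟩ := LinearMap.exists_extend f
  have hFf : ∀ y, y ∈ E → F y = ∫ u, y u * g u := fun y hy =>
    LinearMap.congr_fun hF (⟨y, hy⟩ : h.submodule)
  have := hx.2 F ⟨C.toReal, fun y hy => by
    rw [hFf y hy, h.norm_eq, ← ENNReal.toReal_mul]
    refine (abs_integral_le_integral_abs).trans ?_
    rw [integral_eq_lintegral_of_nonneg_ae (ae_of_all _ fun u => abs_nonneg _)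
      (hint y hy).abs.aestronglyMeasurable]
    exact ENNReal.toReal_mono (ENNReal.mul_lt_top hC.lt_top (h.lt_top hy)).ne (hgC y hy)⟩
  refine this.congr fun n => hFf _ (hx.1 n)

lemma integrable (h : IsMixSpace V E N) {f : I → ℝ} (hf : Measurable f)
    (hfV : mixNorm V volume f < ∞) : Integrable f volume := by
  obtain ⟨C, hC, hCf⟩ := h.lintegral_le
  refine ⟨hf.aestronglyMeasurable, ?_⟩
  rw [hasFiniteIntegral_iff_norm]
  exact (hCf f hf).trans_lt (ENNReal.mul_lt_top hC.lt_top hfV)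

lemma tendsto_mean_of_weaklyNull (h : IsMixSpace V E N) {x : ℕ → L0} (hx : WeaklyNull E N x) :
    Tendsto (fun n => ∫ u, x n u) atTop (𝓝 0) := by
  obtain ⟨C, hC, hCf⟩ := h.lintegral_le
  simpa using h.tendsto_integral_of_weaklyNull hx (g := fun _ => 1)
    aestronglyMeasurable_const hC fun y _ => by simpa using hCf y y.measurable

end IsMixSpace

/-! ### Averages of independent symmetric variables -/

section Averages

variable {Ω : Type*} [MeasurableSpace Ω] {P : Measure Ω} {V : Set (Measure ℝ)}

lemma integral_eq_zero_of_symm {f : Ω → ℝ} (hf : Measurable f)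
    (hs : P.map (fun ω => -f ω) = P.map f) : ∫ ω, f ω ∂P = 0 := by
  have h1 : ∫ ω, f ω ∂P = ∫ y, y ∂(P.map f) :=
    (integral_map (f := fun z => z) hf.aemeasurable (by fun_prop)).symm
  have h2 : ∫ ω, -f ω ∂P = ∫ y, y ∂(P.map fun ω => -f ω) :=
    (integral_map (f := fun z => z) hf.neg.aemeasurable (by fun_prop)).symm
  rw [hs, ← h1, integral_neg] at h2
  linarith

lemma map_odd_comp {f : Ω → ℝ} (hf : Measurable f) (hs : P.map (fun ω => -f ω) = P.map f)
    {G : ℝ → ℝ} (hG : Measurable G) (hodd : ∀ y, G (-y) = -G y) :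
    P.map (fun ω => -G (f ω)) = P.map (fun ω => G (f ω)) := by
  have h1 : P.map (fun ω => G (f ω)) = (P.map f).map G := (Measure.map_map hG hf).symm
  have h2 : P.map (fun ω => -G (f ω)) = (P.map (fun ω => -f ω)).map G := by
    rw [Measure.map_map hG (show Measurable fun ω => -f ω from hf.neg)]
    congr 1
    ext ω
    simp [hodd]
  rw [h1, h2, hs]

/-- Chebyshev's inequality: the variance of the sum is at most mT², against (mα)². -/
lemma tendsto_measure_sum_gt [IsProbabilityMeasure P] {X : ℕ → Ω → ℝ} {T α : ℝ} (hα : 0 < α)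
    (hX : ∀ k, Measurable (X k)) (hXi : iIndepFun X P) (hXT : ∀ k ω, |X k ω| ≤ T)
    (hX0 : ∀ k, ∫ ω, X k ω ∂P = 0) :
    Tendsto (fun m : ℕ => P {ω | m * α < |∑ k ∈ Finset.range m, X k ω|}) atTop (𝓝 0) := by
  have hL : ∀ k, MemLp (X k) 2 P := fun k =>
    MemLp.of_bound (hX k).aestronglyMeasurable T (ae_of_all _ (hXT k))
  have hvar : ∀ m : ℕ, variance (∑ k ∈ Finset.range m, X k) P ≤ m * T ^ 2 := fun m => by
    rw [IndepFun.variance_sum (fun i _ => hL i) fun i _ j _ hij => hXi.indepFun hij]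
    calc ∑ k ∈ Finset.range m, variance (X k) P ≤ ∑ k ∈ Finset.range m, T ^ 2 := by
          refine Finset.sum_le_sum fun k _ => ?_
          refine (variance_le_expectation_sq (hX k).aestronglyMeasurable).trans ?_
          calc ∫ ω, (X k ^ 2) ω ∂P ≤ ∫ ω, T ^ 2 ∂P := by
                refine integral_mono (hL k).integrable_sq (integrable_const _) fun ω => ?_
                simp only [Pi.pow_apply]
                rw [← sq_abs]
                exact pow_le_pow_left₀ (abs_nonneg _) (hXT k ω) 2
            _ = T ^ 2 := by simp
      _ = m * T ^ 2 := by simp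
  have hbound : ∀ᶠ m : ℕ in atTop, P {ω | m * α < |∑ k ∈ Finset.range m, X k ω|}
      ≤ ENNReal.ofReal (T ^ 2 / α ^ 2 * (1 / (m : ℝ))) := by
    filter_upwards [eventually_gt_atTop 0] with m hm
    have hm' : (0 : ℝ) < m := by exact_mod_cast hm
    have hmean : ∫ ω, (∑ k ∈ Finset.range m, X k) ω ∂P = 0 := by
      simp only [Finset.sum_apply]
      rw [integral_finsetSum _ fun k _ => (hL k).integrable (by norm_num)]
      simp [hX0]
    have key := meas_ge_le_variance_div_sq (μ := P) (X := ∑ k ∈ Finset.range m, X k)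
      (memLp_finsetSum' _ fun k _ => hL k) (c := m * α) (by positivity)
    calc P {ω | m * α < |∑ k ∈ Finset.range m, X k ω|}
        ≤ P {ω | m * α ≤ |(∑ k ∈ Finset.range m, X k) ω
            - ∫ ω, (∑ k ∈ Finset.range m, X k) ω ∂P|} := by
          refine measure_mono fun ω hω => ?_
          rw [mem_ofPred_eq, hmean, sub_zero, Finset.sum_apply]
          exact le_of_lt hω
      _ ≤ _ := key
      _ ≤ _ := by
          refine ENNReal.ofReal_le_ofReal ?_
          rw [div_le_iff₀ (by positivity)]
          refine (hvar m).trans (le_of_eq ?_)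
          field_simp
  refine tendsto_of_tendsto_of_tendsto_of_le_of_le' tendsto_const_nhds ?_
    (Eventually.of_forall fun _ => zero_le) hbound
  have : Tendsto (fun m : ℕ => T ^ 2 / α ^ 2 * (1 / (m : ℝ))) atTop (𝓝 0) := by
    simpa using tendsto_one_div_atTop_nhds_zero_nat.const_mul (T ^ 2 / α ^ 2)
  simpa using ENNReal.tendsto_ofReal this

/-- The norms of averages of bounded centred independent variables tend to zero. -/
lemma eventually_mixNorm_sum_le_of_bounded [IsProbabilityMeasure P]
    (hV : FundamentalTendstoZero V) {X : ℕ → Ω → ℝ} {T : ℝ} (hT : 0 ≤ T)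
    (hX : ∀ k, Measurable (X k)) (hXi : iIndepFun X P) (hXT : ∀ k ω, |X k ω| ≤ T)
    (hX0 : ∀ k, ∫ ω, X k ω ∂P = 0) {ε : ℝ} (hε : 0 < ε) :
    ∀ᶠ m : ℕ in atTop, mixNorm V P (fun ω => ∑ k ∈ Finset.range m, X k ω)
      ≤ ENNReal.ofReal (m * ε) := by
  set b := (mixFundamental V 1).toReal
  have hb : mixFundamental V 1 = ENNReal.ofReal b :=
    (ENNReal.ofReal_toReal hV.one_lt_top.ne).symm
  have hb0 : 0 ≤ b := ENNReal.toReal_nonneg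
  -- With this α the part of the sum below mα has norm at most mε/2. The part above is bounded by mT
  -- on a set of vanishing measure. Adding 1 covers b = 0.
  set α := ε / 2 / (b + 1)
  have hα : 0 < α := by positivity
  have hαb : α * b ≤ ε / 2 := by
    rw [div_mul_eq_mul_div, div_le_iff₀ (by positivity)]
    nlinarith
  have hlim : Tendsto (fun m : ℕ => ENNReal.ofReal T *
      mixFundamental V (P {ω | m * α < |∑ k ∈ Finset.range m, X k ω|})) atTop (𝓝 0) := by
    simpa using ENNReal.Tendsto.const_mul (a := ENNReal.ofReal T)
      (hV.tendsto (tendsto_measure_sum_gt hα hX hXi hXT hX0)) (Or.inr ENNReal.ofReal_ne_top)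
  filter_upwards [hlim.eventually_le_const (ENNReal.ofReal_pos.2 (half_pos hε))] with m hm
  have hS : Measurable fun ω => ∑ k ∈ Finset.range m, X k ω := by fun_prop
  set S := fun ω => ∑ k ∈ Finset.range m, X k ω
  have hSb : ∀ ω, |S ω| ≤ m * T := fun ω => by
    calc |S ω| ≤ ∑ k ∈ Finset.range m, |X k ω| := Finset.abs_sum_le_sum_abs _ _
      _ ≤ ∑ k ∈ Finset.range m, T := Finset.sum_le_sum fun k _ => hXT k ω
      _ = m * T := by simp
  calc mixNorm V P S ≤ ENNReal.ofReal (m * α) * mixFundamental V 1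
      + mixNorm V P ({ω | m * α < |S ω|}.indicator S) := mixNorm_le_truncation hS (by positivity)
    _ ≤ ENNReal.ofReal (m * α) * ENNReal.ofReal b
      + ENNReal.ofReal (m * T) * mixFundamental V (P {ω | m * α < |S ω|}) := by
        rw [hb]
        gcongr
        refine mixNorm_le_of_abs_le (ae_of_all _ fun ω => ?_) (measure_mono fun ω hω => ?_)
        · by_cases h1 : m * α < |S ω|
          · rw [indicator_of_mem (show ω ∈ {ω | m * α < |S ω|} from h1)]
            exact hSb ω
          · rw [indicator_of_notMem (show ω ∉ {ω | m * α < |S ω|} from h1)]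
            simpa using (by positivity : 0 ≤ m * T)
        · by_contra h1
          exact hω (indicator_of_notMem h1 _)
    _ ≤ ENNReal.ofReal (m * (ε / 2)) + ENNReal.ofReal (m * (ε / 2)) := by
        refine add_le_add ?_ ?_
        · rw [← ENNReal.ofReal_mul (by positivity)]
          refine ENNReal.ofReal_le_ofReal ?_
          rw [mul_assoc]
          gcongr
        · rw [ENNReal.ofReal_mul (by positivity), ENNReal.ofReal_mul (by positivity), mul_assoc]
          gcongr
    _ = _ := by
        rw [← ENNReal.ofReal_add (by positivity) (by positivity)]
        congr 1
        ring

/-- The norms of averages of independent symmetric variables with order continuous norms and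
dominated distributions become small. -/
lemma exists_mixNorm_sum_le [IsProbabilityMeasure P]
    (hV : FundamentalTendstoZero V) {Y : ℕ → Ω → ℝ}
    (hY : ∀ k, Measurable (Y k)) (hYi : iIndepFun Y P)
    (hsymm : ∀ k, P.map (fun ω => -Y k ω) = P.map (Y k))
    {Y₀ : Ω → ℝ} (hY₀ : HasOCNorm V P Y₀)
    (hd : ∀ k s, 0 ≤ s → P {ω | s < |Y k ω|} ≤ P {ω | s < |Y₀ ω|}) {ε : ℝ} (hε : 0 < ε) :
    ∃ m : ℕ, 1 ≤ m ∧ mixNorm V P (fun ω => ∑ k ∈ Finset.range m, Y k ω)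
      ≤ ENNReal.ofReal (m * ε) := by
  obtain ⟨n, hn⟩ := hY₀.exists_truncation (ENNReal.ofReal_pos.2 (half_pos hε))
  have hn' : ∀ k, mixNorm V P ({ω | (n : ℝ) < |Y k ω|}.indicator (Y k))
      ≤ ENNReal.ofReal (ε / 2) := fun k => by
    refine le_trans (mixNorm_mono_dist fun s hs => ?_) hn
    rw [setOf_lt_abs_indicator hs, setOf_lt_abs_indicator hs]
    exact hd k _ (by positivity)
  -- Truncation is odd, so truncated symmetric variables remain symmetric and hence centred; the
  -- parts above n contribute at most ε/2 each.
  set G : ℝ → ℝ := fun y => {y : ℝ | |y| ≤ n}.indicator id y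
  have hG : Measurable G :=
    measurable_id.indicator (measurableSet_le measurable_id.abs measurable_const)
  have hGodd : ∀ y, G (-y) = -G y := fun y => by
    by_cases h : |y| ≤ n <;> simp [G, indicator, h]
  have hGY : ∀ k ω, {ω | |Y k ω| ≤ n}.indicator (Y k) ω = G (Y k ω) := fun k ω => rfl
  have hev := eventually_mixNorm_sum_le_of_bounded hV (X := fun k ω => G (Y k ω)) (T := n)
    n.cast_nonneg (fun k => hG.comp (hY k)) (hYi.comp (fun _ => G) fun _ => hG)
    (fun k ω => abs_indicator_le_const (f := Y k) n.cast_nonneg ω)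
    (fun k => integral_eq_zero_of_symm (hG.comp (hY k)) (map_odd_comp (hY k) (hsymm k) hG hGodd))
    (half_pos hε)
  obtain ⟨m, hm, hm1⟩ := (hev.and (eventually_ge_atTop 1)).exists
  refine ⟨m, hm1, ?_⟩
  have mB : ∀ k, Measurable ({ω | (n : ℝ) < |Y k ω|}.indicator (Y k)) := fun k =>
    (hY k).indicator (measurableSet_lt_abs (hY k) n)
  calc mixNorm V P (fun ω => ∑ k ∈ Finset.range m, Y k ω)
      = mixNorm V P (fun ω => ∑ k ∈ Finset.range m, G (Y k ω)
        + ∑ k ∈ Finset.range m, {ω | (n : ℝ) < |Y k ω|}.indicator (Y k) ω) := by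
        congr 1
        ext ω
        rw [← Finset.sum_add_distrib]
        exact Finset.sum_congr rfl fun k _ => abs_eq_of_indicator_split _ _
    _ ≤ _ := mixNorm_add_le
        (Measurable.aemeasurable (Finset.measurable_fun_sum _ fun k _ => hG.comp (hY k)))
        (Measurable.aemeasurable (Finset.measurable_fun_sum _ fun k _ => mB k))
    _ ≤ ENNReal.ofReal (m * (ε / 2)) + ∑ k ∈ Finset.range m, ENNReal.ofReal (ε / 2) := by
        refine add_le_add hm ((mixNorm_sum_le _ fun k => (mB k).aemeasurable).trans ?_)
        exact Finset.sum_le_sum fun k _ => hn' k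
    _ = _ := by
        rw [Finset.sum_const, Finset.card_range, nsmul_eq_mul,
          ← ENNReal.ofReal_natCast, ← ENNReal.ofReal_mul (by positivity),
          ← ENNReal.ofReal_add (by positivity) (by positivity)]
        congr 1
        ring

end Averages

/-! ### Independent identically distributed symmetric sequences -/

/-- Every law on `ℝ` is the law of a sequence of independent variables on `[0,1]`. -/
lemma exists_iid_unitInterval (μ : Measure ℝ) [IsProbabilityMeasure μ] :
    ∃ U : ℕ → I → ℝ, (∀ k, Measurable (U k)) ∧ iIndepFun U (volume : Measure I) ∧
      ∀ k, (volume : Measure I).map (U k) = μ := by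
  obtain ⟨F, hF, hFμ⟩ := (Measure.infinitePi fun _ : ℕ => μ).exists_measurable_map_eq
  have hm : ∀ k, Measurable fun u => F u k := fun k => (measurable_pi_apply k).comp hF
  have hlaw : ∀ k, (volume : Measure I).map (fun u => F u k) = μ := fun k => by
    have : (fun u => F u k) = (fun z : ℕ → ℝ => z k) ∘ F := rfl
    rw [this, ← Measure.map_map (measurable_pi_apply k) hF, hFμ]
    exact (measurePreserving_eval_infinitePi (fun _ : ℕ => μ) k).map_eq
  refine ⟨fun k u => F u k, hm, ?_, hlaw⟩
  rw [iIndepFun_iff_map_fun_eq_infinitePi_map hm]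
  simp_rw [hlaw]
  exact hFμ

namespace IsMixSpace

variable {V : Set (Measure ℝ)} {E : Set L0} {N : L0 → ℝ}

/-- Independent symmetric sequences in `E` with dominated distributions are weakly null. -/
lemma weaklyNull_of_symm (h : IsMixSpace V E N) {y : ℕ → L0} (hyE : ∀ k, y k ∈ E)
    (hyi : IsIndepSeq y)
    (hsymm : ∀ k, (volume : Measure I).map (fun u => -y k u) = (volume : Measure I).map (y k))
    (hd : ∀ k s, 0 ≤ s → (volume : Measure I) {u | s < |y k u|}
      ≤ (volume : Measure I) {u | s < |y 0 u|}) :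
    WeaklyNull E N y := by
  refine ⟨hyE, fun f ⟨C, hC⟩ => ?_⟩
  by_contra hcon
  rw [Metric.tendsto_atTop] at hcon
  push Not at hcon
  obtain ⟨δ, hδ, hfr⟩ := hcon
  obtain ⟨θ, hθ, hθδ⟩ := extraction_of_frequently_atTop (P := fun n => δ ≤ |f (y n)|) (by
    rw [frequently_atTop]
    intro n
    obtain ⟨m, hm, hm'⟩ := hfr n
    exact ⟨m, hm, by simpa [Real.dist_eq] using hm'⟩)
  -- The signs prevent cancellation in f, while symmetry keeps the signed sequence within the scope
  -- of `exists_mixNorm_sum_le`: some block of length m has norm too small for a value of f that is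
  -- at least mδ.
  set sg : ℕ → ℝ := fun k => if 0 ≤ f (y (θ k)) then 1 else -1
  have hsg : ∀ k, sg k * f (y (θ k)) = |f (y (θ k))| := fun k => by
    by_cases h0 : 0 ≤ f (y (θ k))
    · simp [sg, h0, abs_of_nonneg h0]
    · simp [sg, h0, abs_of_neg (not_le.1 h0)]
  have hsg1 : ∀ k, sg k = 1 ∨ sg k = -1 := fun k => by
    by_cases h0 : 0 ≤ f (y (θ k)) <;> simp [sg, h0]
  have hsga : ∀ k, |sg k| = 1 := fun k => by rcases hsg1 k with h | h <;> simp [h]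
  obtain ⟨m, hm1, hm⟩ := exists_mixNorm_sum_le h.fundamental (P := volume)
    (Y := fun k u => sg k * y (θ k) u) (fun k => (y (θ k)).measurable.const_mul _)
    ((hyi.precomp hθ.injective).comp (fun k z => sg k * z) fun k => measurable_const_mul _)
    (fun k => map_odd_comp (y (θ k)).measurable (hsymm (θ k)) (G := fun z => sg k * z)
      (measurable_const_mul _) (by simp))
    ((h.mem_iff _).1 (hyE 0)) (fun k s hs => by simpa [abs_mul, hsga] using hd (θ k) s hs)
    (ε := δ / (2 * (|C| + 1))) (by positivity)
  set z : L0 := ∑ k ∈ Finset.range m, sg k • y (θ k)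
  have hzE : z ∈ E := h.submodule.sum_mem fun k _ => h.submodule.smul_mem _ (hyE _)
  have hz : (z : I → ℝ) =ᵐ[volume] fun u => ∑ k ∈ Finset.range m, sg k * y (θ k) u := by
    have hall : ∀ᵐ u, ∀ k, (sg k • y (θ k) : L0) u = sg k * y (θ k) u := by
      rw [ae_all_iff]
      exact fun k => AEEqFun.coeFn_smul _ _
    filter_upwards [L0.coeFn_sum (Finset.range m) fun k => sg k • y (θ k), hall] with u h1 h2
    rw [h1]
    exact Finset.sum_congr rfl fun k _ => h2 k
  have hNz : N z ≤ m * (δ / (2 * (|C| + 1))) := by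
    rw [h.norm_eq, mixNorm_congr hz]
    exact ENNReal.toReal_le_of_le_ofReal (by positivity) hm
  have hfz : m * δ ≤ f z := by
    rw [map_sum]
    calc (m : ℝ) * δ = ∑ k ∈ Finset.range m, δ := by simp
      _ ≤ _ := Finset.sum_le_sum fun k _ => by
        rw [map_smul, smul_eq_mul, hsg]
        exact hθδ k
  have hN0 : 0 ≤ N z := by rw [h.norm_eq]; exact ENNReal.toReal_nonneg
  have h1 : m * δ ≤ |C| * (m * (δ / (2 * (|C| + 1)))) :=
    calc m * δ ≤ |f z| := hfz.trans (le_abs_self _)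
      _ ≤ C * N z := hC z hzE
      _ ≤ |C| * N z := by gcongr; exact le_abs_self C
      _ ≤ _ := by gcongr
  have hmpos : (0 : ℝ) < m := by exact_mod_cast hm1
  have h2 : |C| * (m * (δ / (2 * (|C| + 1)))) = m * δ * (|C| / (2 * (|C| + 1))) := by ring
  have h3 : |C| / (2 * (|C| + 1)) < 1 := by
    rw [div_lt_one (by positivity)]
    linarith [abs_nonneg C]
  rw [h2] at h1
  nlinarith [mul_pos hmpos hδ]

lemma rpow_bound_of_isBSSequence (h : IsMixSpace V E N) {p : ℝ} {x : ℕ → L0}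
    (hx : IsBSSequence E N p x) : ∃ C : ℝ, 0 ≤ C ∧ ∀ m : ℕ, 1 ≤ m →
      mixNorm V volume (fun u => ∑ k ∈ Finset.range m, x k u)
        ≤ ENNReal.ofReal (C * (m : ℝ) ^ (1 / p)) := by
  obtain ⟨hE, -, hs⟩ := hx
  obtain ⟨C, hC⟩ := hs id strictMono_id
  refine ⟨|C|, abs_nonneg C, fun m hm => ?_⟩
  have hmE : ∑ k ∈ Finset.range m, x k ∈ E := h.submodule.sum_mem fun k _ => hE k
  rw [← mixNorm_congr (L0.coeFn_sum (Finset.range m) x), ← h.ofReal_norm hmE]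
  refine ENNReal.ofReal_le_ofReal ?_
  have hmpos : (0 : ℝ) < m := by exact_mod_cast hm
  have h1 := hC m hm
  rw [Real.rpow_neg hmpos.le, inv_mul_le_iff₀ (by positivity)] at h1
  calc N (∑ k ∈ Finset.range m, x k) ≤ (m : ℝ) ^ (1 / p) * C := h1
    _ ≤ |C| * (m : ℝ) ^ (1 / p) := by
      rw [mul_comm]
      gcongr
      exact le_abs_self C

/-! ### Growth of iid symmetric sums without order continuity -/

/-- A slowly decreasing positive sequence of weights attached to a sequence of levels. -/
noncomputable def levelWeight (M : ℕ → ℕ) (hM : StrictMono M) (t : ℝ) : ℝ :=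
  (1 / 2 : ℝ) ^ Nat.find (p := fun j => t ≤ M j)
    ((exists_nat_ge t).imp fun n hn => hn.trans (by exact_mod_cast hM.le_apply))

lemma levelWeight_nonneg (M : ℕ → ℕ) (hM : StrictMono M) (t : ℝ) : 0 ≤ levelWeight M hM t := by
  unfold levelWeight
  positivity

lemma antitone_levelWeight (M : ℕ → ℕ) (hM : StrictMono M) : Antitone (levelWeight M hM) :=
  fun s t hst => by
    unfold levelWeight
    refine pow_le_pow_of_le_one (by norm_num) (by norm_num) ?_
    exact Nat.find_mono fun n hn => hst.trans hn

lemma le_levelWeight (M : ℕ → ℕ) (hM : StrictMono M) {t : ℝ} {j : ℕ} (h : t ≤ M j) :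
    (1 / 2 : ℝ) ^ j ≤ levelWeight M hM t := by
  unfold levelWeight
  refine pow_le_pow_of_le_one (by norm_num) (by norm_num) ?_
  exact Nat.find_min' _ h

lemma levelWeight_le (M : ℕ → ℕ) (hM : StrictMono M) {t : ℝ} {j : ℕ} (h : M j < t) :
    levelWeight M hM t ≤ (1 / 2 : ℝ) ^ j := by
  unfold levelWeight
  refine pow_le_pow_of_le_one (by norm_num) (by norm_num) ?_
  rw [Nat.le_find_iff]
  intro i hi
  rw [not_le]
  exact lt_of_le_of_lt (by exact_mod_cast hM.monotone hi.le) h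

lemma levelWeight_le_one (M : ℕ → ℕ) (hM : StrictMono M) (t : ℝ) : levelWeight M hM t ≤ 1 := by
  unfold levelWeight
  exact pow_le_one₀ (by norm_num) (by norm_num)

/-- Beyond level M j the weight is at most 2^{-j}, so the product is dominated by M j + 2^{-j}|U|, a
bounded function up to an error of small norm. -/
lemma hasOCNorm_levelWeight_mul {U : I → ℝ} (hV : FundamentalTendstoZero V)
    (hU : Measurable U) (hUV : mixNorm V volume U < ∞)
    (M : ℕ → ℕ) (hM : StrictMono M) :
    HasOCNorm V volume (fun u => levelWeight M hM |U u| * U u) := by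
  have hc : Measurable (levelWeight M hM) := (antitone_levelWeight M hM).measurable
  refine hasOCNorm_of_approx hV ((hc.comp hU.abs).mul hU) fun ε hε => ?_
  have hlim : Tendsto (fun j : ℕ => ENNReal.ofReal ((1 / 2 : ℝ) ^ j) * mixNorm V volume U)
      atTop (𝓝 0) := by
    have h1 : Tendsto (fun j : ℕ => ENNReal.ofReal ((1 / 2 : ℝ) ^ j)) atTop (𝓝 0) := by
      simpa using ENNReal.tendsto_ofReal
        (tendsto_pow_atTop_nhds_zero_of_lt_one (r := (1 / 2 : ℝ)) (by norm_num) (by norm_num))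
    simpa using ENNReal.Tendsto.mul_const h1 (Or.inr hUV.ne)
  obtain ⟨j, hj⟩ := (hlim.eventually_le_const hε).exists
  refine ⟨M j, fun u => (1 / 2 : ℝ) ^ j * U u, by positivity, hU.const_mul _, fun u => ?_, ?_⟩
  · rw [abs_mul, abs_mul, abs_of_nonneg (levelWeight_nonneg M hM _),
      abs_of_nonneg (by positivity : (0 : ℝ) ≤ (1 / 2) ^ j)]
    rcases le_or_gt |U u| (M j) with h1 | h1
    · calc levelWeight M hM |U u| * |U u| ≤ 1 * |U u| := by
            gcongr; exact levelWeight_le_one M hM _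
        _ ≤ M j := by rwa [one_mul]
        _ ≤ _ := le_add_of_nonneg_right (by positivity)
    · calc levelWeight M hM |U u| * |U u| ≤ (1 / 2 : ℝ) ^ j * |U u| := by
            gcongr; exact levelWeight_le M hM h1
        _ ≤ _ := le_add_of_nonneg_left (by positivity)
  · refine (mixNorm_const_mul_le hU.aemeasurable _).trans ?_
    rwa [abs_of_nonneg (by positivity : (0 : ℝ) ≤ (1 / 2) ^ j)]

/-- By the Fatou property, a large norm of a finite sum is already visible after truncating the
summands at a finite level. -/
lemma exists_truncation_gt {U : ℕ → I → ℝ} (hU : ∀ k, Measurable (U k)) {m : ℕ} {c : ℝ≥0∞}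
    (hc : c < mixNorm V volume (fun u => ∑ k ∈ Finset.range m, U k u)) :
    ∀ᶠ n : ℕ in atTop, c < mixNorm V volume
      (fun u => ∑ k ∈ Finset.range m, {u | |U k u| ≤ n}.indicator (U k) u) := by
  refine eventually_lt_of_lt_liminf (hc.trans_le (mixNorm_le_liminf (by fun_prop) (fun n =>
    Finset.measurable_fun_sum _ fun k _ => (hU k).indicator (measurableSet_abs_le (hU k) n))
    (ae_of_all _ fun u => ?_)))
  refine tendsto_finsetSum _ fun k _ => tendsto_const_nhds.congr' ?_
  obtain ⟨n₀, hn₀⟩ := exists_nat_ge |U k u|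
  filter_upwards [eventually_ge_atTop n₀] with n hn
  rw [indicator_of_mem]
  exact hn₀.trans (by exact_mod_cast hn)

/-- If `p ∈ Γ_iid(E)`, then the sums of independent identically distributed symmetric variables
with finite norm, which need not have order continuous norm, grow at most as `m^{1/p}`. -/
theorem rpow_bound_of_mem_gammaIid (h : IsMixSpace V E N) {p : ℝ} (hp : p ∈ GammaIid E N)
    {U : ℕ → I → ℝ} (hU : ∀ k, Measurable (U k)) (hUi : iIndepFun U volume)
    (hlaw : ∀ k, (volume : Measure I).map (U k) = (volume : Measure I).map (U 0))
    (hsymm : (volume : Measure I).map (fun u => -U 0 u) = (volume : Measure I).map (U 0))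
    (hfin : mixNorm V volume (U 0) < ∞) :
    ∃ C : ℝ, 0 ≤ C ∧ ∀ m : ℕ, 1 ≤ m →
      mixNorm V volume (fun u => ∑ k ∈ Finset.range m, U k u)
        ≤ ENNReal.ofReal (C * (m : ℝ) ^ (1 / p)) := by
  by_contra! hcon
  have hsymm' : ∀ k, (volume : Measure I).map (fun u => -U k u)
      = (volume : Measure I).map (U k) := fun k => by
    have e1 : (volume : Measure I).map (fun u => -U k u)
        = ((volume : Measure I).map (U k)).map (fun z => -z) :=
      (Measure.map_map measurable_neg (hU k)).symm
    have e2 : (volume : Measure I).map (fun u => -U 0 u)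
        = ((volume : Measure I).map (U 0)).map (fun z => -z) :=
      (Measure.map_map measurable_neg (hU 0)).symm
    rw [e1, hlaw k, ← e2, hsymm]
  -- The lengths m j violate the bound with constant 4^j, and the levels M j retain this violation
  -- for summands truncated at M j. Below M j the damping costs at most a factor 2^{-j}, which
  -- leaves a violation by 2^j.
  choose m hm1 hm using fun j : ℕ => hcon ((4 : ℝ) ^ j) (by positivity)
  obtain ⟨M, hM, hMm⟩ := extraction_forall_of_eventually fun j => exists_truncation_gt hU (hm j)
  set G : ℝ → ℝ := fun z => levelWeight M hM |z| * z
  have hw : Measurable (levelWeight M hM) := (antitone_levelWeight M hM).measurable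
  have hG : Measurable G := (hw.comp measurable_id.abs).mul measurable_id
  have hGodd : ∀ z, G (-z) = -G z := fun z => by simp [G]
  have hGm : ∀ k, Measurable fun u => G (U k u) := fun k => hG.comp (hU k)
  have hGlaw : ∀ k, (volume : Measure I).map (fun u => G (U k u))
      = (volume : Measure I).map (fun u => G (U 0 u)) := fun k => by
    have e : ∀ k, (volume : Measure I).map (fun u => G (U k u))
        = ((volume : Measure I).map (U k)).map G := fun k => (Measure.map_map hG (hU k)).symm
    rw [e, e, hlaw k]
  have hGdist : ∀ k (s : ℝ), (volume : Measure I) {u | s < |G (U k u)|}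
      = (volume : Measure I) {u | s < |G (U 0 u)|} := fun k s => by
    have hms : MeasurableSet {z : ℝ | s < |z|} :=
      measurableSet_lt measurable_const measurable_id.abs
    have := congrArg (fun μ => μ {z : ℝ | s < |z|}) (hGlaw k)
    simpa [Measure.map_apply (hGm _) hms] using this
  set y : ℕ → L0 := fun k => AEEqFun.mk (fun u => G (U k u)) (hGm k).aestronglyMeasurable
  have hy : ∀ k, (y k : I → ℝ) =ᵐ[volume] fun u => G (U k u) := fun k => AEEqFun.coeFn_mk _ _
  have hyd : ∀ k (s : ℝ), (volume : Measure I) {u | s < |y k u|}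
      = (volume : Measure I) {u | s < |G (U 0 u)|} := fun k s => by
    rw [← hGdist k]
    refine measure_congr ?_
    filter_upwards [hy k] with u hu
    exact congrArg (fun z => s < |z|) hu
  have hyi : IsIndepSeq y :=
    iIndepFun.congr (fun k => (hy k).symm) (hUi.comp (fun _ => G) fun _ => hG)
  have hyE : ∀ k, y k ∈ E := fun k => by
    rw [h.mem_iff]
    exact (hasOCNorm_levelWeight_mul h.fundamental (hU 0) hfin M hM).of_dist
      fun s _ => (hyd k s).le
  have hysymm : ∀ k, (volume : Measure I).map (fun u => -y k u)
      = (volume : Measure I).map (y k) := fun k => by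
    have e : (volume : Measure I).map (fun u => -y k u)
        = (volume : Measure I).map (fun u => -G (U k u)) := Measure.map_congr (hy k).neg
    rw [Measure.map_congr (hy k), e]
    exact map_odd_comp (hU k) (hsymm' k) hG hGodd
  have hyiid : IsIIDSeq y := ⟨hyi, fun k => ⟨(y k).measurable.aemeasurable,
    (y 0).measurable.aemeasurable, by
      rw [Measure.map_congr (hy k), Measure.map_congr (hy 0), hGlaw k]⟩⟩
  obtain ⟨θ, hθ, hBS⟩ := hp.2 y
    (h.weaklyNull_of_symm hyE hyi hysymm fun k s _ => by rw [hyd k, hyd 0]) hyiid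
  obtain ⟨C, hC0, hC⟩ := h.rpow_bound_of_isBSSequence hBS
  -- The argument ends with (1/2)^j · 4^j ≤ 2C, the factor 2 coming from the comparison of sums.
  obtain ⟨j, hj⟩ := pow_unbounded_of_one_lt (2 * C) (by norm_num : (1 : ℝ) < 2)
  set T : ℝ → ℝ := fun z => {z : ℝ | |z| ≤ M j}.indicator id z
  have hT : Measurable T :=
    measurable_id.indicator (measurableSet_le measurable_id.abs measurable_const)
  have hTodd : ∀ z, T (-z) = -T z := fun z => by
    by_cases h : |z| ≤ M j <;> simp [T, indicator, h]
  set T' : ℝ → ℝ := fun z => (1 / 2 : ℝ) ^ j * T z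
  have hT' : Measurable T' := hT.const_mul _
  have hTle : ∀ z, |T' z| ≤ |G z| := fun z => by
    by_cases hz : |z| ≤ M j
    · simp only [T', T, G, abs_mul, abs_of_nonneg (levelWeight_nonneg M hM _),
        indicator_of_mem (show z ∈ {z : ℝ | |z| ≤ M j} from hz), id]
      rw [abs_of_nonneg (by positivity : (0 : ℝ) ≤ (1 / 2) ^ j)]
      gcongr
      exact le_levelWeight M hM hz
    · simp [T', T, indicator_of_notMem (show z ∉ {z : ℝ | |z| ≤ M j} from hz)]
  have hTb : ∀ k u, |T' (U k u)| ≤ (1 / 2 : ℝ) ^ j * M j := fun k u => by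
    rw [abs_mul, abs_of_nonneg (by positivity : (0 : ℝ) ≤ (1 / 2) ^ j)]
    gcongr
    exact abs_indicator_le_const (f := id) (by positivity) (U k u)
  have hT0 : ∀ k, ∫ u, T' (U k u) = 0 := fun k =>
    integral_eq_zero_of_symm (hT'.comp (hU k))
      (map_odd_comp (hU k) (hsymm' k) hT' fun z => by simp [T', hTodd])
  -- All damped variables have the same law, so the first m j of the U k can be compared with terms
  -- of the arbitrary subsequence θ: only tails matter.
  have hcomp := mixNorm_sum_centred_le V (P := volume) (P' := volume)
    (X := fun k u => T' (U k u)) (Q := fun k u => y (θ k) u) (fun k => hT'.comp (hU k))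
    (fun k => (y (θ k)).measurable) (hUi.comp (fun _ => T') fun _ => hT')
    (hyi.precomp hθ.injective)
    (fun k => Integrable.of_bound (hT'.comp (hU k)).aestronglyMeasurable _
      (ae_of_all _ (hTb k)))
    (fun k => hysymm (θ k)) (fun k s _ => by
      rw [hyd, ← hGdist k]
      exact measure_mono fun u (hu : s < |T' (U k u)|) => lt_of_lt_of_le hu (hTle _)) (m j)
  simp only [hT0, sub_zero] at hcomp
  have hTm : AEMeasurable (fun u => ∑ k ∈ Finset.range (m j), T (U k u)) volume :=
    (Finset.measurable_fun_sum _ fun k _ => hT.comp (hU k)).aemeasurable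
  have hmpos : (0 : ℝ) < (m j : ℝ) ^ (1 / p) := by
    have : (0 : ℝ) < m j := by exact_mod_cast hm1 j
    positivity
  have e1 : mixNorm V volume (fun u => ∑ k ∈ Finset.range (m j), T' (U k u))
      = ENNReal.ofReal ((1 / 2) ^ j)
        * mixNorm V volume (fun u => ∑ k ∈ Finset.range (m j), T (U k u)) := by
    simp only [T', ← Finset.mul_sum]
    rw [mixNorm_const_mul hTm (by positivity), abs_of_nonneg (by positivity)]
  have e2 : ENNReal.ofReal ((1 / 2 : ℝ) ^ j) * ENNReal.ofReal (4 ^ j * (m j : ℝ) ^ (1 / p))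
      ≤ 2 * ENNReal.ofReal (C * (m j : ℝ) ^ (1 / p)) := by
    refine le_trans ?_ (hcomp.trans (mul_le_mul_right (hC _ (hm1 j)) 2))
    rw [e1]
    gcongr
    exact (hMm j).le
  have h2 : (2 : ℝ≥0∞) = ENNReal.ofReal 2 := by simp
  rw [h2, ← ENNReal.ofReal_mul (by positivity), ← ENNReal.ofReal_mul (by positivity),
    ENNReal.ofReal_le_ofReal_iff (by positivity), ← mul_assoc, ← mul_assoc, ← mul_pow] at e2
  have e3 := le_of_mul_le_mul_right e2 hmpos
  norm_num at e3
  linarith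

end IsMixSpace

/-! ### The rearrangement -/

lemma rearrangement_nonneg (x : L0) (t : ℝ) : 0 ≤ rearrangement x t :=
  Real.sInf_nonneg fun _ hs => hs.1

/-- The tail is right continuous in s, so a strict inequality at s persists slightly above s and
pushes the infimum strictly beyond s. -/
lemma lt_rearrangement_iff (x : L0) {t s : ℝ} (ht : 0 < t) (hs : 0 ≤ s) :
    s < rearrangement x t ↔ ENNReal.ofReal t < (volume : Measure I) {u | s < |x u|} := by
  have hbd : BddBelow {s : ℝ | 0 ≤ s ∧ (volume : Measure I) {u : I | s < |x u|}
    ≤ ENNReal.ofReal t} := ⟨0, fun s hs => hs.1⟩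
  constructor
  · intro h
    by_contra! hc
    exact not_lt.2 (csInf_le hbd (⟨hs, hc⟩ : s ∈ {s : ℝ | 0 ≤ s ∧ _})) h
  · intro h
    have hU : ⋃ n : ℕ, {u : I | s + 1 / ((n : ℝ) + 1) < |x u|} = {u | s < |x u|} := by
      ext u
      simp only [mem_iUnion, mem_ofPred_eq]
      constructor
      · rintro ⟨n, hn⟩
        exact lt_trans (by linarith [Nat.one_div_pos_of_nat (α := ℝ) (n := n)]) hn
      · intro hu
        obtain ⟨n, hn⟩ := exists_nat_one_div_lt (sub_pos.2 hu)
        exact ⟨n, by linarith⟩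
    have hmono : Monotone fun n : ℕ => {u : I | s + 1 / ((n : ℝ) + 1) < |x u|} :=
      fun a b hab u (hu : s + 1 / ((a : ℝ) + 1) < |x u|) => by
        have := Nat.one_div_le_one_div (α := ℝ) hab
        exact lt_of_le_of_lt (by linarith) hu
    have hlim := tendsto_measure_iUnion_atTop (μ := (volume : Measure I)) hmono
    rw [hU] at hlim
    obtain ⟨n, hn⟩ := (hlim.eventually_const_lt h).exists
    have hpos := Nat.one_div_pos_of_nat (α := ℝ) (n := n)
    refine lt_of_lt_of_le (by linarith : s < s + 1 / ((n : ℝ) + 1))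
      (le_csInf (exists_measure_lt_abs_le x.measurable.aemeasurable (ENNReal.ofReal_pos.2 ht)) ?_)
    rintro e ⟨-, he⟩
    by_contra! hc
    refine not_lt.2 he (lt_of_lt_of_le hn (measure_mono fun u hu => ?_))
    exact lt_trans hc hu

lemma measure_rearrangement_lt_abs_le (x : L0) {t : ℝ} (ht : 0 < t) :
    (volume : Measure I) {u | rearrangement x t < |x u|} ≤ ENNReal.ofReal t :=
  not_lt.1 fun h => lt_irrefl _ ((lt_rearrangement_iff x ht (rearrangement_nonneg x t)).2 h)

lemma rearrangement_anti (x : L0) {s t : ℝ} (hs : 0 < s) (hst : s ≤ t) :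
    rearrangement x t ≤ rearrangement x s := by
  by_contra! hc
  rw [lt_rearrangement_iff x (hs.trans_le hst) (rearrangement_nonneg x s)] at hc
  exact not_lt.2 ((measure_rearrangement_lt_abs_le x hs).trans
    (ENNReal.ofReal_le_ofReal hst)) hc

/-- Markov's inequality; it keeps each quantile of an L¹-bounded sequence in a fixed compact
interval. -/
lemma mul_rearrangement_le (x : L0) {t C : ℝ} (ht : 0 < t)
    (hC : ∫⁻ u, ENNReal.ofReal |x u| ≤ ENNReal.ofReal C) (hC0 : 0 ≤ C) :
    rearrangement x t ≤ C / t := by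
  by_contra! hc
  rw [lt_rearrangement_iff x ht (by positivity)] at hc
  have h1 := mul_meas_ge_le_lintegral₀ (μ := (volume : Measure I))
    (f := fun u => ENNReal.ofReal |x u|) x.measurable.abs.ennreal_ofReal.aemeasurable
    (ENNReal.ofReal (C / t))
  have h2 : (volume : Measure I) {u | C / t < |x u|}
      ≤ (volume : Measure I) {u | ENNReal.ofReal (C / t) ≤ ENNReal.ofReal |x u|} :=
    measure_mono fun u hu => ENNReal.ofReal_le_ofReal (le_of_lt hu)
  rcases hC0.eq_or_lt with rfl | hCpos
  · have hz : ∫⁻ u, ENNReal.ofReal |x u| = 0 := le_antisymm (by simpa using hC) zero_le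
    rw [lintegral_abs x.measurable.aemeasurable] at hz
    have h0 : (volume : Measure I) {u | (0 : ℝ) < |x u|} = 0 := by
      rw [← lintegral_abs x.measurable.aemeasurable,
        lintegral_eq_zero_iff x.measurable.abs.ennreal_ofReal] at hz
      rw [← nonpos_iff_eq_zero, ← (ae_iff.1 hz : (volume : Measure I) _ = 0)]
      refine measure_mono fun u (hu : 0 < |x u|) => ?_
      simpa using hu
    rw [zero_div, h0] at hc
    exact not_lt_zero hc
  · have h3 : ENNReal.ofReal (C / t) * ENNReal.ofReal t
        < ENNReal.ofReal (C / t) * (volume : Measure I) {u | C / t < |x u|} :=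
      (ENNReal.mul_lt_mul_iff_right (by simp; positivity) ENNReal.ofReal_ne_top).2 hc
    rw [← ENNReal.ofReal_mul (by positivity), div_mul_cancel₀ _ ht.ne'] at h3
    exact not_lt.2 ((mul_le_mul_right h2 _).trans (h1.trans hC)) h3

/-! ### A symmetric law with prescribed dyadic quantiles -/

/-- The symmetric law which charges `± q j` with mass `2^{-(j+2)}` each. -/
noncomputable def dyadicLaw (q : ℕ → ℝ) : Measure ℝ :=
  Measure.sum fun j => (2⁻¹ : ℝ≥0∞) ^ (j + 2) • (Measure.dirac (q j) + Measure.dirac (-q j))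

lemma dyadicLaw_apply (q : ℕ → ℝ) {s : Set ℝ} (hs : MeasurableSet s) :
    dyadicLaw q s = ∑' j, (2⁻¹ : ℝ≥0∞) ^ (j + 2) * (s.indicator 1 (q j) + s.indicator 1 (-q j)) := by
  rw [dyadicLaw, Measure.sum_apply _ hs]
  simp [Measure.dirac_apply' _ hs, mul_add]

lemma dyadicLaw_map_neg (q : ℕ → ℝ) : (dyadicLaw q).map (fun z => -z) = dyadicLaw q := by
  ext s hs
  rw [Measure.map_apply measurable_neg hs, dyadicLaw_apply q hs,
    dyadicLaw_apply q (measurable_neg hs)]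
  refine tsum_congr fun j => ?_
  change _ * (s.indicator 1 (-q j) + s.indicator 1 (- -q j)) = _
  rw [neg_neg, add_comm (s.indicator 1 (-q j))]

lemma two_inv_pow_mul_two (j : ℕ) : (2⁻¹ : ℝ≥0∞) ^ (j + 2) * (1 + 1) = 2⁻¹ ^ (j + 1) := by
  rw [pow_succ _ (j + 1), mul_assoc, one_add_one_eq_two,
    ENNReal.inv_mul_cancel (by simp) (by simp), mul_one]

lemma tsum_two_inv_pow_add (j₀ : ℕ) : ∑' i : ℕ, (2⁻¹ : ℝ≥0∞) ^ (i + j₀ + 1) = 2⁻¹ ^ j₀ := by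
  have h : ∀ i : ℕ, (2⁻¹ : ℝ≥0∞) ^ (i + j₀ + 1) = 2⁻¹ ^ (j₀ + 1) * 2⁻¹ ^ i := fun i => by
    rw [← pow_add]
    congr 1
    ring
  simp_rw [h]
  rw [ENNReal.tsum_mul_left, ENNReal.tsum_geometric, ENNReal.one_sub_inv_two, inv_inv, pow_succ,
    mul_assoc, ENNReal.inv_mul_cancel (by simp) (by simp), mul_one]

instance (q : ℕ → ℝ) : IsProbabilityMeasure (dyadicLaw q) := ⟨by
  rw [dyadicLaw_apply q MeasurableSet.univ]
  simpa [two_inv_pow_mul_two] using tsum_two_inv_pow_add 0⟩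

lemma dyadicLaw_tail {q : ℕ → ℝ} (hq : ∀ j, 0 ≤ q j) (t : ℝ) :
    dyadicLaw q {z | t < |z|} = ∑' j, if t < q j then (2⁻¹ : ℝ≥0∞) ^ (j + 1) else 0 := by
  rw [dyadicLaw_apply q (measurableSet_lt (by fun_prop) (by fun_prop))]
  refine tsum_congr fun j => ?_
  by_cases h : t < q j
  · simp [indicator, h, abs_of_nonneg (hq j), two_inv_pow_mul_two]
  · simp [indicator, h, abs_of_nonneg (hq j)]

/-- All pairs of atoms ± q j with j ≥ j₀ lie beyond t, and their masses 2^{-(j+1)} add up to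
2^{-j₀}. -/
lemma le_dyadicLaw_tail {q : ℕ → ℝ} (hq : ∀ j, 0 ≤ q j) (hm : Monotone q) {t : ℝ} {j₀ : ℕ}
    (h : t < q j₀) : (2⁻¹ : ℝ≥0∞) ^ j₀ ≤ dyadicLaw q {z | t < |z|} := by
  rw [dyadicLaw_tail hq, ← tsum_two_inv_pow_add j₀]
  refine le_trans (le_of_eq (tsum_congr fun i => ?_)) (ENNReal.tsum_comp_le_tsum_of_injective
    (add_left_injective j₀) fun j => if t < q j then (2⁻¹ : ℝ≥0∞) ^ (j + 1) else 0)
  rw [if_pos (h.trans_le (hm (Nat.le_add_left _ _)))]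

lemma dyadicLaw_tail_le {q : ℕ → ℝ} (hq : ∀ j, 0 ≤ q j) {t : ℝ} {j₀ : ℕ}
    (h : ∀ j < j₀, q j ≤ t) : dyadicLaw q {z | t < |z|} ≤ (2⁻¹ : ℝ≥0∞) ^ j₀ := by
  rw [dyadicLaw_tail hq, ← tsum_two_inv_pow_add j₀,
    ← ENNReal.summable.sum_add_tsum_nat_add' (k := j₀),
    Finset.sum_eq_zero fun j hj => if_neg (not_lt.2 (h j (Finset.mem_range.1 hj))), zero_add]
  refine ENNReal.tsum_le_tsum fun i => ?_
  split_ifs <;> simp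

/-! ### The general theorem -/

/-- Parts with small supports of weakly null sequences of independent variables have subsequences
with bounded partial sums. -/
def SmallSupportProperty (V : Set (Measure ℝ)) (E : Set L0) (N : L0 → ℝ) : Prop :=
  ∀ x : ℕ → L0, WeaklyNull E N x → IsIndepSeq x → ∀ v : ℕ → I → ℝ, (∀ n, Measurable (v n)) →
    (∀ n u, |v n u| ≤ |x n u|) →
    Tendsto (fun n => (volume : Measure I) {u | v n u ≠ 0}) atTop (𝓝 0) →
    ∃ θ : ℕ → ℕ, StrictMono θ ∧ ∃ C : ℝ≥0∞, C ≠ ∞ ∧ ∀ S : Finset ℕ,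
      mixNorm V volume (fun u => ∑ k ∈ S, |v (θ k) u|) ≤ C

lemma WeaklyNull.subseq {E : Set L0} {N : L0 → ℝ} {x : ℕ → L0} (hx : WeaklyNull E N x)
    {θ : ℕ → ℕ} (hθ : StrictMono θ) : WeaklyNull E N (fun n => x (θ n)) :=
  ⟨fun _ => hx.1 _, fun f hf => (hx.2 f hf).comp hθ.tendsto_atTop⟩

lemma IsIndepSeq.subseq {x : ℕ → L0} (hx : IsIndepSeq x)
    {θ : ℕ → ℕ} (hθ : StrictMono θ) : IsIndepSeq (fun n => x (θ n)) :=
  hx.precomp hθ.injective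

namespace IsMixSpace

variable {V : Set (Measure ℝ)} {E : Set L0} {N : L0 → ℝ}

/-- A bounded sequence has a subsequence whose dyadic quantiles converge. -/
lemma exists_subseq_quantiles (h : IsMixSpace V E N) {x : ℕ → L0} (hx : ∀ n, x n ∈ E) {B : ℝ}
    (hB : ∀ n, N (x n) ≤ B) : ∃ (φ : ℕ → ℕ) (c : ℕ → ℝ), StrictMono φ ∧
      ∀ j, Tendsto (fun n => rearrangement (x (φ n)) ((1 / 2) ^ (j + 1))) atTop (𝓝 (c j)) := by
  obtain ⟨C, hC, hCf⟩ := h.lintegral_le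
  have hB0 : 0 ≤ B := le_trans (by rw [h.norm_eq]; exact ENNReal.toReal_nonneg) (hB 0)
  have hL1 : ∀ n, ∫⁻ u, ENNReal.ofReal |x n u| ≤ ENNReal.ofReal (C.toReal * B) := fun n => by
    rw [ENNReal.ofReal_mul ENNReal.toReal_nonneg, ENNReal.ofReal_toReal hC]
    refine (hCf _ (x n).measurable).trans ?_
    gcongr
    rw [← h.ofReal_norm (hx n)]
    exact ENNReal.ofReal_le_ofReal (hB n)
  -- Compactness of a countable product of intervals replaces a diagonal extraction.
  obtain ⟨c, -, φ, hφ, hc⟩ := (isCompact_univ_pi fun j : ℕ =>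
    isCompact_Icc (a := (0 : ℝ)) (b := C.toReal * B / (1 / 2) ^ (j + 1))).tendsto_subseq
    (x := fun n j => rearrangement (x n) ((1 / 2) ^ (j + 1))) fun n j _ =>
      ⟨rearrangement_nonneg _ _, mul_rearrangement_le _ (by positivity) (hL1 n) (by positivity)⟩
  exact ⟨φ, c, hφ, fun j => (tendsto_pi_nhds.1 hc) j⟩

lemma ofReal_half_pow (j : ℕ) : ENNReal.ofReal ((1 / 2 : ℝ) ^ j) = (2⁻¹ : ℝ≥0∞) ^ j := by
  rw [ENNReal.ofReal_pow (by norm_num), one_div, ENNReal.ofReal_inv_of_pos (by norm_num)]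
  simp

/-- Truncations at the level of a dyadic quantile are stochastically dominated. -/
lemma tail_truncation_le {x : L0} {q : ℕ → ℝ} (hq0 : ∀ j, 0 ≤ q j) (hq : Monotone q) {n : ℕ}
    (hn : ∀ j ≤ n, rearrangement x ((1 / 2) ^ (j + 1)) ≤ q j) {s : ℝ} (hs : 0 ≤ s) :
    (volume : Measure I)
      {u | s < |{u | |x u| ≤ rearrangement x ((1 / 2) ^ (n + 1))}.indicator x u|}
      ≤ dyadicLaw q {z | s < |z|} := by
  set M := rearrangement x ((1 / 2) ^ (n + 1))
  have hM0 : 0 ≤ M := rearrangement_nonneg _ _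
  rcases le_or_gt M s with hMs | hMs
  · have : {u | s < |{u | |x u| ≤ M}.indicator x u|} = ∅ := by
      ext u
      simp only [mem_ofPred_eq, mem_empty_iff_false, iff_false, not_lt]
      exact (abs_indicator_le_const hM0 u).trans hMs
    simp [this]
  have hex : ∃ j : ℕ, (2⁻¹ : ℝ≥0∞) ^ (j + 1) < (volume : Measure I) {u | s < |x u|} :=
    ⟨n, by rw [← ofReal_half_pow]; exact (lt_rearrangement_iff x (by positivity) hs).1 hMs⟩
  -- At the first scale j₀ with 2^{-(j₀+1)} below the tail at s, minimality bounds this tail by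
  -- 2^{-j₀}, while s < x*(2^{-(j₀+1)}) ≤ q j₀ makes the tail of the law at least 2^{-j₀}. The
  -- truncation forces j₀ ≤ n, the range where q controls the quantiles.
  set j₀ := Nat.find hex
  have hj : (2⁻¹ : ℝ≥0∞) ^ (j₀ + 1) < (volume : Measure I) {u | s < |x u|} := Nat.find_spec hex
  have hjn : j₀ ≤ n := Nat.find_min' hex (by
    rw [← ofReal_half_pow]; exact (lt_rearrangement_iff x (by positivity) hs).1 hMs)
  calc _ ≤ (volume : Measure I) {u | s < |x u|} := measure_mono fun u
          (hu : s < |{u | |x u| ≤ M}.indicator x u|) => by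
        refine lt_of_lt_of_le hu ?_
        by_cases h1 : |x u| ≤ M
        · rw [indicator_of_mem (show u ∈ {u | |x u| ≤ M} from h1)]
        · rw [indicator_of_notMem (show u ∉ {u | |x u| ≤ M} from h1)]
          simp
    _ ≤ (2⁻¹ : ℝ≥0∞) ^ j₀ := by
        rcases Nat.eq_zero_or_pos j₀ with h0 | h0
        · rw [h0, pow_zero]
          exact prob_le_one
        · have := Nat.find_min hex (Nat.sub_one_lt_of_lt h0)
          rwa [not_lt, Nat.sub_add_cancel h0] at this
    _ ≤ _ := by
        refine le_dyadicLaw_tail hq0 hq (lt_of_lt_of_le ?_ (hn j₀ hjn))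
        rw [lt_rearrangement_iff x (by positivity) hs, ofReal_half_pow]
        exact hj

/-- The law with the limit quantiles, shifted by one, has finite norm. -/
lemma mixNorm_dyadicLaw_lt_top (h : IsMixSpace V E N) {x : ℕ → L0} (hx : ∀ n, x n ∈ E) {B : ℝ}
    (hB : ∀ n, N (x n) ≤ B) {c : ℕ → ℝ} (hc0 : ∀ j, 0 ≤ c j)
    (hc : ∀ j, Tendsto (fun n => rearrangement (x n) ((1 / 2) ^ (j + 1))) atTop (𝓝 (c j)))
    {U : I → ℝ} (hU : Measurable U) (hlaw : (volume : Measure I).map U = dyadicLaw fun j => c j + 1) :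
    mixNorm V volume U < ∞ := by
  have hW : Measurable fun u => max (|U u| - 1) 0 := by fun_prop
  -- After undoing the shift by 1, let j₀ be first with s < c j₀. The left side is at most 2^{-j₀},
  -- whereas the tails of x n at s are eventually at least 2^{-(j₀+1)}: the factor 2 is the loss of
  -- one dyadic scale.
  have htail : ∀ s : ℝ, 0 < s → (volume : Measure I) {u | s < |max (|U u| - 1) 0|}
      ≤ 2 * liminf (fun n => (volume : Measure I) {u | s < |x n u|}) atTop := fun s hs => by
    have hset : {u | s < |max (|U u| - 1) 0|} = U ⁻¹' {z | s + 1 < |z|} := by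
      ext u
      simp only [mem_ofPred_eq, mem_preimage, abs_of_nonneg (le_max_right (|U u| - 1) 0),
        lt_max_iff, hs.not_gt, or_false]
      exact lt_sub_iff_add_lt
    rw [hset, ← Measure.map_apply hU (measurableSet_lt (by fun_prop) (by fun_prop)), hlaw]
    have hq0 : ∀ j, 0 ≤ c j + 1 := fun j => by linarith [hc0 j]
    by_cases hex : ∃ j, s < c j
    · set j₀ := Nat.find hex
      have h1 : dyadicLaw (fun j => c j + 1) {z | s + 1 < |z|} ≤ (2⁻¹ : ℝ≥0∞) ^ j₀ :=
        dyadicLaw_tail_le hq0 fun j hj => by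
          have := not_lt.1 (Nat.find_min hex hj)
          linarith
      have h2 : (2⁻¹ : ℝ≥0∞) ^ (j₀ + 1)
          ≤ liminf (fun n => (volume : Measure I) {u | s < |x n u|}) atTop := by
        refine le_liminf_of_le (by isBoundedDefault) ?_
        filter_upwards [(hc j₀).eventually_const_lt (Nat.find_spec hex)] with n hn
        rw [lt_rearrangement_iff _ (by positivity) hs.le, ofReal_half_pow] at hn
        exact hn.le
      calc _ ≤ (2⁻¹ : ℝ≥0∞) ^ j₀ := h1
        _ = 2 * (2⁻¹ : ℝ≥0∞) ^ (j₀ + 1) := by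
          rw [pow_succ, mul_comm, mul_assoc, ENNReal.inv_mul_cancel (by simp) (by simp), mul_one]
        _ ≤ _ := by gcongr
    · push Not at hex
      have : dyadicLaw (fun j => c j + 1) {z | s + 1 < |z|} = 0 := by
        rw [dyadicLaw_tail hq0]
        simp only [ENNReal.tsum_eq_zero]
        intro j
        rw [if_neg]
        linarith [hex j]
      simp [this]
  have h1 := mixNorm_le_of_dist_le_liminf (V := V) (P := (volume : Measure I))
    (P' := (volume : Measure I)) (F := fun n => (x n : I → ℝ)) (c := 2) (by simp) (by simp) htail
  have h2 : liminf (fun n => mixNorm V volume (x n : I → ℝ)) atTop ≤ ENNReal.ofReal B := by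
    refine (liminf_le_liminf (v := fun _ => ENNReal.ofReal B)
      (Eventually.of_forall fun n => ?_)).trans (by simp)
    rw [← h.ofReal_norm (hx n)]
    exact ENNReal.ofReal_le_ofReal (hB n)
  calc mixNorm V volume U ≤ mixNorm V volume (fun u => 1 + max (|U u| - 1) 0) := by
        refine mixNorm_mono (ae_of_all _ fun u => ?_)
        rw [abs_of_nonneg (a := 1 + max (|U u| - 1) 0) (by positivity)]
        linarith [le_max_left (|U u| - 1) 0]
    _ ≤ mixNorm V volume (fun _ : I => (1 : ℝ)) + mixNorm V volume (fun u => max (|U u| - 1) 0) :=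
        mixNorm_add_le aemeasurable_const hW.aemeasurable
    _ ≤ ENNReal.ofReal 1 * mixFundamental V 1 + 2 * ENNReal.ofReal B := by
        gcongr
        · exact mixNorm_le_of_abs_le_const (by simp)
        · exact h1.trans (by gcongr)
    _ < ∞ := by
        refine ENNReal.add_lt_top.2 ⟨ENNReal.mul_lt_top (by simp) h.fundamental.one_lt_top, ?_⟩
        exact ENNReal.mul_lt_top (by simp) (by simp)

/-- The partial sums of a sequence which splits into dominated parts and parts with bounded
sums. -/
lemma rpow_bound_of_splitting (h : IsMixSpace V E N) {p : ℝ} (hp : 0 < p)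
    {w : ℕ → L0} (hw : ∀ n, w n ∈ E) (hwi : IsIndepSeq w)
    (hmean : ∀ n, |∫ u, w n u| ≤ (1 / 2) ^ n) {M : ℕ → ℝ} (hM : ∀ n, 0 ≤ M n)
    {U : ℕ → I → ℝ} (hU : ∀ k, Measurable (U k)) (hUi : iIndepFun U volume)
    (hsymm : ∀ k, (volume : Measure I).map (fun u => -U k u) = (volume : Measure I).map (U k))
    (htail : ∀ n k s, 0 ≤ s → (volume : Measure I) {u | s < |{u | |w n u| ≤ M n}.indicator (w n) u|}
      ≤ (volume : Measure I) {u | s < |U k u|})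
    {C₁ : ℝ} (hC₁ : 0 ≤ C₁) (hUb : ∀ m : ℕ, 1 ≤ m →
      mixNorm V volume (fun u => ∑ k ∈ Finset.range m, U k u)
        ≤ ENNReal.ofReal (C₁ * (m : ℝ) ^ (1 / p)))
    {C₂ : ℝ≥0∞} (hC₂ : C₂ ≠ ∞) (hv : ∀ S : Finset ℕ, mixNorm V volume
      (fun u => ∑ k ∈ S, |{u | M k < |w k u|}.indicator (w k) u|) ≤ C₂) :
    ∃ C : ℝ, 0 ≤ C ∧ ∀ m : ℕ, 1 ≤ m →
      mixNorm V volume (fun u => ∑ k ∈ Finset.range m, w k u)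
        ≤ ENNReal.ofReal (C * (m : ℝ) ^ (1 / p)) := by
  obtain ⟨L, hL, hLf⟩ := h.lintegral_le
  set a : ℕ → I → ℝ := fun k => {u | |w k u| ≤ M k}.indicator (w k)
  set v : ℕ → I → ℝ := fun k => {u | M k < |w k u|}.indicator (w k)
  have ham : ∀ k, Measurable (a k) := fun k =>
    (w k).measurable.indicator (measurableSet_abs_le (w k).measurable _)
  have hvm : ∀ k, Measurable (v k) := fun k =>
    (w k).measurable.indicator (measurableSet_lt_abs (w k).measurable _)
  have haint : ∀ k, Integrable (a k) volume := fun k =>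
    Integrable.of_bound (ham k).aestronglyMeasurable (M k)
      (ae_of_all _ fun u => abs_indicator_le_const (hM k) u)
  have hwint : ∀ k, Integrable (w k : I → ℝ) volume := fun k =>
    h.integrable (w k).measurable (h.lt_top (hw k))
  have hvint : ∀ k, Integrable (v k) volume := fun k =>
    (hwint k).indicator (measurableSet_lt_abs (w k).measurable _)
  have hsplit : ∀ k u, w k u = a k u + v k u := fun k u => abs_eq_of_indicator_split (M k) u
  have hai : iIndepFun a volume := by
    refine iIndepFun.comp hwi (fun k z => {z : ℝ | |z| ≤ M k}.indicator id z) fun k => ?_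
    exact measurable_id.indicator (measurableSet_le measurable_id.abs measurable_const)
  have hva : ∀ m : ℕ, ∑ k ∈ Finset.range m, ∫ u, |v k u| ≤ (L * C₂).toReal := fun m => by
    rw [← integral_finsetSum _ fun k _ => (hvint k).abs,
      integral_eq_lintegral_of_nonneg_ae (ae_of_all _ fun u => by positivity)
        (Measurable.aestronglyMeasurable (by fun_prop))]
    refine ENNReal.toReal_mono (ENNReal.mul_ne_top hL hC₂) ?_
    refine le_trans (lintegral_mono fun u => ENNReal.ofReal_le_ofReal (le_abs_self _))
      ((hLf _ (by fun_prop)).trans ?_)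
    gcongr
    exact hv _
  -- The 2 bounds ∑ 2^{-k}, hence the sum of the |E w k|; L · C₂ bounds the total L¹ norm of the
  -- upper parts. So the sum of the means of the lower parts is bounded uniformly in m.
  set D := 2 + (L * C₂).toReal
  have hD : 0 ≤ D := by positivity
  have hmeana : ∀ m : ℕ, |∑ k ∈ Finset.range m, ∫ u, a k u| ≤ D := fun m => by
    have e : ∀ k, ∫ u, a k u = (∫ u, w k u) - ∫ u, v k u := fun k => by
      rw [← integral_sub (hwint k) (hvint k)]
      refine integral_congr_ae (ae_of_all _ fun u => ?_)
      simp only [hsplit k u, add_sub_cancel_right]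
    calc |∑ k ∈ Finset.range m, ∫ u, a k u|
        ≤ ∑ k ∈ Finset.range m, |∫ u, a k u| := Finset.abs_sum_le_sum_abs _ _
      _ ≤ ∑ k ∈ Finset.range m, ((1 / 2) ^ k + ∫ u, |v k u|) := by
          refine Finset.sum_le_sum fun k _ => ?_
          rw [e]
          exact (abs_sub _ _).trans (add_le_add (hmean k) abs_integral_le_integral_abs)
      _ = ∑ k ∈ Finset.range m, (1 / 2 : ℝ) ^ k + ∑ k ∈ Finset.range m, ∫ u, |v k u| :=
          Finset.sum_add_distrib
      _ ≤ D := add_le_add (sum_geometric_two_le m) (hva m)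
  clear_value D
  set b := (mixFundamental V 1).toReal
  have hb : mixFundamental V 1 = ENNReal.ofReal b :=
    (ENNReal.ofReal_toReal h.fundamental.one_lt_top.ne).symm
  have hb0 : 0 ≤ b := ENNReal.toReal_nonneg
  -- Only the centred sum grows; the constants and the upper parts stay bounded and are absorbed
  -- because m^{1/p} ≥ 1.
  refine ⟨2 * C₁ + (D * b + C₂.toReal), by positivity, fun m hm => ?_⟩
  have hmp : (1 : ℝ) ≤ (m : ℝ) ^ (1 / p) :=
    Real.one_le_rpow (by exact_mod_cast hm) (by positivity)
  have hcent := mixNorm_sum_centred_le V (P := volume) (P' := volume) ham hU hai hUi haint hsymm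
    (fun k s hs => htail k k s hs) m
  have hm1 : Measurable fun u => ∑ k ∈ Finset.range m, (a k u - ∫ u', a k u') := by fun_prop
  have hm2 : Measurable fun u => ∑ k ∈ Finset.range m, v k u := by fun_prop
  calc mixNorm V volume (fun u => ∑ k ∈ Finset.range m, w k u)
      = mixNorm V volume (fun u => ∑ k ∈ Finset.range m, (a k u - ∫ u', a k u')
          + ((∑ k ∈ Finset.range m, ∫ u', a k u') + ∑ k ∈ Finset.range m, v k u)) := by
        congr 1
        ext u
        rw [Finset.sum_sub_distrib, ← add_assoc, sub_add_cancel, ← Finset.sum_add_distrib]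
        exact Finset.sum_congr rfl fun k _ => hsplit k u
    _ ≤ mixNorm V volume (fun u => ∑ k ∈ Finset.range m, (a k u - ∫ u', a k u'))
        + (mixNorm V volume (fun _ : I => ∑ k ∈ Finset.range m, ∫ u', a k u')
          + mixNorm V volume (fun u => ∑ k ∈ Finset.range m, v k u)) :=
        (mixNorm_add_le hm1.aemeasurable (hm2.const_add _).aemeasurable).trans
          (add_le_add le_rfl (mixNorm_add_le aemeasurable_const hm2.aemeasurable))
    _ ≤ 2 * ENNReal.ofReal (C₁ * (m : ℝ) ^ (1 / p)) + (ENNReal.ofReal D * ENNReal.ofReal b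
          + ENNReal.ofReal C₂.toReal) := by
        rw [ENNReal.ofReal_toReal hC₂, ← hb]
        refine add_le_add (hcent.trans (mul_le_mul_right (hUb m hm) 2)) (add_le_add
          (mixNorm_le_of_abs_le_const (ae_of_all _ fun _ => hmeana m))
          (le_trans (mixNorm_mono (ae_of_all _ fun u => ?_)) (hv (Finset.range m))))
        exact (Finset.abs_sum_le_sum_abs _ _).trans (le_abs_self _)
    _ = ENNReal.ofReal (2 * (C₁ * (m : ℝ) ^ (1 / p)) + (D * b + C₂.toReal)) := by
        have hr : 0 ≤ C₁ * (m : ℝ) ^ (1 / p) := by positivity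
        generalize C₁ * (m : ℝ) ^ (1 / p) = r at hr
        rw [ENNReal.ofReal_add (by positivity) (by positivity), ENNReal.ofReal_mul zero_le_two,
          ENNReal.ofReal_add (by positivity) (by positivity), ENNReal.ofReal_mul hD,
          ENNReal.ofReal_ofNat]
    _ ≤ _ := by
        refine ENNReal.ofReal_le_ofReal ?_
        have : D * b + C₂.toReal ≤ (D * b + C₂.toReal) * (m : ℝ) ^ (1 / p) :=
          le_mul_of_one_le_right (by positivity) hmp
        linarith

/-- Independent and independent identically distributed weakly null sequences have the same
Banach–Saks index set. -/
theorem gammaI_eq_gammaIid (h : IsMixSpace V E N) (hs : SmallSupportProperty V E N) :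
    GammaI E N = GammaIid E N := by
  refine Subset.antisymm (fun p hp => ⟨hp.1, fun x hx hi => hp.2 x hx hi.1⟩) fun p hp => ?_
  refine ⟨hp.1, fun x hx hxi => ?_⟩
  have hp0 : 0 < p := lt_of_lt_of_le one_pos hp.1
  obtain ⟨B, hB⟩ := h.bounded_of_weaklyNull hx
  obtain ⟨φ, c, hφ, hc⟩ := h.exists_subseq_quantiles hx.1 hB
  have hc0 : ∀ j, 0 ≤ c j := fun j => ge_of_tendsto' (hc j) fun n => rearrangement_nonneg _ _
  have hcm : Monotone c := monotone_nat_of_le_succ fun j => le_of_tendsto_of_tendsto' (hc j)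
    (hc (j + 1)) fun n => rearrangement_anti _ (by positivity)
      (pow_le_pow_of_le_one (by norm_num) (by norm_num) (by lia))
  have hxφ := hx.subseq hφ
  -- The n-th selected term respects the first n + 1 limit quantiles up to the margin 1 and has mean
  -- below 2^{-n}.
  obtain ⟨ψ, hψ, hψP⟩ := extraction_forall_of_eventually (P := fun n k =>
    (∀ j ∈ Finset.range (n + 1), rearrangement (x (φ k)) ((1 / 2) ^ (j + 1)) < c j + 1)
      ∧ |∫ u, x (φ k) u| < (1 / 2) ^ n) fun n => by
    refine (Filter.eventually_all_finset _ |>.2 fun j _ =>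
      (hc j).eventually_lt_const (by linarith)).and ?_
    have := (h.tendsto_mean_of_weaklyNull hxφ).abs
    rw [abs_zero] at this
    exact this.eventually_lt_const (by positivity)
  set w : ℕ → L0 := fun n => x (φ (ψ n))
  have hwn : WeaklyNull E N w := hxφ.subseq hψ
  have hwi : IsIndepSeq w := (hxi.subseq hφ).subseq hψ
  set M : ℕ → ℝ := fun n => rearrangement (w n) ((1 / 2) ^ (n + 1))
  set q : ℕ → ℝ := fun j => c j + 1
  have hq0 : ∀ j, 0 ≤ q j := fun j => by linarith [hc0 j]
  obtain ⟨U, hU, hUi, hUlaw⟩ := exists_iid_unitInterval (dyadicLaw q)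
  have hUsymm : ∀ k, (volume : Measure I).map (fun u => -U k u)
      = (volume : Measure I).map (U k) := fun k => by
    have e : (volume : Measure I).map (fun u => -U k u)
        = ((volume : Measure I).map (U k)).map (fun z => -z) :=
      (Measure.map_map measurable_neg (hU k)).symm
    rw [e, hUlaw, dyadicLaw_map_neg]
  have hUfin : mixNorm V volume (U 0) < ∞ := h.mixNorm_dyadicLaw_lt_top
    (x := fun n => x (φ n)) (fun n => hx.1 _) (fun n => hB _) hc0 hc (hU 0) (hUlaw 0)
  obtain ⟨C₁, hC₁, hUb⟩ := h.rpow_bound_of_mem_gammaIid hp hU hUi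
    (fun k => by rw [hUlaw, hUlaw]) (hUsymm 0) hUfin
  have hms : ∀ n, MeasurableSet {u | M n < |w n u|} := fun n =>
    measurableSet_lt_abs (w n).measurable _
  obtain ⟨θ, hθ, C₂, hC₂, hv⟩ := hs w hwn hwi (fun n => {u | M n < |w n u|}.indicator (w n))
    (fun n => (w n).measurable.indicator (hms n)) (fun n u => by
      by_cases h1 : M n < |w n u|
      · rw [indicator_of_mem (show u ∈ {u | M n < |w n u|} from h1)]
      · rw [indicator_of_notMem (show u ∉ {u | M n < |w n u|} from h1)]
        simp) (by
      have hlim : Tendsto (fun n : ℕ => ENNReal.ofReal ((1 / 2 : ℝ) ^ (n + 1))) atTop (𝓝 0) := by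
        simpa using ENNReal.tendsto_ofReal ((tendsto_pow_atTop_nhds_zero_of_lt_one
          (r := (1 / 2 : ℝ)) (by norm_num) (by norm_num)).comp (tendsto_add_atTop_nat 1))
      refine tendsto_of_tendsto_of_tendsto_of_le_of_le tendsto_const_nhds hlim
        (fun _ => zero_le) fun n => le_trans (measure_mono fun u hu => ?_)
          (measure_rearrangement_lt_abs_le (w n) (t := (1 / 2) ^ (n + 1)) (by positivity))
      by_contra h1
      exact hu (indicator_of_notMem h1 _))
  refine ⟨fun n => φ (ψ (θ n)), fun a b hab => hφ (hψ (hθ hab)), fun n => hx.1 _,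
    ⟨B, fun n => hB _⟩, fun η hη => ?_⟩
  -- Further subsequences only raise indices, so the bounds 2^{-k} on the means survive.
  have hid : ∀ k, k ≤ θ (η k) := fun k => (hη.le_apply).trans hθ.le_apply
  obtain ⟨C, hC0, hC⟩ := h.rpow_bound_of_splitting hp0 (w := fun k => w (θ (η k)))
    (fun k => hwn.1 _) ((hwi.subseq hθ).subseq hη)
    (fun k => (hψP _).2.le.trans (pow_le_pow_of_le_one (by norm_num) (by norm_num) (hid k)))
    (M := fun k => M (θ (η k))) (fun k => rearrangement_nonneg _ _) hU hUi hUsymm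
    (fun k i s hs => by
      refine (tail_truncation_le hq0 (fun a b hab => by simpa [q] using hcm hab)
        (fun j hj => ((hψP _).1 j (Finset.mem_range_succ_iff.2 hj)).le) hs).trans ?_
      rw [← hUlaw i, Measure.map_apply (hU i) (measurableSet_lt (by fun_prop) (by fun_prop))]
      rfl) hC₁ hUb hC₂ (fun S => by
      have := hv (S.map ⟨η, hη.injective⟩)
      simpa [Finset.sum_map] using this)
  refine ⟨C, fun m hm => ?_⟩
  have hmpos : (0 : ℝ) < m := by exact_mod_cast hm
  rw [h.norm_eq, mixNorm_congr (L0.coeFn_sum _ _), Real.rpow_neg hmpos.le,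
    inv_mul_le_iff₀ (by positivity), mul_comm]
  exact ENNReal.toReal_le_of_le_ofReal (by positivity) (hC m hm)

end IsMixSpace

/-! ### Increasing concave functions -/

namespace Psi

variable (ψ : Psi)

lemma mono {s t : ℝ} (hs : 0 ≤ s) (hst : s ≤ t) (ht : t ≤ 1) : ψ.toFun s ≤ ψ.toFun t :=
  ψ.monotoneOn' ⟨hs, hst.trans ht⟩ ⟨hs.trans hst, ht⟩ hst

lemma nonneg {t : ℝ} (ht : 0 ≤ t) (ht1 : t ≤ 1) : 0 ≤ ψ.toFun t := by
  simpa [ψ.map_zero'] using ψ.mono le_rfl ht ht1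

/-- `ψ(t)/t` does not increase. -/
lemma mul_le_mul {s t : ℝ} (hs : 0 ≤ s) (hst : s ≤ t) (ht : t ≤ 1) :
    s * ψ.toFun t ≤ t * ψ.toFun s := by
  rcases (hs.trans hst).eq_or_lt with h0 | h0
  · have : s = 0 := le_antisymm (hst.trans h0.ge) hs
    simp [← h0, this]
  have h := ψ.concaveOn'.2 (show (0 : ℝ) ∈ Icc (0 : ℝ) 1 from ⟨le_rfl, zero_le_one⟩)
    (show t ∈ Icc (0 : ℝ) 1 from ⟨h0.le, ht⟩)
    (show 0 ≤ 1 - s / t by rw [sub_nonneg, div_le_one h0]; exact hst)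
    (show 0 ≤ s / t by positivity) (by ring)
  simp only [ψ.map_zero', smul_eq_mul, mul_zero, zero_add, div_mul_cancel₀ _ h0.ne'] at h
  rw [div_mul_eq_mul_div, div_le_iff₀ h0] at h
  linarith

lemma one_pos : 0 < ψ.toFun 1 := by
  obtain ⟨t, ht, hne⟩ := ψ.ne_zero'
  exact lt_of_lt_of_le (lt_of_le_of_ne (ψ.nonneg ht.1 ht.2) hne.symm) (ψ.mono ht.1 ht.2 le_rfl)

lemma mul_one_le {t : ℝ} (ht : 0 ≤ t) (ht1 : t ≤ 1) : t * ψ.toFun 1 ≤ ψ.toFun t := by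
  simpa using ψ.mul_le_mul ht ht1 le_rfl

lemma pos {t : ℝ} (ht : 0 < t) (ht1 : t ≤ 1) : 0 < ψ.toFun t :=
  lt_of_lt_of_le (mul_pos ht ψ.one_pos) (ψ.mul_one_le ht.le ht1)

lemma tendsto_zero : Tendsto ψ.toFun (𝓝[Icc 0 1] 0) (𝓝 0) := by
  have := ψ.continuousOn' 0 ⟨le_rfl, zero_le_one⟩
  rwa [ContinuousWithinAt, ψ.map_zero'] at this

lemma exists_le {ε : ℝ} (hε : 0 < ε) : ∃ δ : ℝ, 0 < δ ∧ δ ≤ 1 ∧ ψ.toFun δ ≤ ε := by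
  have h1 : Tendsto ψ.toFun (𝓝[Ioc 0 1] 0) (𝓝 0) :=
    ψ.tendsto_zero.mono_left (nhdsWithin_mono _ Ioc_subset_Icc_self)
  have h2 : 𝓝[Ioc (0 : ℝ) 1] 0 = 𝓝[>] 0 := nhdsWithin_Ioc_eq_nhdsGT zero_lt_one
  rw [h2] at h1
  have h3 : ∀ᶠ t : ℝ in 𝓝[>] 0, t ∈ Ioc (0 : ℝ) 1 := Ioc_mem_nhdsGT zero_lt_one
  obtain ⟨δ, hδ, hδ1⟩ := ((h1.eventually_le_const hε).and h3).exists
  exact ⟨δ, hδ1.1, hδ1.2, hδ⟩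

/-- Increments of `ψ` decrease. -/
lemma increment_le {S c L l : ℝ} (hS : 0 ≤ S) (hSL : S ≤ L) (hc : 0 ≤ c) (hcl : c ≤ l)
    (hL : L + l ≤ 1) :
    (ψ.toFun (L + l) - ψ.toFun L) / l * c ≤ ψ.toFun (S + c) - ψ.toFun S := by
  rcases hc.eq_or_lt with rfl | hc
  · simp
  have hl : 0 < l := hc.trans_le hcl
  have mS : S ∈ Icc (0 : ℝ) 1 := ⟨hS, by linarith⟩
  have mSc : S + c ∈ Icc (0 : ℝ) 1 := ⟨by linarith, by linarith⟩
  have mL : L ∈ Icc (0 : ℝ) 1 := ⟨by linarith, by linarith⟩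
  have mLl : L + l ∈ Icc (0 : ℝ) 1 := ⟨by linarith, by linarith⟩
  -- The slope over [S, L + l] lies between the slopes over [L, L + l] and [S, S + c].
  have h1 := ψ.concaveOn'.slope_anti mS (a := S + c) (b := L + l)
    ⟨mSc, by simp [hc.ne']⟩ ⟨mLl, by simp; linarith⟩ (by linarith)
  have h2 := ψ.concaveOn'.slope_anti mLl (a := S) (b := L)
    ⟨mS, by simp; linarith⟩ ⟨mL, by simp [hl.ne']⟩ hSL
  rw [slope_comm, slope_comm _ (L + l) S] at h2
  have h4 := h2.trans h1
  rw [slope_def_field, slope_def_field, add_sub_cancel_left, add_sub_cancel_left] at h4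
  rwa [le_div_iff₀ hc] at h4

/-- The function `ψ`, as a function of extended nonnegative numbers. -/
noncomputable def fun' (d : ℝ≥0∞) : ℝ≥0∞ := ENNReal.ofReal (ψ.toFun d.toReal)

lemma fun'_mono {a b : ℝ≥0∞} (hab : a ≤ b) (hb : b ≤ 1) : ψ.fun' a ≤ ψ.fun' b :=
  ENNReal.ofReal_le_ofReal (ψ.mono ENNReal.toReal_nonneg
    (ENNReal.toReal_mono (hb.trans_lt (by simp)).ne hab)
    (by simpa using ENNReal.toReal_mono (by simp) hb))

lemma tendsto_fun' {ι : Type*} {l : Filter ι} {d : ι → ℝ≥0∞} (hd : Tendsto d l (𝓝 0))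
    (hd1 : ∀ i, d i ≤ 1) : Tendsto (fun i => ψ.fun' (d i)) l (𝓝 0) := by
  have h1 : Tendsto (fun i => (d i).toReal) l (𝓝[Icc 0 1] 0) := by
    rw [tendsto_nhdsWithin_iff]
    refine ⟨by simpa [Function.comp_def] using (ENNReal.tendsto_toReal (by simp)).comp hd,
      Eventually.of_forall fun i => ⟨ENNReal.toReal_nonneg, ?_⟩⟩
    simpa using ENNReal.toReal_mono (by simp) (hd1 i)
  simpa [fun', Function.comp_def] using ENNReal.tendsto_ofReal (ψ.tendsto_zero.comp h1)

lemma fun'_ofReal {t : ℝ} (ht : 0 ≤ t) : ψ.fun' (ENNReal.ofReal t) = ENNReal.ofReal (ψ.toFun t) := by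
  rw [fun', ENNReal.toReal_ofReal ht]

/-! ### Layer-cake representation of ψ through its right derivative -/

/-- The right derivative of `ψ`. -/
noncomputable def rightDeriv (t : ℝ) : ℝ := -derivWithin (-ψ.toFun) (Ioi t) t

lemma hasDerivWithinAt {t : ℝ} (ht : t ∈ Ioo (0 : ℝ) 1) :
    HasDerivWithinAt ψ.toFun (ψ.rightDeriv t) (Ioi t) t := by
  have h := ψ.concaveOn'.neg.hasDerivWithinAt_rightDeriv_of_mem_interior (x := t)
    (by rwa [interior_Icc])
  have h2 := h.neg
  rwa [neg_neg] at h2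

lemma antitoneOn_rightDeriv : AntitoneOn ψ.rightDeriv (Ioo 0 1) := by
  have h := ψ.concaveOn'.neg.monotoneOn_rightDeriv
  rw [interior_Icc] at h
  exact fun a ha b hb hab => neg_le_neg (h ha hb hab)

lemma rightDeriv_nonneg {t : ℝ} (ht : t ∈ Ioo (0 : ℝ) 1) : 0 ≤ ψ.rightDeriv t := by
  have h := (hasDerivWithinAt_iff_tendsto_slope' (by simp)).1 (ψ.hasDerivWithinAt ht)
  refine ge_of_tendsto h ?_
  filter_upwards [Ioo_mem_nhdsGT ht.2] with s hs
  rw [slope_def_field]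
  exact div_nonneg (sub_nonneg.2 (ψ.mono ht.1.le hs.1.le hs.2.le)) (sub_nonneg.2 hs.1.le)

/-- The fundamental theorem of calculus for right derivatives; integrability near 0, where the
derivative may be unbounded, comes from its sign. -/
lemma lintegral_rightDeriv {u : ℝ} (hu : 0 ≤ u) (hu1 : u ≤ 1) :
    ∫⁻ t in Ioo 0 u, ENNReal.ofReal (ψ.rightDeriv t) = ENNReal.ofReal (ψ.toFun u) := by
  have hsub : Ioo 0 u ⊆ Ioo (0 : ℝ) 1 := Ioo_subset_Ioo_right hu1
  have hcont : ContinuousOn ψ.toFun (Icc 0 u) := ψ.continuousOn'.mono (Icc_subset_Icc_right hu1)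
  have hint : IntegrableOn ψ.rightDeriv (Ioc 0 u) :=
    intervalIntegral.integrableOn_deriv_right_of_nonneg hcont
      (fun t ht => ψ.hasDerivWithinAt (hsub ht)) fun t ht => ψ.rightDeriv_nonneg (hsub ht)
  have hftc := intervalIntegral.integral_eq_sub_of_hasDeriv_right_of_le hu hcont
    (fun t ht => ψ.hasDerivWithinAt (hsub ht))
    ((intervalIntegrable_iff_integrableOn_Ioc_of_le hu).2 hint)
  rw [intervalIntegral.integral_of_le hu, integral_Ioc_eq_integral_Ioo, ψ.map_zero',
    sub_zero] at hftc
  rw [← hftc, ofReal_integral_eq_lintegral_ofReal (hint.mono_set Ioo_subset_Ioc_self)]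
  filter_upwards [ae_restrict_mem measurableSet_Ioo] with t ht
  exact ψ.rightDeriv_nonneg (hsub ht)

/-- The length of the interval on which the right derivative of `ψ` exceeds `r`. -/
noncomputable def level (r : ℝ) : ℝ := (volume (Ioo (0 : ℝ) 1 ∩ {t | r < ψ.rightDeriv t})).toReal

lemma ofReal_level (r : ℝ) :
    ENNReal.ofReal (ψ.level r) = volume (Ioo (0 : ℝ) 1 ∩ {t | r < ψ.rightDeriv t}) :=
  ENNReal.ofReal_toReal (measure_ne_top_of_subset inter_subset_left (by simp))

lemma measurable_level : Measurable ψ.level := by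
  refine Antitone.measurable fun a b hab => ?_
  refine ENNReal.toReal_mono (measure_ne_top_of_subset inter_subset_left (by simp)) ?_
  exact measure_mono fun t ht => ⟨ht.1, lt_of_le_of_lt hab ht.2⟩

/-- The right derivative does not increase, so its superlevel set in (0,1) is an initial interval of
length `ψ.level r`, up to its endpoint. -/
lemma measure_level_inter {u : ℝ} (hu1 : u ≤ 1) (r : ℝ) :
    volume (Ioo 0 u ∩ {t | r < ψ.rightDeriv t})
      = min (ENNReal.ofReal u) (ENNReal.ofReal (ψ.level r)) := by
  rw [ofReal_level]
  set A := Ioo (0 : ℝ) 1 ∩ {t | r < ψ.rightDeriv t}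
  have hA : Ioo 0 u ∩ {t | r < ψ.rightDeriv t} = Ioo 0 u ∩ A := by
    rw [← inter_assoc, inter_eq_left.2 (Ioo_subset_Ioo_right hu1)]
  rw [hA]
  by_cases h : ∃ t ∈ A, u ≤ t
  · obtain ⟨t, ht, hut⟩ := h
    have hsub : Ioo 0 u ⊆ A := fun s hs => by
      have hs1 : s ∈ Ioo (0 : ℝ) 1 := ⟨hs.1, hs.2.trans_le hu1⟩
      exact ⟨hs1, lt_of_lt_of_le ht.2 (ψ.antitoneOn_rightDeriv hs1 ht.1 (hs.2.le.trans hut))⟩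
    have hv := measure_mono (μ := volume) hsub
    rw [Real.volume_Ioo, sub_zero] at hv
    rw [inter_eq_left.2 hsub, Real.volume_Ioo, sub_zero, min_eq_left hv]
  · push Not at h
    have hsub : A ⊆ Ioo 0 u := fun t ht => ⟨ht.1.1, h t ht⟩
    have hv := measure_mono (μ := volume) hsub
    rw [Real.volume_Ioo, sub_zero] at hv
    rw [inter_eq_right.2 hsub, min_eq_right hv]

/-- `ψ` as a mixture of the functions `u ↦ min u τ`. -/
lemma eq_lintegral_min {u : ℝ} (hu : 0 ≤ u) (hu1 : u ≤ 1) :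
    ENNReal.ofReal (ψ.toFun u)
      = ∫⁻ r in Ioi 0, min (ENNReal.ofReal u) (ENNReal.ofReal (ψ.level r)) := by
  have hsub : Ioo 0 u ⊆ Ioo (0 : ℝ) 1 := Ioo_subset_Ioo_right hu1
  rw [← ψ.lintegral_rightDeriv hu hu1, lintegral_eq_lintegral_meas_lt]
  · refine lintegral_congr fun r => ?_
    rw [← ψ.measure_level_inter hu1, Measure.restrict_apply' measurableSet_Ioo, inter_comm]
  · filter_upwards [ae_restrict_mem measurableSet_Ioo] with t ht
    exact ψ.rightDeriv_nonneg (hsub ht)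
  · exact aemeasurable_restrict_of_antitoneOn measurableSet_Ioo (ψ.antitoneOn_rightDeriv.mono hsub)

lemma fun'_eq_lintegral_min {d : ℝ≥0∞} (hd : d ≤ 1) :
    ψ.fun' d = ∫⁻ r in Ioi 0, min d (ENNReal.ofReal (ψ.level r)) := by
  have hdt : d ≠ ∞ := (hd.trans_lt (by simp)).ne
  rw [fun', ψ.eq_lintegral_min ENNReal.toReal_nonneg
    (by simpa using ENNReal.toReal_mono (by simp) hd), ENNReal.ofReal_toReal hdt]

end Psi

/-! ### Norms of the `c₀` type -/

/-- A sequence of functions which are bounded by `Φ`, are `o(Φ)` at zero and tend to zero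
uniformly has a subsequence with sum bounded by a multiple of `Φ`. -/
lemma exists_subseq_tsum_le {Φ : ℝ → ℝ≥0∞} (hΦ : MonotoneOn Φ (Ioc 0 1))
    (hΦ0 : ∀ t ∈ Ioc (0 : ℝ) 1, 0 < Φ t) {F : ℕ → ℝ → ℝ≥0∞}
    (hF : ∀ n, ∀ t ∈ Ioc (0 : ℝ) 1, F n t ≤ Φ t)
    (hFo : ∀ n, ∀ ε : ℝ≥0∞, 0 < ε → ∃ t₀ ∈ Ioc (0 : ℝ) 1, ∀ t ∈ Ioc 0 t₀, F n t ≤ ε * Φ t)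
    (hFu : ∀ ε : ℝ≥0∞, 0 < ε → ∀ᶠ n in atTop, ∀ t ∈ Ioc (0 : ℝ) 1, F n t ≤ ε) :
    ∃ θ : ℕ → ℕ, StrictMono θ ∧ ∀ t ∈ Ioc (0 : ℝ) 1, ∑' k, F (θ k) t ≤ 5 * Φ t := by
  -- On (0, T n] the function F n is below 2^{-n}Φ. The next index is taken so large that later
  -- functions are uniformly below 2^{-n}Φ(T j) for all j ≤ n.
  choose T hT hTF using fun n => hFo n (2⁻¹ ^ n) (ENNReal.pow_pos (by simp) n)
  have hex : ∀ n : ℕ, ∃ m, n < m ∧ ∀ m' ≥ m, ∀ j ≤ n, ∀ t ∈ Ioc (0 : ℝ) 1,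
      F m' t ≤ 2⁻¹ ^ n * Φ (T j) := fun n => by
    have h1 : ∀ᶠ m' in atTop, ∀ j ∈ Finset.range (n + 1), ∀ t ∈ Ioc (0 : ℝ) 1,
        F m' t ≤ 2⁻¹ ^ n * Φ (T j) := by
      rw [Filter.eventually_all_finset]
      exact fun j _ => hFu _ (ENNReal.mul_pos (ENNReal.pow_pos (by simp) n).ne'
        (hΦ0 _ (hT j)).ne')
    obtain ⟨m, hm⟩ := eventually_atTop.1 h1
    refine ⟨max m (n + 1), lt_of_lt_of_le n.lt_succ_self (le_max_right _ _),
      fun m' hm' j hj => hm m' (le_trans (le_max_left _ _) hm') j (by simpa using by lia)⟩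
  choose g hg hgF using hex
  set θ : ℕ → ℕ := fun k => g^[k] 0
  have hθs : ∀ k, θ (k + 1) = g (θ k) := fun k => Function.iterate_succ_apply' g k 0
  have hθ : StrictMono θ := strictMono_nat_of_lt_succ fun k => by rw [hθs]; exact hg _
  have hpow : ∀ {a b : ℕ}, a ≤ b → (2⁻¹ : ℝ≥0∞) ^ b ≤ 2⁻¹ ^ a := fun hab =>
    pow_le_pow_of_le_one zero_le (by simp) hab
  have hsmall : ∀ i k, i < k → ∀ t ∈ Ioc (0 : ℝ) 1, F (θ k) t ≤ 2 * 2⁻¹ ^ k * Φ (T (θ i)) := by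
    intro i k hik t ht
    obtain ⟨l, rfl⟩ : ∃ l, k = l + 1 := ⟨k - 1, by lia⟩
    have h1 := hgF (θ l) (θ (l + 1)) (by rw [hθs]) (θ i) (hθ.monotone (by lia)) t ht
    refine h1.trans ?_
    gcongr
    refine (hpow hθ.le_apply).trans (le_of_eq ?_)
    rw [pow_succ, mul_comm, mul_assoc, ENNReal.inv_mul_cancel (by simp) (by simp), mul_one]
  refine ⟨θ, hθ, fun t ht => ?_⟩
  -- For fixed t let i₀ be the first k with T (θ k) < t. Earlier terms are small by the o(Φ)
  -- condition, later ones by uniform smallness against Φ(T (θ i₀)) ≤ Φ(t); only the term i₀ may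
  -- cost a full Φ(t). The total is 2 · 2 + 1 = 5.
  have hterm : ∃ i₀ : ℕ, ∀ k, F (θ k) t ≤ (2 * 2⁻¹ ^ k + if k = i₀ then 1 else 0) * Φ t := by
    have hlarge : ∀ k, t ≤ T (θ k) → F (θ k) t ≤ 2 * 2⁻¹ ^ k * Φ t := fun k hk => by
      refine (hTF (θ k) t ⟨ht.1, hk⟩).trans ?_
      gcongr
      exact (hpow hθ.le_apply).trans (le_mul_of_one_le_left zero_le (by simp))
    by_cases hex : ∃ i, T (θ i) < t
    · refine ⟨Nat.find hex, fun k => ?_⟩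
      rcases lt_trichotomy k (Nat.find hex) with h | h | h
      · rw [if_neg h.ne, add_zero]
        exact hlarge k (not_lt.1 (Nat.find_min hex h))
      · rw [if_pos h, add_mul, one_mul]
        exact (hF _ t ht).trans (le_add_of_nonneg_left zero_le)
      · rw [if_neg h.ne', add_zero]
        refine (hsmall _ k h t ht).trans ?_
        gcongr
        exact hΦ (hT _) ht (Nat.find_spec hex).le
    · push Not at hex
      refine ⟨0, fun k => (hlarge k (hex k)).trans ?_⟩
      gcongr
      exact le_add_of_nonneg_right zero_le
  obtain ⟨i₀, hi₀⟩ := hterm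
  calc ∑' k, F (θ k) t ≤ ∑' k, (2 * 2⁻¹ ^ k + if k = i₀ then 1 else 0) * Φ t :=
        ENNReal.tsum_le_tsum hi₀
    _ = (2 * 2 + 1) * Φ t := by
        rw [ENNReal.tsum_mul_right, ENNReal.tsum_add, ENNReal.tsum_mul_left,
          ENNReal.tsum_geometric, ENNReal.one_sub_inv_two, inv_inv]
        simp
    _ = 5 * Φ t := by norm_num

/-! ### The Marcinkiewicz space -/

lemma volume_lt_rearrangement (x : L0) {τ s : ℝ} (hs : 0 ≤ s) :
    volume ({t | s < rearrangement x t} ∩ Ioc 0 τ)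
      = min ((volume : Measure I) {u | s < |x u|}) (ENNReal.ofReal τ) := by
  set d := (volume : Measure I) {u | s < |x u|}
  have hd : d ≠ ∞ := measure_ne_top _ _
  have h : {t | s < rearrangement x t} ∩ Ioc 0 τ = Ioo 0 d.toReal ∩ Iic τ := by
    ext t
    simp only [mem_inter_iff, mem_ofPred_eq, mem_Ioc, mem_Ioo, mem_Iic]
    refine ⟨fun ⟨h1, h2, h3⟩ => ⟨⟨h2, ?_⟩, h3⟩, fun ⟨⟨h1, h2⟩, h3⟩ => ⟨?_, h1, h3⟩⟩
    · exact (ENNReal.ofReal_lt_iff_lt_toReal h2.le hd).1 ((lt_rearrangement_iff x h2 hs).1 h1)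
    · exact (lt_rearrangement_iff x h1 hs).2 ((ENNReal.ofReal_lt_iff_lt_toReal h1.le hd).2 h2)
  rw [h]
  refine le_antisymm (le_min ?_ ?_) ?_
  · refine (measure_mono inter_subset_left).trans ?_
    rw [Real.volume_Ioo, sub_zero, ENNReal.ofReal_toReal hd]
  · refine (measure_mono (t := Ioc 0 τ) fun t ht => ⟨ht.1.1, ht.2⟩).trans ?_
    rw [Real.volume_Ioc, sub_zero]
  · have h2 : Ioo 0 (min d.toReal τ) ⊆ Ioo 0 d.toReal ∩ Iic τ := fun t ht =>
      ⟨⟨ht.1, ht.2.trans_le (min_le_left _ _)⟩, (ht.2.trans_le (min_le_right _ _)).le⟩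
    refine le_trans (le_of_eq ?_) (measure_mono h2)
    rw [Real.volume_Ioo, sub_zero, ENNReal.ofReal_min, ENNReal.ofReal_toReal hd]

lemma antitoneOn_rearrangement (x : L0) (τ : ℝ) : AntitoneOn (rearrangement x) (Ioc 0 τ) :=
  fun _ hs _ _ hst => rearrangement_anti x hs.1 hst

lemma lintegral_rearrangement (x : L0) (τ : ℝ) :
    ∫⁻ t in Ioc 0 τ, ENNReal.ofReal (rearrangement x t) = kFun volume (x : I → ℝ) τ := by
  rw [kFun, lintegral_eq_lintegral_meas_lt _ (ae_of_all _ (rearrangement_nonneg x))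
    (aemeasurable_restrict_of_antitoneOn measurableSet_Ioc (antitoneOn_rearrangement x τ))]
  refine setLIntegral_congr_fun measurableSet_Ioi fun s (hs : 0 < s) => ?_
  rw [← volume_lt_rearrangement x hs.le, Measure.restrict_apply' measurableSet_Ioc]

lemma kFun_sum_le {Ω : Type*} [MeasurableSpace Ω] {P : Measure Ω} [IsFiniteMeasure P]
    {ι : Type*} (S : Finset ι) {F : ι → Ω → ℝ} (hF : ∀ i, AEMeasurable (F i) P) (τ : ℝ) :
    kFun P (fun ω => ∑ i ∈ S, F i ω) τ ≤ ∑ i ∈ S, kFun P (F i) τ := by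
  classical
  induction S using Finset.induction_on with
  | empty => simp [kFun_zero]
  | insert a S ha ih =>
    simp only [Finset.sum_insert ha]
    refine (kFun_add_le (hF a) ?_ τ).trans (by gcongr)
    exact Finset.aemeasurable_fun_sum _ fun i _ => hF i

/-- The measures which describe the norm of `M(ψ)`. -/
def marcinkiewiczMix (ψ : Psi) : Set (Measure ℝ) :=
  {ν | ∃ τ ∈ Ioc (0 : ℝ) 1, ν = (ENNReal.ofReal (ψ.toFun τ))⁻¹ • Measure.dirac τ}

section Marcinkiewicz

variable (ψ : Psi)

lemma iSup_marcinkiewiczMix {G : ℝ → ℝ≥0∞} :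
    ⨆ ν ∈ marcinkiewiczMix ψ, ∫⁻ τ, G τ ∂ν
      = ⨆ τ ∈ Ioc (0 : ℝ) 1, G τ / ENNReal.ofReal (ψ.toFun τ) := by
  refine le_antisymm (iSup₂_le ?_) (iSup₂_le fun τ hτ => ?_)
  · rintro ν ⟨τ, hτ, rfl⟩
    refine le_trans (le_of_eq ?_) (le_iSup₂ (f := fun τ (_ : τ ∈ Ioc (0 : ℝ) 1) =>
      G τ / ENNReal.ofReal (ψ.toFun τ)) τ hτ)
    simp [div_eq_mul_inv, mul_comm]
  · refine le_trans (le_of_eq ?_) (le_iSup₂ (f := fun ν (_ : ν ∈ marcinkiewiczMix ψ) =>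
      ∫⁻ τ, G τ ∂ν) _ ⟨τ, hτ, rfl⟩)
    simp [div_eq_mul_inv, mul_comm]

lemma iSup_marcinkiewiczMix_le_iff {G : ℝ → ℝ≥0∞} {c : ℝ≥0∞} :
    ⨆ ν ∈ marcinkiewiczMix ψ, ∫⁻ τ, G τ ∂ν ≤ c
      ↔ ∀ τ ∈ Ioc (0 : ℝ) 1, G τ ≤ c * ENNReal.ofReal (ψ.toFun τ) := by
  rw [iSup_marcinkiewiczMix, iSup₂_le_iff]
  refine forall₂_congr fun τ hτ => ?_
  rw [ENNReal.div_le_iff (ENNReal.ofReal_pos.2 (ψ.pos hτ.1 hτ.2)).ne' ENNReal.ofReal_ne_top]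

variable {Ω : Type*} [MeasurableSpace Ω] {P : Measure Ω} {f : Ω → ℝ}

lemma mixNorm_marcinkiewicz_le_iff {c : ℝ≥0∞} : mixNorm (marcinkiewiczMix ψ) P f ≤ c
    ↔ ∀ τ ∈ Ioc (0 : ℝ) 1, kFun P f τ ≤ c * ENNReal.ofReal (ψ.toFun τ) :=
  iSup_marcinkiewiczMix_le_iff ψ

lemma kFun_le_mixNorm_marcinkiewicz {τ : ℝ} (hτ : τ ∈ Ioc (0 : ℝ) 1) :
    kFun P f τ ≤ mixNorm (marcinkiewiczMix ψ) P f * ENNReal.ofReal (ψ.toFun τ) :=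
  (mixNorm_marcinkiewicz_le_iff ψ).1 le_rfl τ hτ

lemma marcinkiewiczRatio_eq (x : L0) (τ : ℝ) :
    marcinkiewiczRatio ψ x τ = kFun volume (x : I → ℝ) τ / ENNReal.ofReal (ψ.toFun τ) := by
  rw [marcinkiewiczRatio, lintegral_rearrangement]

lemma marcinkiewiczRatio_le_iff (x : L0) {τ : ℝ} (hτ : τ ∈ Ioc (0 : ℝ) 1) {c : ℝ≥0∞} :
    marcinkiewiczRatio ψ x τ ≤ c
      ↔ kFun volume (x : I → ℝ) τ ≤ c * ENNReal.ofReal (ψ.toFun τ) := by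
  rw [marcinkiewiczRatio_eq,
    ENNReal.div_le_iff (ENNReal.ofReal_pos.2 (ψ.pos hτ.1 hτ.2)).ne' ENNReal.ofReal_ne_top]

lemma marcinkiewiczENorm_eq (x : L0) :
    marcinkiewiczENorm ψ x = mixNorm (marcinkiewiczMix ψ) volume (x : I → ℝ) := by
  simp_rw [marcinkiewiczENorm, marcinkiewiczRatio_eq]
  exact (iSup_marcinkiewiczMix ψ).symm

lemma tendsto_marcinkiewiczRatio_iff (x : L0) :
    Tendsto (marcinkiewiczRatio ψ x) (𝓝[>] 0) (𝓝 0) ↔ ∀ ε : ℝ≥0∞, 0 < ε →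
      ∃ t₀ ∈ Ioc (0 : ℝ) 1, ∀ t ∈ Ioc 0 t₀,
        kFun volume (x : I → ℝ) t ≤ ε * ENNReal.ofReal (ψ.toFun t) := by
  rw [ENNReal.tendsto_nhds_zero]
  refine forall₂_congr fun ε hε => ?_
  constructor
  · intro h
    obtain ⟨t, ht, htε⟩ := mem_nhdsGT_iff_exists_Ioc_subset.1 h
    refine ⟨min t 1, ⟨lt_min ht one_pos, min_le_right _ _⟩, fun s hs => ?_⟩
    exact (marcinkiewiczRatio_le_iff ψ x ⟨hs.1, hs.2.trans (min_le_right _ _)⟩).1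
      (htε ⟨hs.1, hs.2.trans (min_le_left _ _)⟩)
  · rintro ⟨t₀, ht₀, h⟩
    filter_upwards [Ioc_mem_nhdsGT ht₀.1] with s hs
    exact (marcinkiewiczRatio_le_iff ψ x ⟨hs.1, hs.2.trans ht₀.2⟩).2 (h s hs)

lemma lintegral_abs_le_mixNorm_marcinkiewicz [IsProbabilityMeasure P] (hf : AEMeasurable f P) :
    ∫⁻ ω, ENNReal.ofReal |f ω| ∂P
      ≤ ENNReal.ofReal (ψ.toFun 1) * mixNorm (marcinkiewiczMix ψ) P f := by
  rw [← kFun_one hf, mul_comm]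
  exact kFun_le_mixNorm_marcinkiewicz ψ ⟨one_pos, le_rfl⟩

variable {ψ}

/-- τ/ψ(τ) does not decrease with τ, so a bound at δ holds at all smaller τ. -/
lemma Psi.ofReal_le_of_slope {e δ : ℝ} (hδ1 : δ ≤ 1) (hδe : δ ≤ e * ψ.toFun δ) {τ : ℝ}
    (hτ : τ ∈ Ioc 0 δ) : τ ≤ e * ψ.toFun τ := by
  have hδ : 0 < δ := hτ.1.trans_le hτ.2
  have h1 := ψ.mul_le_mul hτ.1.le hτ.2 hδ1
  have h2 := ψ.pos hδ hδ1
  have h3 := (ψ.pos hτ.1 (hτ.2.trans hδ1)).le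
  refine le_of_mul_le_mul_right ?_ h2
  nlinarith [mul_le_mul_of_nonneg_right hδe h3]

/-! ### The nondegenerate case of M(ψ)₀, where t/ψ(t) → 0 as t → 0 -/

variable (hψ : ∀ e : ℝ, 0 < e → ∃ δ ∈ Ioc (0 : ℝ) 1, δ ≤ e * ψ.toFun δ)
include hψ

/-- min(δ, τ)/ψ(τ) is largest at τ = δ, where it equals δ/ψ(δ). -/
lemma marcinkiewicz_fundamental : FundamentalTendstoZero (marcinkiewiczMix ψ) := by
  intro ε hε
  obtain ⟨e, he0, he⟩ := ENNReal.lt_iff_exists_nnreal_btwn.1 hε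
  obtain ⟨δ, hδ, hδe⟩ := hψ e (by simpa using he0)
  refine ⟨ENNReal.ofReal δ, ENNReal.ofReal_pos.2 hδ.1, ?_⟩
  refine (iSup_marcinkiewiczMix_le_iff ψ).2 fun τ hτ => ?_
  refine le_trans ?_ (mul_le_mul_left he.le _)
  rw [← ENNReal.ofReal_coe_nnreal, ← ENNReal.ofReal_mul e.coe_nonneg, ← ENNReal.ofReal_min]
  refine ENNReal.ofReal_le_ofReal ?_
  rcases le_total τ δ with h | h
  · exact (min_le_right _ _).trans (Psi.ofReal_le_of_slope hδ.2 hδe ⟨hτ.1, h⟩)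
  · exact (min_le_left _ _).trans (hδe.trans
      (mul_le_mul_of_nonneg_left (ψ.mono hδ.1.le h hτ.2) e.coe_nonneg))

/-- The part of f below n contributes at most nt, which is o(ψ(t)); the part above n has small norm.
-/
lemma HasOCNorm.kFun_marcinkiewicz [IsProbabilityMeasure P] (hf : Measurable f)
    (h : HasOCNorm (marcinkiewiczMix ψ) P f) {ε : ℝ≥0∞} (hε : 0 < ε) :
    ∃ t₀ ∈ Ioc (0 : ℝ) 1, ∀ t ∈ Ioc 0 t₀, kFun P f t ≤ ε * ENNReal.ofReal (ψ.toFun t) := by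
  obtain ⟨n, hn⟩ := h.exists_truncation (ENNReal.half_pos hε.ne')
  obtain ⟨e, he0, he⟩ := ENNReal.lt_iff_exists_nnreal_btwn.1 (ENNReal.half_pos hε.ne')
  have he0' : (0 : ℝ) < e := by simpa using he0
  obtain ⟨δ, hδ, hδe⟩ := hψ (e / (n + 1)) (by positivity)
  refine ⟨δ, hδ, fun t ht => ?_⟩
  have hte := Psi.ofReal_le_of_slope hδ.2 hδe ht
  have ht1 : t ∈ Ioc (0 : ℝ) 1 := ⟨ht.1, ht.2.trans hδ.2⟩
  have m1 := hf.indicator (measurableSet_abs_le hf n)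
  have m2 := hf.indicator (measurableSet_lt_abs hf n)
  have hψt := ψ.nonneg ht1.1.le ht1.2
  calc kFun P f t = kFun P (fun ω => {ω | |f ω| ≤ n}.indicator f ω
        + {ω | (n : ℝ) < |f ω|}.indicator f ω) t := by
        congr 1; ext ω; exact abs_eq_of_indicator_split _ ω
    _ ≤ kFun P ({ω | |f ω| ≤ n}.indicator f) t
        + kFun P ({ω | (n : ℝ) < |f ω|}.indicator f) t :=
        kFun_add_le m1.aemeasurable m2.aemeasurable t
    _ ≤ ENNReal.ofReal n * ENNReal.ofReal t + ε / 2 * ENNReal.ofReal (ψ.toFun t) := by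
        gcongr
        · refine (kFun_le_of_abs_le (ae_of_all _ (abs_indicator_le_const n.cast_nonneg)) le_rfl t).trans ?_
          gcongr
          exact min_le_right _ _
        · exact (mixNorm_marcinkiewicz_le_iff ψ).1 hn t ht1
    _ ≤ ε / 2 * ENNReal.ofReal (ψ.toFun t) + ε / 2 * ENNReal.ofReal (ψ.toFun t) := by
        refine add_le_add (le_trans ?_ (mul_le_mul_left he.le _)) le_rfl
        rw [← ENNReal.ofReal_coe_nnreal, ← ENNReal.ofReal_mul e.coe_nonneg,
          ← ENNReal.ofReal_mul n.cast_nonneg]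
        refine ENNReal.ofReal_le_ofReal ?_
        rw [div_mul_eq_mul_div, le_div_iff₀ (by positivity)] at hte
        nlinarith [ht.1]
    _ = ε * ENNReal.ofReal (ψ.toFun t) := by rw [← add_mul, ENNReal.add_halves]

/-- From the limit condition to order continuity: for τ ≤ t₀ the truncations are dominated by x
itself, and for τ ≥ t₀ their L¹ norms, which tend to zero, are compared with ψ(t₀) > 0. -/
lemma marcinkiewicz_mem_iff (x : L0) :
    x ∈ marcinkiewiczSpaceZero ψ ↔ HasOCNorm (marcinkiewiczMix ψ) volume (x : I → ℝ) := by
  change (marcinkiewiczENorm ψ x < ∞ ∧ _) ↔ _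
  rw [marcinkiewiczENorm_eq, tendsto_marcinkiewiczRatio_iff]
  refine ⟨fun ⟨hx, h⟩ => ?_, fun h => ⟨h.lt_top (marcinkiewicz_fundamental hψ) x.measurable,
    fun ε hε => h.kFun_marcinkiewicz hψ x.measurable hε⟩⟩
  rw [HasOCNorm, ENNReal.tendsto_nhds_zero]
  intro ε hε
  obtain ⟨t₀, ht₀, hk⟩ := h ε hε
  have hint : ∫⁻ u, ENNReal.ofReal |x u| ≠ ∞ :=
    ((lintegral_abs_le_mixNorm_marcinkiewicz ψ x.measurable.aemeasurable).trans_lt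
      (ENNReal.mul_lt_top ENNReal.ofReal_lt_top hx)).ne
  have hlim := tendsto_setLIntegral_zero hint
    (tendsto_measure_lt_abs (P := (volume : Measure I)) x.measurable.aemeasurable)
  have hpos : 0 < ε * ENNReal.ofReal (ψ.toFun t₀) :=
    ENNReal.mul_pos hε.ne' (ENNReal.ofReal_pos.2 (ψ.pos ht₀.1 ht₀.2)).ne'
  filter_upwards [hlim.eventually_le_const hpos] with n hn
  refine (mixNorm_marcinkiewicz_le_iff ψ).2 fun τ hτ => ?_
  have hms := measurableSet_lt_abs x.measurable n
  rcases le_total τ t₀ with hτ0 | hτ0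
  · refine (kFun_mono (ae_of_all _ fun u => ?_) τ).trans (hk τ ⟨hτ.1, hτ0⟩)
    by_cases hu : (n : ℝ) < |x u| <;> simp [hu]
  · refine (kFun_le_lintegral_abs (x.measurable.indicator hms).aemeasurable τ).trans
      (le_trans (le_of_eq ?_) (hn.trans ?_))
    · rw [← lintegral_indicator hms]
      refine lintegral_congr fun u => ?_
      by_cases hu : (n : ℝ) < |x u| <;> simp [hu]
    · gcongr
      exact ψ.mono ht₀.1.le hτ0 hτ.2

lemma marcinkiewicz_isMixSpace :
    IsMixSpace (marcinkiewiczMix ψ) (marcinkiewiczSpaceZero ψ) (marcinkiewiczNorm ψ) where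
  fundamental := marcinkiewicz_fundamental hψ
  mem_iff := marcinkiewicz_mem_iff hψ
  norm_eq x := by rw [marcinkiewiczNorm, marcinkiewiczENorm_eq]
  lintegral_le := ⟨_, ENNReal.ofReal_ne_top, fun _ hf =>
    lintegral_abs_le_mixNorm_marcinkiewicz ψ hf.aemeasurable⟩

/-- The functions t ↦ ∫₀^t (v n)* satisfy the three conditions of `exists_subseq_tsum_le`: the norm
bound, o(ψ) by order continuity, and uniform smallness, because they are at most Kψ(δ) once the
support has measure at most δ. -/
lemma marcinkiewicz_smallSupportProperty :
    SmallSupportProperty (marcinkiewiczMix ψ) (marcinkiewiczSpaceZero ψ)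
      (marcinkiewiczNorm ψ) := by
  intro x hx _ v hv hvx hv0
  have h := marcinkiewicz_isMixSpace hψ
  obtain ⟨C, hC⟩ := h.bounded_of_weaklyNull hx
  -- The added 1 makes Kψ positive and at least ψ.
  set K : ℝ≥0∞ := ENNReal.ofReal C + 1
  have hK : K ≠ ∞ := by simp [K]
  have hvK : ∀ n, mixNorm (marcinkiewiczMix ψ) volume (v n) ≤ K := fun n =>
    (mixNorm_mono (ae_of_all _ (hvx n))).trans (by
      rw [← h.ofReal_norm (hx.1 n)]
      exact (ENNReal.ofReal_le_ofReal (hC n)).trans le_self_add)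
  have hle := fun n => (mixNorm_marcinkiewicz_le_iff ψ).1 (hvK n)
  obtain ⟨θ, hθ, hsum⟩ := exists_subseq_tsum_le
    (Φ := fun t => K * ENNReal.ofReal (ψ.toFun t)) (F := fun n => kFun volume (v n))
    (fun s hs t ht hst => by
      dsimp only
      gcongr
      exact ψ.mono hs.1.le hst ht.2)
    (fun t ht => ENNReal.mul_pos (by simp [K]) (ENNReal.ofReal_pos.2 (ψ.pos ht.1 ht.2)).ne')
    hle
    (fun n ε hε => by
      have hoc := ((h.mem_iff _).1 (hx.1 n)).mono (ae_of_all _ (hvx n))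
      obtain ⟨t₀, ht₀, hk⟩ := hoc.kFun_marcinkiewicz hψ (hv n) hε
      refine ⟨t₀, ht₀, fun t ht => (hk t ht).trans ?_⟩
      gcongr
      exact le_mul_of_one_le_left zero_le le_add_self)
    (fun ε hε => by
      obtain ⟨e, he0, he⟩ := ENNReal.lt_iff_exists_nnreal_btwn.1 (ENNReal.div_pos hε.ne' hK)
      obtain ⟨δ, hδ, hδ1, hδe⟩ := ψ.exists_le (ε := e) (by simpa using he0)
      filter_upwards [hv0.eventually_le_const (ENNReal.ofReal_pos.2 hδ)] with n hn t _
      refine (kFun_le_of_measure_support_le hn).trans ((hle n δ ⟨hδ, hδ1⟩).trans ?_)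
      refine le_trans ?_ (ENNReal.mul_div_le (a := K) (b := ε))
      gcongr
      refine le_trans ?_ he.le
      rw [← ENNReal.ofReal_coe_nnreal]
      exact ENNReal.ofReal_le_ofReal hδe)
  refine ⟨θ, hθ, 5 * K, ENNReal.mul_ne_top (by simp) hK, fun S => ?_⟩
  refine (mixNorm_marcinkiewicz_le_iff ψ).2 fun τ hτ => ?_
  calc kFun volume (fun u => ∑ k ∈ S, |v (θ k) u|) τ
      ≤ ∑ k ∈ S, kFun volume (fun u => |v (θ k) u|) τ :=
        kFun_sum_le S (fun k => (hv _).abs.aemeasurable) τ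
    _ = ∑ k ∈ S, kFun volume (v (θ k)) τ := by simp [kFun]
    _ ≤ ∑' k, kFun volume (v (θ k)) τ := ENNReal.sum_le_tsum S
    _ ≤ _ := by
        rw [mul_assoc]
        exact hsum τ hτ

end Marcinkiewicz

/-- If `ψ(t) ≤ B t`, then `M(ψ)₀ = {0}`. -/
lemma eq_zero_of_mem_marcinkiewicz {ψ : Psi} {e : ℝ} (he : 0 < e)
    (hψ : ∀ δ ∈ Ioc (0 : ℝ) 1, e * ψ.toFun δ < δ) {x : L0} (hx : x ∈ marcinkiewiczSpaceZero ψ) :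
    x = 0 := by
  -- ∫₀^t x* dominates its chord t∫₀^1 x*, yet it must be o(ψ(t)) = o(t).
  have hmul : ∀ t ∈ Ioc (0 : ℝ) 1,
      ENNReal.ofReal t * kFun volume (x : I → ℝ) 1 ≤ kFun volume (x : I → ℝ) t := fun t ht => by
    have hm : Measurable fun s : ℝ =>
        min ((volume : Measure I) {u | s < |x u|}) (ENNReal.ofReal 1) :=
      Antitone.measurable fun a b hab => min_le_min
        (measure_mono fun u (hu : b < _) => lt_of_le_of_lt hab hu) le_rfl
    rw [kFun, kFun, ← lintegral_const_mul _ hm]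
    refine lintegral_mono fun s => ?_
    rw [mul_min, ENNReal.ofReal_one, mul_one]
    exact min_le_min (mul_le_of_le_one_left zero_le (by simpa using ht.2)) le_rfl
  have h0 : kFun volume (x : I → ℝ) 1 = 0 := by
    refine le_antisymm (ENNReal.le_of_forall_pos_le_add fun η hη _ => ?_) zero_le
    rw [zero_add]
    have hη' : (0 : ℝ≥0∞) < η * ENNReal.ofReal e :=
      ENNReal.mul_pos (by simpa using hη.ne') (ENNReal.ofReal_pos.2 he).ne'
    obtain ⟨t, ht, hk⟩ := (tendsto_marcinkiewiczRatio_iff ψ x).1 hx.2 _ hη'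
    have h1 := (hmul t ht).trans (hk t ⟨ht.1, le_rfl⟩)
    rw [mul_assoc, ← ENNReal.ofReal_mul he.le, mul_comm] at h1
    have h2 := h1.trans (mul_le_mul_right (ENNReal.ofReal_le_ofReal (hψ t ht).le) _)
    exact (ENNReal.mul_le_mul_iff_left (ENNReal.ofReal_pos.2 ht.1).ne'
      ENNReal.ofReal_ne_top).1 h2
  rw [kFun_one x.measurable.aemeasurable,
    lintegral_eq_zero_iff x.measurable.abs.ennreal_ofReal] at h0
  refine AEEqFun.ext ?_
  filter_upwards [h0, AEEqFun.coeFn_zero (β := ℝ) (μ := (volume : Measure I))] with u hu hu0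
  rw [hu0]
  simpa using hu

/-- If t/ψ(t) is bounded below, the space is {0} and its only sequence is p-BS for every p ≥ 1;
otherwise the general theorem applies. -/
theorem gammaI_marcinkiewicz (ψ : Psi) :
    GammaI (marcinkiewiczSpaceZero ψ) (marcinkiewiczNorm ψ) =
      GammaIid (marcinkiewiczSpaceZero ψ) (marcinkiewiczNorm ψ) := by
  by_cases hψ : ∀ e : ℝ, 0 < e → ∃ δ ∈ Ioc (0 : ℝ) 1, δ ≤ e * ψ.toFun δ
  · exact (marcinkiewicz_isMixSpace hψ).gammaI_eq_gammaIid (marcinkiewicz_smallSupportProperty hψ)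
  push Not at hψ
  obtain ⟨e, he, hψ⟩ := hψ
  refine Subset.antisymm (fun p hp => ⟨hp.1, fun x hx hi => hp.2 x hx hi.1⟩) fun p hp => ?_
  refine ⟨hp.1, fun x hx _ => ⟨id, strictMono_id, hx.1, ?_⟩⟩
  have h0 : ∀ n, x n = 0 := fun n => eq_zero_of_mem_marcinkiewicz he hψ (hx.1 n)
  have hN : marcinkiewiczNorm ψ 0 = 0 := by
    rw [marcinkiewiczNorm, marcinkiewiczENorm_eq, mixNorm_congr AEEqFun.coeFn_zero]
    simp [Pi.zero_def, mixNorm_zero]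
  exact ⟨⟨0, fun n => by simp [h0, hN]⟩, fun θ _ => ⟨0, fun m _ => by simp [h0, hN]⟩⟩

/-! ### The Lorentz space -/

/-- The measure which describes the norm of `Λ(ψ)`. -/
noncomputable def lorentzMix (ψ : Psi) : Set (Measure ℝ) :=
  {(volume.restrict (Ioi 0)).map ψ.level}

section Lorentz

variable (ψ : Psi) {Ω : Type*} [MeasurableSpace Ω] {P : Measure Ω} {f : Ω → ℝ}

lemma antitone_measure_lt_abs (P : Measure Ω) (f : Ω → ℝ) :
    Antitone fun s : ℝ => P {ω | s < |f ω|} :=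
  fun _ _ hab => measure_mono fun _ h => lt_of_le_of_lt hab h

lemma measurable_fun'_measure_lt_abs [IsProbabilityMeasure P] :
    Measurable fun s : ℝ => ψ.fun' (P {ω | s < |f ω|}) :=
  Antitone.measurable fun _ _ hab => ψ.fun'_mono (antitone_measure_lt_abs P f hab) prob_le_one

/-- By Tonelli one may first integrate min(P(|f| > s), `ψ.level r`) over r, which gives ψ(P(|f| >
s)). -/
lemma mixNorm_lorentz [IsProbabilityMeasure P] :
    mixNorm (lorentzMix ψ) P f = ∫⁻ s in Ioi 0, ψ.fun' (P {ω | s < |f ω|}) := by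
  have hm := (antitone_measure_lt_abs P f).measurable
  have hl := ψ.measurable_level
  rw [mixNorm, lorentzMix, iSup_singleton, lintegral_map (measurable_kFun P f) hl]
  simp only [kFun]
  rw [lintegral_lintegral_swap]
  · exact lintegral_congr fun s => (ψ.fun'_eq_lintegral_min prob_le_one).symm
  · exact ((hm.comp measurable_snd).min (hl.comp measurable_fst).ennreal_ofReal).aemeasurable

lemma mixFundamental_lorentz {δ : ℝ≥0∞} (hδ : δ ≤ 1) :
    mixFundamental (lorentzMix ψ) δ = ψ.fun' δ := by
  rw [mixFundamental, lorentzMix, iSup_singleton, lintegral_map (by fun_prop) ψ.measurable_level,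
    ψ.fun'_eq_lintegral_min hδ]

lemma Psi.dMeasure_Ioo {d : ℝ} (hd : 0 ≤ d) (hd1 : d ≤ 1) :
    ψ.dMeasure (Ioo 0 d) = ENNReal.ofReal (ψ.toFun d) := by
  have hc : Continuous ψ.stieltjes :=
    ψ.continuousOn'.domRestrict.comp continuous_projIcc
  have h : ∀ t : ℝ, t ∈ Icc (0 : ℝ) 1 → ψ.stieltjes t = ψ.toFun t := fun t ht => by
    change ψ.toFun (projIcc (0 : ℝ) 1 zero_le_one t) = _
    rw [projIcc_of_mem _ ht]
  rw [Psi.dMeasure, StieltjesFunction.measure_Ioo, leftLim_eq_of_tendsto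
    (hc.tendsto d |>.mono_left nhdsWithin_le_nhds), h d ⟨hd, hd1⟩,
    h 0 ⟨le_rfl, zero_le_one⟩, ψ.map_zero', sub_zero]

/-- Layer cake for dψ: the set {x* > s} is the interval (0, d), with d the tail at s, and has
dψ-measure ψ(d). -/
lemma lorentzENorm_eq (x : L0) :
    lorentzENorm ψ x = mixNorm (lorentzMix ψ) volume (x : I → ℝ) := by
  rw [mixNorm_lorentz, lorentzENorm,
    lintegral_eq_lintegral_meas_lt _ (ae_of_all _ (rearrangement_nonneg x))
    (aemeasurable_restrict_of_antitoneOn measurableSet_Ioc (antitoneOn_rearrangement x 1))]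
  refine setLIntegral_congr_fun measurableSet_Ioi fun s (hs : 0 < s) => ?_
  rw [Measure.restrict_apply' measurableSet_Ioc]
  set d := (volume : Measure I) {u | s < |x u|}
  have hd1 : d.toReal ≤ 1 := by
    simpa using ENNReal.toReal_mono (b := 1) (by simp) prob_le_one
  have hd : d ≠ ∞ := measure_ne_top _ _
  rw [Psi.fun', ← ψ.dMeasure_Ioo ENNReal.toReal_nonneg hd1]
  congr 1
  ext t
  simp only [mem_inter_iff, mem_ofPred_eq, mem_Ioc, mem_Ioo]
  refine ⟨fun ⟨h1, h2, _⟩ => ⟨h2, ?_⟩, fun ⟨h1, h2⟩ => ⟨?_, h1, (h2.trans_le hd1).le⟩⟩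
  · exact (ENNReal.ofReal_lt_iff_lt_toReal h2.le hd).1 ((lt_rearrangement_iff x h2 hs.le).1 h1)
  · exact (lt_rearrangement_iff x h1 hs.le).2 ((ENNReal.ofReal_lt_iff_lt_toReal h1.le hd).2 h2)

lemma lorentz_fundamental : FundamentalTendstoZero (lorentzMix ψ) := by
  intro ε hε
  obtain ⟨e, he0, he⟩ := ENNReal.lt_iff_exists_nnreal_btwn.1 hε
  obtain ⟨δ, hδ, hδ1, hδe⟩ := ψ.exists_le (ε := e) (by simpa using he0)
  refine ⟨ENNReal.ofReal δ, ENNReal.ofReal_pos.2 hδ, ?_⟩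
  rw [mixFundamental_lorentz ψ (by simpa using hδ1), ψ.fun'_ofReal hδ.le]
  refine le_trans ?_ he.le
  rw [← ENNReal.ofReal_coe_nnreal]
  exact ENNReal.ofReal_le_ofReal hδe

/-- By dominated convergence in s, finiteness of the norm already implies order continuity. -/
lemma lorentz_mem_iff (x : L0) :
    x ∈ lorentzSpace ψ ↔ HasOCNorm (lorentzMix ψ) volume (x : I → ℝ) := by
  change lorentzENorm ψ x < ∞ ↔ _
  rw [lorentzENorm_eq]
  refine ⟨fun hx => ?_, fun h => h.lt_top (lorentz_fundamental ψ) x.measurable⟩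
  rw [mixNorm_lorentz] at hx
  have h0 := tendsto_measure_lt_abs (P := (volume : Measure I)) x.measurable.aemeasurable
  have hlim := tendsto_lintegral_of_dominated_convergence (μ := volume.restrict (Ioi 0))
    (F := fun (n : ℕ) (s : ℝ) => ψ.fun' ((volume : Measure I) {u | max s n < |x u|}))
    (f := fun _ => 0) (fun s => ψ.fun' ((volume : Measure I) {u | s < |x u|}))
    (fun n => Antitone.measurable fun a b hab => ψ.fun'_mono
      (antitone_measure_lt_abs _ _ (max_le_max_right _ hab)) prob_le_one)
    (fun n => ae_of_all _ fun s => ψ.fun'_mono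
      (antitone_measure_lt_abs _ _ (le_max_left _ _)) prob_le_one)
    hx.ne
    (ae_of_all _ fun s => ψ.tendsto_fun' (tendsto_of_tendsto_of_tendsto_of_le_of_le
      tendsto_const_nhds h0 (fun _ => zero_le)
      (fun n => antitone_measure_lt_abs _ _ (le_max_right _ _))) fun _ => prob_le_one)
  rw [lintegral_zero] at hlim
  refine hlim.congr fun n => ?_
  rw [mixNorm_lorentz]
  refine setLIntegral_congr_fun measurableSet_Ioi fun s hs => ?_
  rw [setOf_lt_abs_indicator hs]

lemma Psi.le_mul_fun' {d : ℝ≥0∞} (hd : d ≤ 1) :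
    d ≤ (ENNReal.ofReal (ψ.toFun 1))⁻¹ * ψ.fun' d := by
  have h1 : ENNReal.ofReal (ψ.toFun 1) ≠ 0 := (ENNReal.ofReal_pos.2 ψ.one_pos).ne'
  have hdt : d ≠ ∞ := (hd.trans_lt (by simp)).ne
  have h2 : ENNReal.ofReal (ψ.toFun 1) * d ≤ ψ.fun' d := by
    conv_lhs => rw [← ENNReal.ofReal_toReal hdt, ← ENNReal.ofReal_mul ψ.one_pos.le, mul_comm]
    exact ENNReal.ofReal_le_ofReal (ψ.mul_one_le ENNReal.toReal_nonneg
      (by simpa using ENNReal.toReal_mono (by simp) hd))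
  rw [mul_comm, ← div_eq_mul_inv, ENNReal.le_div_iff_mul_le (Or.inl h1)
    (Or.inl ENNReal.ofReal_ne_top), mul_comm]
  exact h2

lemma lorentz_isMixSpace :
    IsMixSpace (lorentzMix ψ) (lorentzSpace ψ) (lorentzNorm ψ) where
  fundamental := lorentz_fundamental ψ
  mem_iff := lorentz_mem_iff ψ
  norm_eq x := by rw [lorentzNorm, lorentzENorm_eq]
  lintegral_le := ⟨(ENNReal.ofReal (ψ.toFun 1))⁻¹,
    ENNReal.inv_ne_top.2 (ENNReal.ofReal_pos.2 ψ.one_pos).ne', fun f hf => by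
      rw [lintegral_abs hf.aemeasurable, mixNorm_lorentz,
        ← lintegral_const_mul _ (measurable_fun'_measure_lt_abs ψ)]
      exact lintegral_mono fun s => ψ.le_mul_fun' prob_le_one⟩

/-- The upper part `(|f| - s)⁺` of a function has the norm `∫_s^∞ ψ(P(|f| > t)) dt`. -/
lemma mixNorm_lorentz_excess [IsProbabilityMeasure P] {s : ℝ} :
    mixNorm (lorentzMix ψ) P (fun ω => max (|f ω| - s) 0)
      = ∫⁻ t in Ioi s, ψ.fun' (P {ω | t < |f ω|}) := by
  rw [mixNorm_lorentz, ← setLIntegral_Ioi_add (fun t => ψ.fun' (P {ω | t < |f ω|}))]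
  refine setLIntegral_congr_fun measurableSet_Ioi fun t (ht : 0 < t) => ?_
  congr 2
  ext ω
  simp only [mem_ofPred_eq]
  rw [abs_of_nonneg (le_max_right _ _), lt_max_iff, lt_sub_iff_add_lt, or_iff_left ht.not_gt]

/-- Functions `g` with `∫_S |g| ≤ K ψ(P(S))` define bounded functionals on `Λ(ψ)`. -/
lemma lintegral_mul_le_mixNorm_lorentz [IsProbabilityMeasure P] (hf : Measurable f) {g : Ω → ℝ}
    (hg : AEStronglyMeasurable g P) {K : ℝ≥0∞}
    (hK : ∀ S, MeasurableSet S → ∫⁻ ω in S, ENNReal.ofReal |g ω| ∂P ≤ K * ψ.fun' (P S)) :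
    ∫⁻ ω, ENNReal.ofReal |f ω * g ω| ∂P ≤ K * mixNorm (lorentzMix ψ) P f := by
  have hgm : AEMeasurable (fun ω => ENNReal.ofReal |g ω|) P := hg.aemeasurable.abs.ennreal_ofReal
  have h1 : ∫⁻ ω, ENNReal.ofReal |f ω * g ω| ∂P
      = ∫⁻ ω, ENNReal.ofReal |f ω| ∂(P.withDensity fun ω => ENNReal.ofReal |g ω|) := by
    rw [lintegral_withDensity_eq_lintegral_mul₀ hgm hf.abs.ennreal_ofReal.aemeasurable]
    refine lintegral_congr fun ω => ?_
    rw [Pi.mul_apply, abs_mul, mul_comm, ENNReal.ofReal_mul (abs_nonneg _)]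
  rw [h1, lintegral_abs hf.aemeasurable, mixNorm_lorentz,
    ← lintegral_const_mul _ (measurable_fun'_measure_lt_abs ψ)]
  refine lintegral_mono fun s => ?_
  rw [withDensity_apply _ (measurableSet_lt_abs hf s)]
  exact hK _ (measurableSet_lt_abs hf s)

end Lorentz

/-! ### Norming functionals in the dual of the Lorentz space -/

section Norming

variable (ψ : Psi) {Ω : Type*} [MeasurableSpace Ω] {P : Measure Ω}

/-- For nested sets A j, the function G equals on A j \ A (j+1) the average slope of ψ between the
measures of the preimages of A (j+1) and A j. The integrals over the preimages telescope to values
of ψ. By concavity an increment over a smaller base is larger, so no set S can collect more than ψ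
of its measure. The induction adds one outer layer at a time. The bound on G under ψ(t) ≤ Bt serves
the case where Λ(ψ) is L¹ up to equivalence of norms. -/
lemma Psi.exists_norming [IsProbabilityMeasure P] {y : Ω → ℝ} (hy : Measurable y) (N : ℕ) :
    ∀ A : ℕ → Set ℝ, Antitone A → (∀ j, MeasurableSet (A j)) → A N = ∅ →
    ∃ G : ℝ → ℝ, Measurable G ∧ (∀ z, 0 ≤ G z) ∧ (∃ B, ∀ z, G z ≤ B) ∧
      (∀ B, (∀ t ∈ Icc (0 : ℝ) 1, ψ.toFun t ≤ B * t) → ∀ z, G z ≤ B) ∧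
      (∀ z, z ∉ A 0 → G z = 0) ∧
      (∀ S, MeasurableSet S → ∫ ω in S, G (y ω) ∂P ≤ ψ.toFun (P.real (S ∩ y ⁻¹' A 0))) ∧
      ∀ j, ∫ ω in y ⁻¹' A j, G (y ω) ∂P = ψ.toFun (P.real (y ⁻¹' A j)) := by
  induction N with
  | zero =>
    intro A hA _ hA0
    have h0 : ∀ j, A j = ∅ := fun j => subset_empty_iff.1 ((hA (Nat.zero_le j)).trans hA0.le)
    refine ⟨fun _ => 0, measurable_const, fun _ => le_rfl, ⟨0, fun _ => le_rfl⟩,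
      fun B hB _ => ?_, fun _ _ => rfl, fun S _ => ?_, fun j => ?_⟩
    · simpa using ψ.one_pos.le.trans (hB 1 ⟨zero_le_one, le_rfl⟩)
    · simp [h0, ψ.map_zero']
    · simp [h0, ψ.map_zero']
  | succ N ih =>
    intro A hA hAm hAN
    obtain ⟨G, hGm, hG0, ⟨B, hGB⟩, hGB', hGs, hGle, hGeq⟩ := ih (fun j => A (j + 1))
      (fun a b hab => hA (by lia)) (fun j => hAm _) hAN
    set L := P.real (y ⁻¹' A 1)
    set l := P.real (y ⁻¹' A 0) - L
    have hL0 : 0 ≤ L := measureReal_nonneg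
    have h10 : A 1 ⊆ A 0 := hA zero_le_one
    have hl : 0 ≤ l := sub_nonneg.2 (measureReal_mono (preimage_mono h10))
    have hLl : L + l = P.real (y ⁻¹' A 0) := by ring
    have hLl1 : L + l ≤ 1 := by rw [hLl]; exact measureReal_le_one
    -- For l = 0 the quotient is 0 by convention, consistently with a layer of measure zero.
    set q := (ψ.toFun (L + l) - ψ.toFun L) / l
    have hq : 0 ≤ q := div_nonneg (sub_nonneg.2 (ψ.mono hL0 (by linarith) hLl1)) hl
    have hqB : ∀ B, (∀ t ∈ Icc (0 : ℝ) 1, ψ.toFun t ≤ B * t) → q ≤ B := fun B hB => by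
      rcases hl.eq_or_lt with h | h
      · have : q = 0 := by simp [q, ← h]
        rw [this]
        simpa using ψ.one_pos.le.trans (hB 1 ⟨zero_le_one, le_rfl⟩)
      · have h1 := ψ.increment_le le_rfl hL0 hl le_rfl hLl1
        rw [zero_add, ψ.map_zero', sub_zero] at h1
        exact le_of_mul_le_mul_right (h1.trans (hB l ⟨hl, by linarith⟩)) h
    have hDm : MeasurableSet (A 0 \ A 1) := (hAm 0).diff (hAm 1)
    set G' : ℝ → ℝ := fun z => G z + (A 0 \ A 1).indicator (fun _ => q) z
    have hint : Integrable (fun ω => G (y ω)) P :=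
      Integrable.of_bound (hGm.comp hy).aestronglyMeasurable B
        (ae_of_all _ fun ω => by rw [Real.norm_of_nonneg (hG0 _)]; exact hGB _)
    have hset : ∀ S, MeasurableSet S → ∫ ω in S, G' (y ω) ∂P
        = (∫ ω in S, G (y ω) ∂P) + q * P.real (S ∩ y ⁻¹' (A 0 \ A 1)) := fun S hS => by
      have e : ∀ ω, (A 0 \ A 1).indicator (fun _ => q) (y ω)
          = (y ⁻¹' (A 0 \ A 1)).indicator (fun _ => q) ω := fun ω => rfl
      simp only [G', e]
      rw [integral_add hint.integrableOn ((integrable_const q).indicator (hy hDm)).integrableOn,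
        setIntegral_indicator (hy hDm), setIntegral_const, smul_eq_mul, mul_comm q]
    have hle : ∀ S, MeasurableSet S → P.real (S ∩ y ⁻¹' (A 0 \ A 1))
        = P.real (S ∩ y ⁻¹' A 0) - P.real (S ∩ y ⁻¹' A 1) := fun S hS => by
      rw [preimage_sdiff, inter_sdiff_distrib_left,
        measureReal_sdiff (inter_subset_inter_right _ (preimage_mono h10)) (hS.inter (hy (hAm 1)))]
    have hcase : ∀ z, G' z = G z ∧ (z ∈ A 1 ∨ z ∉ A 0) ∨ G' z = q ∧ z ∈ A 0 := fun z => by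
      by_cases h1 : z ∈ A 0 \ A 1
      · right
        simp [G', h1.1, h1.2, hGs z h1.2]
      · left
        refine ⟨by simp only [G', indicator_of_notMem h1, add_zero], ?_⟩
        by_contra! hc
        exact h1 ⟨hc.2, hc.1⟩
    refine ⟨G', hGm.add (measurable_const.indicator hDm), fun z => ?_, ⟨max B q, fun z => ?_⟩,
      fun B hB z => ?_, fun z hz => ?_, fun S hS => ?_, fun j => ?_⟩
    · rcases hcase z with h | h <;> rw [h.1]
      exacts [hG0 z, hq]
    · rcases hcase z with h | h <;> rw [h.1]
      exacts [(hGB z).trans (le_max_left _ _), le_max_right _ _]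
    · rcases hcase z with h | h <;> rw [h.1]
      exacts [hGB' B hB z, hqB B hB]
    · rcases hcase z with h | h
      · rw [h.1, hGs z fun h1 => hz (h10 h1)]
      · exact absurd h.2 hz
    · rw [hset S hS]
      have h1 := hGle S hS
      have hc0 : 0 ≤ P.real (S ∩ y ⁻¹' (A 0 \ A 1)) := measureReal_nonneg
      -- S meets the outer layer in measure c ≤ l and the inner set in measure at most L, so qc is
      -- at most the increment of ψ available to S.
      have h2 := ψ.increment_le (S := P.real (S ∩ y ⁻¹' A 1))
        (c := P.real (S ∩ y ⁻¹' (A 0 \ A 1))) (l := l) measureReal_nonneg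
        (measureReal_mono inter_subset_right) hc0 (by
          have e := hle univ MeasurableSet.univ
          simp only [univ_inter] at e
          calc _ ≤ P.real (y ⁻¹' (A 0 \ A 1)) := measureReal_mono inter_subset_right
            _ = l := e) hLl1
      have e : P.real (S ∩ y ⁻¹' A 1) + P.real (S ∩ y ⁻¹' (A 0 \ A 1))
          = P.real (S ∩ y ⁻¹' A 0) := by rw [hle S hS]; ring
      rw [e] at h2
      simp only [zero_add] at h1
      linarith
    · rw [hset _ (hy (hAm j)), hle _ (hy (hAm j))]
      rcases j with _ | j
      · have h1 := hGeq 0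
        have h2 : ∫ ω in y ⁻¹' A 0, G (y ω) ∂P = ∫ ω in y ⁻¹' A (0 + 1), G (y ω) ∂P := by
          refine setIntegral_eq_of_subset_of_forall_sdiff_eq_zero (hy (hAm 0))
            (preimage_mono h10) fun ω hω => hGs _ hω.2
        rw [h2, h1, inter_self, inter_eq_right.2 (preimage_mono h10)]
        change ψ.toFun L + q * l = _
        rw [← hLl]
        rcases hl.eq_or_lt with h | h
        · simp [← h]
        · simp only [q]
          field_simp
          ring
      · have hs1 : A (j + 1) ⊆ A 1 := hA (by lia)
        rw [inter_eq_left.2 (preimage_mono hs1), inter_eq_left.2 (preimage_mono (hs1.trans h10)),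
          sub_self, mul_zero, add_zero]
        exact hGeq j

/-- Fewer than z of the positive integers lie below z when z > 0; this bounds by |y| the number of
levels lying below |y|. -/
lemma sum_indicator_le (N : ℕ) {z : ℝ} (hz : 0 ≤ z) :
    ∑ j ∈ Finset.range N, (if (j : ℝ) + 1 < z then (1 : ℝ) else 0) ≤ z := by
  induction N with
  | zero => simpa using hz
  | succ N ih =>
    rw [Finset.sum_range_succ]
    split_ifs with h
    · have h2 : ∑ j ∈ Finset.range N, (if (j : ℝ) + 1 < z then (1 : ℝ) else 0) ≤ N := by
        refine (Finset.sum_le_sum (g := fun _ => (1 : ℝ)) fun j _ => ?_).trans (by simp)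
        split_ifs <;> norm_num
      linarith
    · simpa using ih

lemma lintegral_Ioi_le_tsum {F : ℝ → ℝ≥0∞} (hF : Antitone F) (c : ℝ) :
    ∫⁻ t in Ioi c, F t ≤ ∑' j : ℕ, F (c + j) := by
  have hsub : Ioi c ⊆ ⋃ j : ℕ, Ioc (c + j) (c + j + 1) := fun t (ht : c < t) => by
    obtain ⟨n, hn⟩ : ∃ n, ⌈t - c⌉₊ = n + 1 :=
      ⟨⌈t - c⌉₊ - 1, by have := Nat.ceil_pos.2 (sub_pos.2 ht); lia⟩
    have h1 := (Nat.ceil_eq_iff (by lia)).1 hn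
    simp only [Nat.add_sub_cancel] at h1
    push_cast at h1
    exact mem_iUnion.2 ⟨n, by linarith [h1.1], by linarith [h1.2]⟩
  refine (lintegral_mono_set hsub).trans ((lintegral_iUnion_le _ _).trans
    (ENNReal.tsum_le_tsum fun j => ?_))
  calc ∫⁻ t in Ioc (c + j) (c + j + 1), F t ≤ ∫⁻ _ in Ioc (c + j) (c + j + 1), F (c + j) :=
        setLIntegral_mono' measurableSet_Ioc fun t ht => hF ht.1.le
    _ = F (c + j) := by simp

/-- A function of `y` which nearly norms the part of `y` above the level `c`. -/
lemma Psi.exists_norming_excess [IsProbabilityMeasure P] {y : Ω → ℝ} (hy : Measurable y)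
    (hyi : Integrable y P) {c : ℝ} (hc : 1 ≤ c) {ε : ℝ}
    (hε : ENNReal.ofReal ε < ∫⁻ t in Ioi c, ψ.fun' (P {ω | t < |y ω|})) :
    ∃ h : ℝ → ℝ, Measurable h ∧ (∃ B, ∀ z, |h z| ≤ B) ∧
      (∀ B, (∀ t ∈ Icc (0 : ℝ) 1, ψ.toFun t ≤ B * t) → ∀ z, |h z| ≤ B) ∧
      (∀ S, MeasurableSet S → ∫⁻ ω in S, ENNReal.ofReal |h (y ω)| ∂P
        ≤ ψ.fun' (P (S ∩ {ω | c < |y ω|}))) ∧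
      ε ≤ ∫ ω, y ω * h (y ω) ∂P := by
  have hanti : Antitone fun t : ℝ => ψ.fun' (P {ω | t < |y ω|}) := fun _ _ hab =>
    ψ.fun'_mono (antitone_measure_lt_abs P y hab) prob_le_one
  have h1 := hε.trans_le (lintegral_Ioi_le_tsum hanti c)
  rw [ENNReal.tsum_eq_iSup_nat, lt_iSup_iff] at h1
  obtain ⟨N, hN⟩ := h1
  -- Finitely many levels c + j already push the upper Riemann sum beyond ε; the condition j < N
  -- makes the chain end in ∅.
  set A : ℕ → Set ℝ := fun j => {z | j < N ∧ c + j < |z|}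
  have hAm : ∀ j, MeasurableSet (A j) := fun j =>
    (MeasurableSet.const (j < N)).inter (measurableSet_lt_abs measurable_id (c + j))
  have hAanti : Antitone A := fun a b hab z hz => by
    have : (a : ℝ) ≤ b := by exact_mod_cast hab
    exact ⟨hab.trans_lt hz.1, lt_of_le_of_lt (by linarith) hz.2⟩
  obtain ⟨G, hGm, hG0, ⟨B, hGB⟩, hGB', hGs, hGle, hGeq⟩ := ψ.exists_norming (P := P) hy N A hAanti
    hAm (by ext z; simp [A])
  have habs : ∀ z, |SignType.sign z * G z| ≤ G z := fun z => by
    rw [abs_mul, abs_of_nonneg (hG0 z)]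
    refine mul_le_of_le_one_left (hG0 z) ?_
    rcases lt_trichotomy z 0 with h | h | h <;> simp [h]
  have hmul : ∀ z, z * (SignType.sign z * G z) = |z| * G z := fun z => by
    rw [← mul_assoc, self_mul_sign]
  have hsm : Measurable fun z : ℝ => ((SignType.sign z : SignType) : ℝ) := by
    have : (fun z : ℝ => ((SignType.sign z : SignType) : ℝ))
        = fun z => if 0 < z then 1 else if z < 0 then -1 else 0 := by
      ext z
      rcases lt_trichotomy z 0 with h | h | h <;> simp [h, h.not_gt]
    rw [this]
    exact Measurable.ite measurableSet_Ioi measurable_const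
      (Measurable.ite measurableSet_Iio measurable_const measurable_const)
  have hGi : Integrable (fun ω => G (y ω)) P :=
    Integrable.of_bound (hGm.comp hy).aestronglyMeasurable B
      (ae_of_all _ fun ω => by rw [Real.norm_of_nonneg (hG0 _)]; exact hGB _)
  refine ⟨fun z => SignType.sign z * G z, hsm.mul hGm, ⟨B, fun z => (habs z).trans (hGB z)⟩,
    fun B hB z => (habs z).trans (hGB' B hB z), fun S hS => ?_, ?_⟩
  · calc ∫⁻ ω in S, ENNReal.ofReal |SignType.sign (y ω) * G (y ω)| ∂P
        ≤ ∫⁻ ω in S, ENNReal.ofReal (G (y ω)) ∂P :=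
          lintegral_mono fun ω => ENNReal.ofReal_le_ofReal (habs _)
      _ = ENNReal.ofReal (∫ ω in S, G (y ω) ∂P) :=
          (ofReal_integral_eq_lintegral_ofReal hGi.integrableOn (ae_of_all _ fun ω => hG0 _)).symm
      _ ≤ ENNReal.ofReal (ψ.toFun (P.real (S ∩ y ⁻¹' A 0))) := ENNReal.ofReal_le_ofReal (hGle S hS)
      _ = ψ.fun' (P (S ∩ y ⁻¹' A 0)) := rfl
      _ ≤ _ := ψ.fun'_mono (measure_mono (inter_subset_inter_right _ fun ω hω => by
          simpa using hω.2)) prob_le_one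
  · simp only [hmul]
    have hyG : Integrable (fun ω => |y ω| * G (y ω)) P :=
      hyi.abs.mul_bdd (c := B) (hGm.comp hy).aestronglyMeasurable
        (ae_of_all _ fun ω => by rw [Real.norm_of_nonneg (hG0 _)]; exact hGB _)
    have hind : ∀ j, Integrable (fun ω => (y ⁻¹' A j).indicator (fun ω => G (y ω)) ω) P :=
      fun j => hGi.indicator (hy (hAm j))
    have hψ0 : ∀ s, 0 ≤ ψ.toFun (P.real s) := fun s => ψ.nonneg measureReal_nonneg measureReal_le_one
    -- As c ≥ 1, at most |y| of the levels c + j lie below |y|, so the sum of the indicators times G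
    -- is at most |y|G.
    calc ε ≤ ∑ j ∈ Finset.range N, ψ.toFun (P.real (y ⁻¹' A j)) := by
          rw [← ENNReal.ofReal_le_ofReal_iff (Finset.sum_nonneg fun j _ => hψ0 _),
            ENNReal.ofReal_sum_of_nonneg fun j _ => hψ0 _]
          refine hN.le.trans (le_of_eq (Finset.sum_congr rfl fun j hj => ?_))
          rw [Psi.fun', Measure.real]
          congr 4
          ext ω
          simp [A, Finset.mem_range.1 hj]
      _ = ∫ ω, ∑ j ∈ Finset.range N, (y ⁻¹' A j).indicator (fun ω => G (y ω)) ω ∂P := by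
          rw [integral_finsetSum _ fun j _ => hind j]
          refine Finset.sum_congr rfl fun j _ => ?_
          rw [integral_indicator (hy (hAm j)), hGeq]
      _ ≤ ∫ ω, |y ω| * G (y ω) ∂P := by
          refine integral_mono (integrable_finsetSum _ fun j _ => hind j) hyG fun ω => ?_
          have e : ∀ j ∈ Finset.range N, (y ⁻¹' A j).indicator (fun ω => G (y ω)) ω
              ≤ (if (j : ℝ) + 1 < |y ω| then (1 : ℝ) else 0) * G (y ω) := fun j _ => by
            by_cases hω : ω ∈ y ⁻¹' A j
            · rw [indicator_of_mem hω, if_pos (by linarith [hω.2]), one_mul]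
            · rw [indicator_of_notMem hω]
              exact mul_nonneg (by split_ifs <;> norm_num) (hG0 _)
          refine (Finset.sum_le_sum e).trans ?_
          rw [← Finset.sum_mul]
          exact mul_le_mul_of_nonneg_right (sum_indicator_le N (abs_nonneg _)) (hG0 _)

end Norming

/-! ### Gluing nearly norming functions into one bounded functional -/

section Gluing

lemma ofReal_abs_tsum_sub_le {a : ℕ → ℝ} (ha : ∑' j, ENNReal.ofReal |a j| ≠ ∞) (n : ℕ) :
    ENNReal.ofReal |∑' j, a j - a n| ≤ ∑' j, if j = n then 0 else ENNReal.ofReal |a j| := by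
  have hs : Summable a := (ENNReal.summable_toReal ha).of_norm_bounded fun j => by
    rw [ENNReal.toReal_ofReal (abs_nonneg _), Real.norm_eq_abs]
  rw [hs.tsum_eq_add_tsum_ite n, add_sub_cancel_left, ← Real.enorm_eq_ofReal_abs]
  refine enorm_tsum_le_tsum_enorm.trans (ENNReal.tsum_le_tsum fun j => ?_)
  split_ifs <;> simp [Real.enorm_eq_ofReal_abs]

variable {Ω : Type*} [MeasurableSpace Ω] {P : Measure Ω} {g : ℕ → Ω → ℝ}

lemma ae_tsum_abs_ne_top (hg : ∀ k, Measurable (g k))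
    (hs : ∑' k, ∫⁻ ω, ENNReal.ofReal |g k ω| ∂P ≠ ∞) :
    ∀ᵐ ω ∂P, ∑' k, ENNReal.ofReal |g k ω| ≠ ∞ := by
  have hm : ∀ k, Measurable fun ω => ENNReal.ofReal |g k ω| := fun k => (hg k).abs.ennreal_ofReal
  refine (ae_lt_top (Measurable.tsum hm) ?_).mono fun _ h => h.ne
  rwa [lintegral_tsum fun k => (hm k).aemeasurable]

lemma aestronglyMeasurable_tsum (hg : ∀ k, Measurable (g k)) :
    AEStronglyMeasurable (fun ω => ∑' k, g k ω) P :=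
  (Measurable.tsum hg).aestronglyMeasurable

/-- Clipping to [-B, B] is 1-Lipschitz and fixes w. -/
lemma abs_clip_sub_le {B z w : ℝ} (hw : |w| ≤ B) : |max (-B) (min B z) - w| ≤ |z - w| := by
  have h := abs_le.1 hw
  have e : w = max (-B) (min B w) := by rw [min_eq_right h.2, max_eq_right h.1]
  conv_lhs => rw [e]
  refine (abs_max_sub_max_le_max _ _ _ _).trans ?_
  rw [sub_self, abs_zero, max_eq_right (abs_nonneg _)]
  refine (abs_min_sub_min_le_max _ _ _ _).trans ?_
  rw [sub_self, abs_zero, max_eq_right (abs_nonneg _)]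

variable (ψ : Psi) [IsProbabilityMeasure P]

/-- Sums of subsequences, in the case `ψ(t)/t → ∞` as `t → 0`. -/
lemma Psi.exists_subseq_lintegral_tsum_le
    (hψ : ∀ e : ℝ, 0 < e → ∃ δ ∈ Ioc (0 : ℝ) 1, δ ≤ e * ψ.toFun δ)
    (hg : ∀ k, Measurable (g k)) (hgB : ∀ k, ∃ B, ∀ ω, |g k ω| ≤ B)
    (hgS : ∀ k S, MeasurableSet S → ∫⁻ ω in S, ENNReal.ofReal |g k ω| ∂P ≤ ψ.fun' (P S))
    (hg0 : Tendsto (fun k => ∫⁻ ω, ENNReal.ofReal |g k ω| ∂P) atTop (𝓝 0)) :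
    ∃ θ : ℕ → ℕ, StrictMono θ ∧ ∀ S, MeasurableSet S →
      ∫⁻ ω in S, ∑' k, ENNReal.ofReal |g (θ k) ω| ∂P ≤ 5 * ψ.fun' (P S) := by
  choose B hB using hgB
  -- With t = P(S), the integral of |g k| over S is at most ψ(t), at most the L¹ norm of g k (small
  -- uniformly in t), and at most B k · t (which is o(ψ)): exactly the three conditions needed.
  obtain ⟨θ, hθ, hsum⟩ := exists_subseq_tsum_le
    (Φ := fun t => ENNReal.ofReal (ψ.toFun t))
    (F := fun k t => min (ENNReal.ofReal (ψ.toFun t))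
      (min (∫⁻ ω, ENNReal.ofReal |g k ω| ∂P) (ENNReal.ofReal (B k) * ENNReal.ofReal t)))
    (fun s hs t ht hst => ENNReal.ofReal_le_ofReal (ψ.mono hs.1.le hst ht.2))
    (fun t ht => ENNReal.ofReal_pos.2 (ψ.pos ht.1 ht.2))
    (fun n t _ => min_le_left _ _)
    (fun n ε hε => by
      obtain ⟨e, he0, he⟩ := ENNReal.lt_iff_exists_nnreal_btwn.1 hε
      have he0' : (0 : ℝ) < e := by simpa using he0
      obtain ⟨δ, hδ, hδe⟩ := hψ (e / (|B n| + 1)) (by positivity)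
      refine ⟨δ, hδ, fun t ht => (min_le_right _ _).trans ((min_le_right _ _).trans ?_)⟩
      have hte := Psi.ofReal_le_of_slope hδ.2 hδe ht
      refine le_trans ?_ (mul_le_mul_left he.le _)
      rw [← ENNReal.ofReal_coe_nnreal, ← ENNReal.ofReal_mul e.coe_nonneg,
        ← ENNReal.ofReal_mul' ht.1.le]
      refine ENNReal.ofReal_le_ofReal ?_
      rw [div_mul_eq_mul_div, le_div_iff₀ (by positivity)] at hte
      nlinarith [ht.1, le_abs_self (B n)])
    (fun ε hε => by
      filter_upwards [hg0.eventually_le_const hε] with n hn t _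
      exact (min_le_right _ _).trans ((min_le_left _ _).trans hn))
  refine ⟨θ, hθ, fun S hS => ?_⟩
  rw [lintegral_tsum fun k => (hg _).abs.ennreal_ofReal.aemeasurable]
  have hPt : P S ≠ ∞ := measure_ne_top _ _
  rcases eq_or_ne (P S) 0 with h0 | h0
  · simp [Measure.restrict_eq_zero.2 h0]
  have ht : (P S).toReal ∈ Ioc (0 : ℝ) 1 :=
    ⟨ENNReal.toReal_pos h0 hPt, by simpa using ENNReal.toReal_mono (by simp) prob_le_one⟩
  refine le_trans (ENNReal.tsum_le_tsum fun k => ?_) (hsum _ ht)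
  refine le_min (hgS _ S hS) (le_min (setLIntegral_le_lintegral _ _) ?_)
  rw [ENNReal.ofReal_toReal hPt, ← setLIntegral_const]
  exact lintegral_mono fun ω => ENNReal.ofReal_le_ofReal (hB _ ω)

/-- A function which is close to all terms of a subsequence of `g`. -/
lemma Psi.exists_glue (hg : ∀ k, Measurable (g k)) (hgB : ∀ k, ∃ B, ∀ ω, |g k ω| ≤ B)
    (hgB' : ∀ B, (∀ t ∈ Icc (0 : ℝ) 1, ψ.toFun t ≤ B * t) → ∀ k ω, |g k ω| ≤ B)
    (hgS : ∀ k S, MeasurableSet S → ∫⁻ ω in S, ENNReal.ofReal |g k ω| ∂P ≤ ψ.fun' (P S))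
    (hg0 : Tendsto (fun k => ∫⁻ ω, ENNReal.ofReal |g k ω| ∂P) atTop (𝓝 0))
    {η : ℝ≥0∞} (hη : 0 < η) (hη' : η ≠ ∞) :
    ∃ θ : ℕ → ℕ, StrictMono θ ∧ ∃ G : Ω → ℝ, AEStronglyMeasurable G P ∧
      (∃ K : ℝ≥0∞, K ≠ ∞ ∧ ∀ S, MeasurableSet S →
        ∫⁻ ω in S, ENNReal.ofReal |G ω| ∂P ≤ K * ψ.fun' (P S)) ∧
      (∀ n, ∀ᵐ ω ∂P, ENNReal.ofReal |G ω - g (θ n) ω|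
        ≤ ∑' j, if j = n then 0 else ENNReal.ofReal |g (θ j) ω|) ∧
      ∑' j, ∫⁻ ω, ENNReal.ofReal |g (θ j) ω| ∂P ≤ η := by
  obtain ⟨α, hα, hαη⟩ := extraction_forall_of_eventually (P := fun n k =>
    ∫⁻ ω, ENNReal.ofReal |g k ω| ∂P ≤ η * 2⁻¹ ^ (n + 1)) fun n =>
      hg0.eventually_le_const (ENNReal.mul_pos hη.ne' (ENNReal.pow_pos (by simp) _).ne')
  have hsum : ∑' j, ∫⁻ ω, ENNReal.ofReal |g (α j) ω| ∂P ≤ η := by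
    refine (ENNReal.tsum_le_tsum hαη).trans (le_of_eq ?_)
    rw [ENNReal.tsum_mul_left]
    have := tsum_two_inv_pow_add 0
    simp only [add_zero, pow_zero] at this
    rw [this, mul_one]
  by_cases hψ : ∀ e : ℝ, 0 < e → ∃ δ ∈ Ioc (0 : ℝ) 1, δ ≤ e * ψ.toFun δ
  · obtain ⟨β, hβ, hle⟩ := ψ.exists_subseq_lintegral_tsum_le hψ (g := fun k => g (α k))
      (fun k => hg _) (fun k => hgB _) (fun k => hgS _) (hg0.comp hα.tendsto_atTop)
    have hsum' : ∑' j, ∫⁻ ω, ENNReal.ofReal |g (α (β j)) ω| ∂P ≤ η :=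
      (ENNReal.tsum_comp_le_tsum_of_injective hβ.injective _).trans hsum
    have hne := ne_top_of_le_ne_top hη' hsum'
    refine ⟨α ∘ β, hα.comp hβ, fun ω => ∑' k, g (α (β k)) ω,
      aestronglyMeasurable_tsum fun k => hg _, ⟨5, by simp, fun S hS => ?_⟩, fun n => ?_,
      hsum'⟩
    · refine (lintegral_mono fun ω => ?_).trans (hle S hS)
      rw [← Real.enorm_eq_ofReal_abs]
      simp only [← Real.enorm_eq_ofReal_abs]
      exact enorm_tsum_le_tsum_enorm
    · filter_upwards [ae_tsum_abs_ne_top (fun k => hg _) hne] with ω hω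
      exact ofReal_abs_tsum_sub_le hω n
  -- Now ψ(t) ≤ e⁻¹t, so all g k are bounded by e⁻¹. The glued sum is clipped at this bound, which
  -- does not increase its distance to any g k.
  · push Not at hψ
    obtain ⟨e, he, hψ⟩ := hψ
    have hψB : ∀ t ∈ Icc (0 : ℝ) 1, ψ.toFun t ≤ e⁻¹ * t := fun t ht => by
      rcases ht.1.eq_or_lt with rfl | h
      · simp [ψ.map_zero']
      · rw [inv_mul_eq_div, le_div_iff₀ he, mul_comm]
        exact (hψ t ⟨h, ht.2⟩).le
    have hgB := hgB' _ hψB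
    have hne := ne_top_of_le_ne_top hη' hsum
    have hcont : Continuous fun z : ℝ => max (-e⁻¹) (min e⁻¹ z) := by fun_prop
    refine ⟨α, hα, fun ω => max (-e⁻¹) (min e⁻¹ (∑' k, g (α k) ω)),
      hcont.comp_aestronglyMeasurable (aestronglyMeasurable_tsum fun k => hg _),
      ⟨ENNReal.ofReal e⁻¹ * (ENNReal.ofReal (ψ.toFun 1))⁻¹, ENNReal.mul_ne_top
        ENNReal.ofReal_ne_top (ENNReal.inv_ne_top.2 (ENNReal.ofReal_pos.2 ψ.one_pos).ne'),
        fun S hS => ?_⟩, fun n => ?_, hsum⟩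
    · calc _ ≤ ∫⁻ _ in S, ENNReal.ofReal e⁻¹ ∂P := by
            refine lintegral_mono fun ω => ENNReal.ofReal_le_ofReal (abs_le.2 ⟨le_max_left _ _, ?_⟩)
            have : 0 < e⁻¹ := inv_pos.2 he
            exact max_le (by linarith) (min_le_left _ _)
        _ = ENNReal.ofReal e⁻¹ * P S := setLIntegral_const _ _
        _ ≤ _ := by
            rw [mul_assoc]
            gcongr
            exact ψ.le_mul_fun' prob_le_one
    · filter_upwards [ae_tsum_abs_ne_top (fun k => hg _) hne] with ω hω
      exact (ENNReal.ofReal_le_ofReal (abs_clip_sub_le (hgB _ ω))).trans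
        (ofReal_abs_tsum_sub_le hω n)

end Gluing

/-! ### Uniform smallness of upper parts in Λ(ψ) -/

section LorentzWeaklyNull

variable {ψ : Psi}

/-- The upper parts of the terms of a weakly null sequence of independent functions in `Λ(ψ)`
are eventually uniformly small. -/
lemma lorentz_excess_le {x : ℕ → L0} (hx : WeaklyNull (lorentzSpace ψ) (lorentzNorm ψ) x)
    (hxi : IsIndepSeq x) {ε : ℝ} (hε : 0 < ε) : ∃ s : ℕ, ∀ᶠ n in atTop,
      ∫⁻ t in Ioi (s : ℝ), ψ.fun' ((volume : Measure I) {u | t < |x n u|})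
        ≤ ENNReal.ofReal ε := by
  have hS := lorentz_isMixSpace ψ
  by_contra! hcon
  obtain ⟨φ, hφ, hφε⟩ := extraction_forall_of_frequently fun k : ℕ => hcon (k + 1)
  set y : ℕ → L0 := fun k => x (φ k)
  have hy : WeaklyNull (lorentzSpace ψ) (lorentzNorm ψ) y := hx.subseq hφ
  have hyi : IsIndepSeq y := hxi.subseq hφ
  obtain ⟨C, hC⟩ := hS.bounded_of_weaklyNull hy
  obtain ⟨D, hD, hDle⟩ := hS.lintegral_le
  set K : ℝ≥0∞ := D * ENNReal.ofReal C + 1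
  have hK : K ≠ ∞ := by simp [K, ENNReal.mul_ne_top hD]
  have hK0 : K ≠ 0 := by simp [K]
  have hyK : ∀ k, ∫⁻ u, ENNReal.ofReal |y k u| ≤ K := fun k => by
    refine (hDle _ (y k).measurable).trans (le_trans ?_ le_self_add)
    rw [← hS.ofReal_norm (hy.1 k)]
    gcongr
    exact hC k
  have hyint : ∀ k, Integrable (y k : I → ℝ) volume := fun k =>
    hS.integrable (y k).measurable (hS.lt_top (hy.1 k))
  choose h hh hhB hhB' hhS hhε using fun k : ℕ =>
    ψ.exists_norming_excess (P := (volume : Measure I)) (y k).measurable (hyint k)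
      (c := ((k + 1 : ℕ) : ℝ)) (by push_cast; linarith [k.cast_nonneg (α := ℝ)]) (hφε k)
  -- Each g k depends on y k alone, so it is independent of the other y n.
  set g : ℕ → I → ℝ := fun k u => h k (y k u)
  have hg : ∀ k, Measurable (g k) := fun k => (hh k).comp (y k).measurable
  have htail : Tendsto (fun k : ℕ => (volume : Measure I) {u | ((k + 1 : ℕ) : ℝ) < |y k u|})
      atTop (𝓝 0) := by
    have h1 : Tendsto (fun k : ℕ => K * ((k + 1 : ℕ) : ℝ≥0∞)⁻¹) atTop (𝓝 0) := by
      have := ENNReal.Tendsto.const_mul (a := K)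
        (ENNReal.tendsto_inv_nat_nhds_zero.comp (tendsto_add_atTop_nat 1)) (Or.inr hK)
      rwa [mul_zero] at this
    refine tendsto_of_tendsto_of_tendsto_of_le_of_le tendsto_const_nhds h1 (fun _ => zero_le)
      fun k => ?_
    dsimp only
    rw [← div_eq_mul_inv]
    refine le_trans ?_ (ENNReal.div_le_div_right (hyK k) _)
    have hsub : {u | ((k + 1 : ℕ) : ℝ) < |y k u|}
        ⊆ {u | ((k + 1 : ℕ) : ℝ≥0∞) ≤ ENNReal.ofReal |y k u|} := fun u hu => by
      rw [mem_ofPred_eq, ← ENNReal.ofReal_natCast]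
      exact ENNReal.ofReal_le_ofReal (le_of_lt hu)
    refine le_trans (measure_mono hsub) (meas_ge_le_lintegral_div
      (y k).measurable.abs.ennreal_ofReal.aemeasurable (by simp) (by simp))
  have hg0 : Tendsto (fun k => ∫⁻ u, ENNReal.ofReal |g k u|) atTop (𝓝 0) := by
    refine tendsto_of_tendsto_of_tendsto_of_le_of_le tendsto_const_nhds
      (ψ.tendsto_fun' htail fun _ => prob_le_one) (fun _ => zero_le) fun k => ?_
    have := hhS k univ MeasurableSet.univ
    rwa [univ_inter, Measure.restrict_univ] at this
  -- The L¹ norms of the glued g k sum to at most (ε/2)/K and the y n have L¹ norm at most K, so all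
  -- cross terms together are at most ε/2.
  have hη : 0 < ENNReal.ofReal (ε / 2) / K :=
    ENNReal.div_pos (ENNReal.ofReal_pos.2 (by positivity)).ne' hK
  obtain ⟨θ, hθ, G, hG, ⟨B, hB, hGB⟩, hGg, hsum⟩ := ψ.exists_glue (P := (volume : Measure I)) hg
    (fun k => (hhB k).imp fun B hB u => hB _) (fun B hB k u => hhB' k B hB _)
    (fun k S hS' => (hhS k S hS').trans (ψ.fun'_mono (measure_mono inter_subset_left) prob_le_one))
    hg0 hη (ENNReal.div_ne_top ENNReal.ofReal_ne_top hK0)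
  have hlim := Tendsto.comp (hS.tendsto_integral_of_weaklyNull hy hG hB fun w _ =>
    lintegral_mul_le_mixNorm_lorentz ψ w.measurable hG hGB) hθ.tendsto_atTop
  have hge : ∀ n, ε / 2 ≤ ∫ u, y (θ n) u * G u := fun n => by
    set w : I → ℝ := fun u => y (θ n) u
    have hw : Measurable w := (y (θ n)).measurable
    have hD1 : ∫⁻ u, ENNReal.ofReal |w u * (G u - g (θ n) u)| ≤ ENNReal.ofReal (ε / 2) := by
      have hterm : ∀ j, Measurable fun u => if j = n then 0 else ENNReal.ofReal |g (θ j) u| :=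
        fun j => by
          split_ifs
          exacts [measurable_const, (hg _).abs.ennreal_ofReal]
      calc ∫⁻ u, ENNReal.ofReal |w u * (G u - g (θ n) u)|
          ≤ ∫⁻ u, ∑' j, ENNReal.ofReal |w u|
              * (if j = n then 0 else ENNReal.ofReal |g (θ j) u|) := by
            refine lintegral_mono_ae ?_
            filter_upwards [hGg n] with u hu
            rw [abs_mul, ENNReal.ofReal_mul (abs_nonneg _), ENNReal.tsum_mul_left]
            gcongr
        _ = ∑' j, ∫⁻ u, ENNReal.ofReal |w u|
              * (if j = n then 0 else ENNReal.ofReal |g (θ j) u|) :=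
            lintegral_tsum fun j => (hw.abs.ennreal_ofReal.mul (hterm j)).aemeasurable
        _ ≤ ∑' j, K * ∫⁻ u, ENNReal.ofReal |g (θ j) u| := by
            refine ENNReal.tsum_le_tsum fun j => ?_
            split_ifs with hj
            · simp
            -- Independence factors the cross term into the product of the two L¹ norms.
            have hind := (hyi.indepFun (hθ.injective.ne (Ne.symm hj))).comp
              (φ := fun z : ℝ => ENNReal.ofReal |z|)
              (ψ := fun z : ℝ => ENNReal.ofReal |h (θ j) z|)
              measurable_id.abs.ennreal_ofReal (hh (θ j)).abs.ennreal_ofReal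
            have hmul := lintegral_mul_eq_lintegral_mul_lintegral_of_indepFun
              hw.abs.ennreal_ofReal (hg (θ j)).abs.ennreal_ofReal hind
            refine (le_of_eq hmul).trans ?_
            gcongr
            exact hyK _
        _ ≤ K * (ENNReal.ofReal (ε / 2) / K) := by
            rw [ENNReal.tsum_mul_left]
            gcongr
        _ ≤ ENNReal.ofReal (ε / 2) := ENNReal.mul_div_le
    have hDi : Integrable (fun u => w u * (G u - g (θ n) u)) volume := by
      refine ⟨hw.aestronglyMeasurable.mul (hG.sub (hg _).aestronglyMeasurable), ?_⟩
      rw [hasFiniteIntegral_iff_norm]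
      exact hD1.trans_lt ENNReal.ofReal_lt_top
    have hwg : Integrable (fun u => w u * g (θ n) u) volume := by
      obtain ⟨b, hb⟩ := hhB (θ n)
      exact (hyint _).mul_bdd (c := b) (hg _).aestronglyMeasurable (ae_of_all _ fun u => hb _)
    have hDle2 : |∫ u, w u * (G u - g (θ n) u)| ≤ ε / 2 := by
      have := norm_integral_le_lintegral_norm (μ := (volume : Measure I))
        fun u => w u * (G u - g (θ n) u)
      refine this.trans (ENNReal.toReal_le_of_le_ofReal (by positivity) hD1)
    have e : ∫ u, w u * G u = (∫ u, w u * g (θ n) u) + ∫ u, w u * (G u - g (θ n) u) := by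
      rw [← integral_add hwg hDi]
      congr 1
      ext u
      ring
    have h1 : ε ≤ ∫ u, w u * g (θ n) u := hhε (θ n)
    rw [e]
    linarith [(abs_le.1 hDle2).1]
  linarith [ge_of_tendsto' hlim hge]

/-- |v n| ≤ (|x n| - s)⁺ + s · 1_{v n ≠ 0}: the first term is eventually small in norm by
`lorentz_excess_le`, the second because the supports shrink. So the norms tend to zero, and a
subsequence with norms at most 2^{-k} has sums bounded by 2. -/
lemma lorentz_smallSupportProperty :
    SmallSupportProperty (lorentzMix ψ) (lorentzSpace ψ) (lorentzNorm ψ) := by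
  intro x hx hxi v hv hvx hv0
  have hS := lorentz_isMixSpace ψ
  have hlim : Tendsto (fun n => mixNorm (lorentzMix ψ) volume (v n)) atTop (𝓝 0) := by
    rw [ENNReal.tendsto_nhds_zero]
    intro ε hε
    obtain ⟨e, he0, he⟩ := ENNReal.lt_iff_exists_nnreal_btwn.1 (ENNReal.half_pos hε.ne')
    obtain ⟨s, hs⟩ := lorentz_excess_le hx hxi (ε := e) (by simpa using he0)
    have h2 : Tendsto (fun n => ENNReal.ofReal s
        * mixFundamental (lorentzMix ψ) ((volume : Measure I) {u | v n u ≠ 0})) atTop (𝓝 0) := by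
      have := ENNReal.Tendsto.const_mul (a := ENNReal.ofReal s)
        (hS.fundamental.tendsto hv0) (Or.inr ENNReal.ofReal_ne_top)
      rwa [mul_zero] at this
    filter_upwards [hs, h2.eventually_le_const (ENNReal.half_pos hε.ne')] with n h1 h2
    have hms : MeasurableSet {u | v n u ≠ 0} := hv n (measurableSet_singleton 0).compl
    have hm1 : Measurable fun u => max (|x n u| - s) 0 :=
      ((x n).measurable.abs.sub_const _).max measurable_const
    have hm2 : Measurable ({u | v n u ≠ 0}.indicator fun _ => (s : ℝ)) :=
      measurable_const.indicator hms
    calc mixNorm (lorentzMix ψ) volume (v n)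
        ≤ mixNorm (lorentzMix ψ) volume (fun u => max (|x n u| - s) 0
            + {u | v n u ≠ 0}.indicator (fun _ => (s : ℝ)) u) := by
          refine mixNorm_mono (ae_of_all _ fun u => ?_)
          by_cases hu : v n u = 0
          · simp [hu]
          · rw [indicator_of_mem (show u ∈ {u | v n u ≠ 0} from hu),
              abs_of_nonneg (a := max _ _ + _) (by positivity)]
            linarith [hvx n u, le_max_left (|x n u| - s) 0]
      _ ≤ mixNorm (lorentzMix ψ) volume (fun u => max (|x n u| - s) 0)
            + mixNorm (lorentzMix ψ) volume ({u | v n u ≠ 0}.indicator fun _ => (s : ℝ)) :=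
          mixNorm_add_le hm1.aemeasurable hm2.aemeasurable
      _ ≤ ε / 2 + ε / 2 := by
          gcongr
          · rw [mixNorm_lorentz_excess]
            exact h1.trans (by simpa using he.le)
          · refine (mixNorm_le_of_abs_le (ae_of_all _ fun u => ?_) (measure_mono ?_)).trans h2
            · by_cases hu : v n u = 0 <;> simp [hu]
            · intro u hu
              by_contra hc
              exact hu (indicator_of_notMem hc _)
      _ = ε := ENNReal.add_halves ε
  obtain ⟨θ, hθ, hle⟩ := extraction_forall_of_eventually (P := fun n k =>
    mixNorm (lorentzMix ψ) volume (v k) ≤ 2⁻¹ ^ n) fun n =>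
      hlim.eventually_le_const (ENNReal.pow_pos (by simp) n)
  refine ⟨θ, hθ, 2, by simp, fun S => ?_⟩
  calc mixNorm (lorentzMix ψ) volume (fun u => ∑ k ∈ S, |v (θ k) u|)
      ≤ ∑ k ∈ S, mixNorm (lorentzMix ψ) volume (fun u => |v (θ k) u|) :=
        mixNorm_sum_le S fun k => (hv _).abs.aemeasurable
    _ ≤ ∑ k ∈ S, 2⁻¹ ^ k := Finset.sum_le_sum fun k _ => by
        rw [mixNorm_abs]
        exact hle k
    _ ≤ ∑' k : ℕ, 2⁻¹ ^ k := ENNReal.sum_le_tsum S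
    _ = 2 := by rw [ENNReal.tsum_geometric, ENNReal.one_sub_inv_two, inv_inv]

theorem gammaI_lorentz (ψ : Psi) :
    GammaI (lorentzSpace ψ) (lorentzNorm ψ) = GammaIid (lorentzSpace ψ) (lorentzNorm ψ) :=
  (lorentz_isMixSpace ψ).gammaI_eq_gammaIid lorentz_smallSupportProperty

end LorentzWeaklyNull

theorem mainTheorem10 (ψ : Psi) :
    GammaI (lorentzSpace ψ) (lorentzNorm ψ) = GammaIid (lorentzSpace ψ) (lorentzNorm ψ) ∧
    GammaI (marcinkiewiczSpaceZero ψ) (marcinkiewiczNorm ψ) =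
      GammaIid (marcinkiewiczSpaceZero ψ) (marcinkiewiczNorm ψ) :=
  ⟨gammaI_lorentz ψ, gammaI_marcinkiewicz ψ⟩
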